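/- **Conventions.** A *local dg-algebra* is a dg-algebra $A=\bigoplus_{i\ge 0}A_i$ over $\mathbb Z$ (homological grading, differential $\partial$ of degree $-1$) that is graded commutative ($aa'=(-1)^{|a||a'|}a'a$ for homogeneous $a,a'$, and $a^2=0$ when $|a|$ is odd), such that $A_0$ is a Noetherian local ring, $H_0(A)\neq 0$, and each $H_i(A)$ is finitely generated over $H_0(A)$. Let $\mathfrak m_A=\mathfrak m_{A_0}\oplus A_{\ge1}$ be its homogeneous maximal ideal and $\mathbf k=A/\mathfrak m_A$ its residue field, viewed as a dg-algebra in degree $0$. A quasi-isomorphism $f\colon A\to B$ of local dg-algebras is *local* if $f(\mathfrak m_A)\subseteq\mathfrak m_B$. The local dg-algebra $A$ is *nilpotent* if every $a\in A_{\ge 1}$ satisfies $a^n=0$ for some $n\ge1$, and *derived nilpotent* if there is a local quasi-isomorphism, in one direction or the other, between $A$ and a nilpotent local dg-algebra. A *semifree $\Gamma$-extension* $U=A\langle Y\rangle$ of $A$ is obtained by successively adjoining to $A$ variables $y$ of positive degree that kill cycles $z=\partial(y)$: exterior variables if $|y|$ is odd, and divided power variables with $\partial(y^{(i)})=z\,y^{(i-1)}$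 if $|y|$ is even; here we ask that there are only finitely many variables in each degree. An *acyclic closure* of $\mathbf k$ over $A$ is a local semifree $\Gamma$-extension $U=A\langle Y\rangle$ with a local quasi-isomorphism $U\to\mathbf k$ that restricts to the canonical surjection $A\to\mathbf k$, and that is minimal: $\partial(U)\subseteq\mathfrak m_A U+Y^{(2)}U$, where $Y^{(2)}$ is the ideal generated by the monomials $y_1^{(i_1)}\cdots y_n^{(i_n)}$ with $i_1+\cdots+i_n\ge2$. It exists and is unique up to isomorphism of dg-$A$-algebras. The *$i$-th deviation* $\varepsilon_i^A(\mathbf k)$ is the number of variables of degree $i$ in an acyclic closure of $\mathbf k$ over $A$. **Theorem 4.4.** Let $A$ be a derived nilpotent local dg-algebra with residue field $\mathbf k$, and assume $\varepsilon^A_q(\mathbf k)\neq0$ for some odd integer $q>1$. Then there is an even integer $i>q$ such that $\varepsilon^A_i(\mathbf k)\ne0$. -/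

import Mathlib

universe u v w

/-- A (nonnegatively graded, homologically indexed) graded commutative dg-algebra over `ℤ`:
a graded ring `A = ⨁ i, A_i` which is strictly graded commutative, with a differential of
degree `-1` that squares to zero and satisfies the Leibniz rule. -/
structure CDGA : Type (u + 1) where
  carrier : Type u
  [ring : Ring carrier]
  /-- The homogeneous components `A_i`. -/
  grading : ℕ → AddSubgroup carrier
  [gradedRing : GradedRing grading]
  /-- The differential. -/
  d : carrier →+ carrier
  d_mem : ∀ (i : ℕ) (a : carrier), a ∈ grading (i + 1) → d a ∈ grading i
  d_eq_zero : ∀ a ∈ grading 0, d a = 0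
  d_d : ∀ a, d (d a) = 0
  leibniz : ∀ (i : ℕ) (a b : carrier), a ∈ grading i →
    d (a * b) = d a * b + (-1) ^ i * (a * d b)
  graded_comm : ∀ (i j : ℕ) (a b : carrier), a ∈ grading i → b ∈ grading j →
    a * b = (-1) ^ (i * j) * (b * a)
  sq_eq_zero : ∀ (i : ℕ) (a : carrier), Odd i → a ∈ grading i → a ^ 2 = 0

attribute [instance] CDGA.ring CDGA.gradedRing

namespace CDGA

instance : CoeSort CDGA.{u} (Type u) := ⟨CDGA.carrier⟩

section Basic

variable (A : CDGA.{u})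

/-- The degree zero part `A_0`, as a subring of `A`. -/
def zeroRing : Subring A := SetLike.GradeZero.subring A.grading

theorem mem_zeroRing {a : A} : a ∈ A.zeroRing ↔ a ∈ A.grading 0 := Iff.rfl

instance : CommRing A.zeroRing :=
  { (inferInstance : Ring A.zeroRing) with
    mul_comm := fun a b => Subtype.ext <| by
      simpa using A.graded_comm 0 0 (a : A) (b : A) a.2 b.2 }

/-- The projection `A → A_0`, which is a ring homomorphism with kernel `A_{≥ 1}`. -/
def toZeroRing : A →+* A.zeroRing :=
  (GradedRing.projZeroRingHom A.grading).codRestrict A.zeroRing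
    fun a => (DirectSum.decompose A.grading a 0).2

theorem toZeroRing_of_mem {i : ℕ} (hi : i ≠ 0) {a : A} (ha : a ∈ A.grading i) :
    A.toZeroRing a = 0 :=
  Subtype.ext (DirectSum.decompose_of_mem_ne A.grading ha hi)

/-- The `A_0`-module of cycles of degree `i`. -/
def cycles (i : ℕ) : Submodule A.zeroRing A where
  carrier := {a | a ∈ A.grading i ∧ A.d a = 0}
  add_mem' := fun {a b} ha hb => ⟨add_mem ha.1 hb.1, by rw [map_add, ha.2, hb.2, add_zero]⟩
  zero_mem' := ⟨zero_mem _, map_zero _⟩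
  smul_mem' := fun r a ha => by
    refine ⟨?_, ?_⟩
    · have h := SetLike.mul_mem_graded (A := A.grading) (A.mem_zeroRing.1 r.2) ha.1
      rw [zero_add] at h
      exact h
    · change A.d ((r : A) * a) = 0
      rw [A.leibniz 0 _ _ r.2, A.d_eq_zero _ r.2, ha.2]
      simp

/-- The `A_0`-module of boundaries of degree `i`. -/
def boundaries (i : ℕ) : Submodule A.zeroRing A where
  carrier := {a | ∃ b ∈ A.grading (i + 1), A.d b = a}
  add_mem' := by
    rintro _ _ ⟨a, ha, rfl⟩ ⟨b, hb, rfl⟩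
    exact ⟨a + b, add_mem ha hb, map_add _ _ _⟩
  zero_mem' := ⟨0, zero_mem _, map_zero _⟩
  smul_mem' := by
    rintro r _ ⟨b, hb, rfl⟩
    refine ⟨(r : A) * b, ?_, ?_⟩
    · have h := SetLike.mul_mem_graded (A := A.grading) (A.mem_zeroRing.1 r.2) hb
      rw [zero_add] at h
      exact h
    · change A.d ((r : A) * b) = (r : A) * A.d b
      rw [A.leibniz 0 _ _ r.2, A.d_eq_zero _ r.2]
      simp

theorem toZeroRing_d_mem_boundaries (a : A) : (A.toZeroRing (A.d a) : A) ∈ A.boundaries 0 := by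
  induction a using DirectSum.Decomposition.inductionOn A.grading with
  | zero => simp
  | homogeneous a =>
    rename_i i
    rcases i with _ | _ | i
    · rw [A.d_eq_zero _ a.2, map_zero]
      exact zero_mem _
    · have h := A.d_mem 0 _ a.2
      refine ⟨a, a.2, ?_⟩
      exact (DirectSum.decompose_of_mem_same A.grading h).symm
    · rw [A.toZeroRing_of_mem (Nat.succ_ne_zero i) (A.d_mem (i + 1) _ a.2)]
      exact zero_mem _
  | add a b ha hb =>
    rw [map_add, map_add]
    exact add_mem ha hb

/-- The homology `H_i(A)` as an `A_0`-module. The action of `A_0` factors through the quotient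
ring `H_0(A) = A_0 / ∂(A_1)`. -/
abbrev Homology (i : ℕ) : Type u := A.cycles i ⧸ (A.boundaries i).submoduleOf (A.cycles i)

/-- `A` is a local dg-algebra: `A_0` is a Noetherian local ring, `H_0(A) ≠ 0` and each `H_i(A)`
is finitely generated over `H_0(A)` (equivalently over `A_0`, as `A_0 → H_0(A)` is onto). -/
class IsLocal : Prop where
  isNoetherianRing : IsNoetherianRing A.zeroRing
  isLocalRing : IsLocalRing A.zeroRing
  nontrivial_homology_zero : Nontrivial (A.Homology 0)
  finite_homology : ∀ i, Module.Finite A.zeroRing (A.Homology i)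

attribute [instance] IsLocal.isNoetherianRing IsLocal.isLocalRing

/-- The homogeneous maximal ideal `𝔪_A = 𝔪_{A_0} ⊕ A_{≥ 1}` of a local dg-algebra. -/
def maxIdeal [A.IsLocal] : Ideal A :=
  (IsLocalRing.maximalIdeal A.zeroRing).comap A.toZeroRing

/-- `A` is nilpotent: every element of `A_{≥ 1}` is nilpotent. -/
def IsNil : Prop := ∀ a : A, A.toZeroRing a = 0 → ∃ n : ℕ, 1 ≤ n ∧ a ^ n = 0

end Basic

/-- A morphism of dg-algebras: a homogeneous ring homomorphism of degree zero commuting with the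
differentials. -/
structure Hom (A : CDGA.{u}) (B : CDGA.{v}) where
  toRingHom : A →+* B
  map_mem : ∀ (i : ℕ) (a : A), a ∈ A.grading i → toRingHom a ∈ B.grading i
  map_d : ∀ a : A, toRingHom (A.d a) = B.d (toRingHom a)

/-- A morphism of local dg-algebras maps `𝔪_A` into `𝔪_B`. -/
def Hom.IsLocal {A : CDGA.{u}} {B : CDGA.{v}} [A.IsLocal] [B.IsLocal] (f : Hom A B) : Prop :=
  ∀ a ∈ A.maxIdeal, f.toRingHom a ∈ B.maxIdeal

/-- `f` is a quasi-isomorphism: for every `i`, the map `H_i(A) → H_i(B)` sending the class of a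
cycle `a` to the class of `f a` is injective and surjective. -/
def Hom.IsQuasiIso {A : CDGA.{u}} {B : CDGA.{v}} (f : Hom A B) : Prop :=
  ∀ i : ℕ,
    (∀ a ∈ A.cycles i, f.toRingHom a ∈ B.boundaries i → a ∈ A.boundaries i) ∧
    (∀ b ∈ B.cycles i, ∃ a ∈ A.cycles i, b - f.toRingHom a ∈ B.boundaries i)

/-- `A` is derived nilpotent: there is a local quasi-isomorphism, in one of the two directions,
between `A` and a nilpotent local dg-algebra. -/
def IsDerivedNilpotent (A : CDGA.{u}) [A.IsLocal] : Prop :=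
  ∃ (B : CDGA.{w}) (_ : B.IsLocal), B.IsNil ∧
    ((∃ f : Hom A B, f.IsLocal ∧ f.IsQuasiIso) ∨ (∃ f : Hom B A, f.IsLocal ∧ f.IsQuasiIso))

section OfCommRing

variable (R : Type u) [CommRing R]

/-- The grading of a commutative ring concentrated in degree zero. -/
def trivialGrading (i : ℕ) : AddSubgroup R := if i = 0 then ⊤ else ⊥

theorem mem_trivialGrading_zero (r : R) : r ∈ trivialGrading R 0 := by simp [trivialGrading]

theorem mem_trivialGrading_pos {i : ℕ} (hi : i ≠ 0) {r : R} :
    r ∈ trivialGrading R i ↔ r = 0 := by simp [trivialGrading, hi]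

instance : SetLike.GradedMonoid (trivialGrading R) where
  one_mem := mem_trivialGrading_zero R 1
  mul_mem := by
    intro i j a b ha hb
    by_cases hi : i = 0
    · by_cases hj : j = 0
      · subst hi hj
        exact mem_trivialGrading_zero R _
      · rw [(mem_trivialGrading_pos R hj).1 hb, mul_zero]
        exact zero_mem _
    · rw [(mem_trivialGrading_pos R hi).1 ha, zero_mul]
      exact zero_mem _

instance : DirectSum.Decomposition (trivialGrading R) :=
  DirectSum.Decomposition.ofAddHom (trivialGrading R)
    ((DirectSum.of (fun i => trivialGrading R i) 0).comp
      ((AddMonoidHom.id R).codRestrict (trivialGrading R 0) (mem_trivialGrading_zero R)))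
    (by
      ext r
      simp)
    (by
      ext i x : 2
      by_cases hi : i = 0
      · subst hi
        simp
      · have hx : x = 0 := Subtype.ext ((mem_trivialGrading_pos R hi).1 x.2)
        subst hx
        simp only [map_zero])

instance : GradedRing (trivialGrading R) where

/-- A commutative ring, regarded as a dg-algebra concentrated in degree zero. -/
abbrev ofCommRing : CDGA.{u} where
  carrier := R
  grading := trivialGrading R
  d := 0
  d_mem := fun _ _ _ => zero_mem _
  d_eq_zero := fun _ _ => rfl
  d_d := fun _ => rfl
  leibniz := fun _ _ _ _ => by simp
  graded_comm := fun i j a b ha hb => by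
    by_cases hi : i = 0
    · subst hi
      simp [mul_comm]
    · simp [(mem_trivialGrading_pos R hi).1 ha]
  sq_eq_zero := fun i a hi ha => by
    have : i ≠ 0 := by
      rintro rfl
      simp at hi
    simp [(mem_trivialGrading_pos R this).1 ha]

/-- The degree zero part of `ofCommRing R` is `R`. -/
def zeroRingOfCommRing : R ≃+* (ofCommRing R).zeroRing where
  toFun := fun r => ⟨r, mem_trivialGrading_zero R r⟩
  invFun := fun r => r.1
  left_inv := fun _ => rfl
  right_inv := fun _ => rfl
  map_mul' := fun _ _ => rfl
  map_add' := fun _ _ => rfl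

instance [IsNoetherianRing R] [IsLocalRing R] : (ofCommRing R).IsLocal where
  isNoetherianRing := isNoetherianRing_of_ringEquiv R (zeroRingOfCommRing R)
  isLocalRing := (zeroRingOfCommRing R).isLocalRing
  nontrivial_homology_zero := by
    refine Submodule.Quotient.nontrivial_iff.2 fun h => ?_
    have h1 : (1 : R) ∈ (ofCommRing R).cycles 0 := ⟨mem_trivialGrading_zero R 1, rfl⟩
    have h2 : (⟨(1 : R), h1⟩ : (ofCommRing R).cycles 0) ∈
        ((ofCommRing R).boundaries 0).submoduleOf ((ofCommRing R).cycles 0) := by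
      rw [h]
      trivial
    obtain ⟨b, -, hb⟩ := h2
    exact zero_ne_one (α := R) hb
  finite_homology := fun i => by
    have : IsNoetherianRing (ofCommRing R).zeroRing :=
      isNoetherianRing_of_ringEquiv R (zeroRingOfCommRing R)
    have : Module.Finite (ofCommRing R).zeroRing (ofCommRing R) :=
      ⟨⟨{(1 : ofCommRing R)}, by
        refine eq_top_iff.2 fun r _ => ?_
        refine Submodule.mem_span.2 fun p hp => ?_
        have h := p.smul_mem (zeroRingOfCommRing R r)
          (hp (Finset.mem_coe.2 (Finset.mem_singleton_self _)) : (1 : ofCommRing R) ∈ p)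
        have h' : (zeroRingOfCommRing R r) • (1 : ofCommRing R) = r := mul_one (r : R)
        rwa [h'] at h⟩⟩
    infer_instance

end OfCommRing

section Augmentation

variable (A : CDGA.{u}) [A.IsLocal]

theorem mem_maximalIdeal_of_mem_boundaries {r : A.zeroRing} (hr : (r : A) ∈ A.boundaries 0) :
    r ∈ IsLocalRing.maximalIdeal A.zeroRing := by
  rw [IsLocalRing.mem_maximalIdeal, mem_nonunits_iff]
  intro hu
  obtain ⟨s, hs⟩ := hu.exists_left_inv
  have h1 : (1 : A) ∈ A.boundaries 0 := by
    have h := (A.boundaries 0).smul_mem s hr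
    have h' : s • (r : A) = 1 := congrArg Subtype.val hs
    rwa [h'] at h
  have := IsLocal.nontrivial_homology_zero (A := A)
  refine Submodule.Quotient.nontrivial_iff.1 this (eq_top_iff.2 fun z _ => ?_)
  have h := (A.boundaries 0).smul_mem (⟨z, z.2.1⟩ : A.zeroRing) h1
  have h' : (⟨z, z.2.1⟩ : A.zeroRing) • (1 : A) = z := mul_one (z : A)
  rw [h'] at h
  exact h

/-- The residue field `𝐤` of `A`, as a dg-algebra concentrated in degree zero. -/
noncomputable abbrev residue : CDGA.{u} := ofCommRing (IsLocalRing.ResidueField A.zeroRing)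

/-- The canonical surjection `A → A_0 → 𝐤`. -/
noncomputable def augmentation : Hom A A.residue where
  toRingHom := (IsLocalRing.residue A.zeroRing).comp A.toZeroRing
  map_mem := fun i a ha => by
    by_cases hi : i = 0
    · subst hi
      exact mem_trivialGrading_zero _ _
    · refine (mem_trivialGrading_pos _ hi).2 ?_
      rw [RingHom.comp_apply, A.toZeroRing_of_mem hi ha, map_zero]
  map_d := fun a =>
    (IsLocalRing.residue_eq_zero_iff _).2
      (A.mem_maximalIdeal_of_mem_boundaries (A.toZeroRing_d_mem_boundaries a))

end Augmentation

/-- A semifree `Γ`-extension `U = A⟨Y⟩` of `A`, with variables `Y` in positive degrees, finitely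
many in each degree. As a graded algebra, `U` is the tensor product of `A` with the divided power
algebras on the variables of even degree and the exterior algebras on the variables of odd degree:
the normal monomials `y₁^{(i₁)} ⋯ yₙ^{(iₙ)}` are a basis of `U` over `A`, with exponents at most
`1` at variables of odd degree. The differential extends the one of `A` and satisfies
`∂(y^{(i+1)}) = ∂(y) y^{(i)}`. For degree reasons `∂(y)` lies in `A⟨Y_{<|y|}⟩`, so `U` is obtained
from `A` by successively adjoining the variables, in order of increasing degree. -/
structure GammaExtension (A : CDGA.{u}) : Type (u + 1) where
  U : CDGA.{u}
  /-- The structure map `A → U`. -/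
  incl : Hom A U
  /-- The set of variables. -/
  Y : Type u
  /-- An auxiliary order on the variables, which fixes the signs of the monomials. -/
  [linearOrder : LinearOrder Y]
  /-- The degree of a variable. -/
  deg : Y → ℕ
  deg_pos : ∀ y, 0 < deg y
  finite_deg : ∀ i, Finite {y : Y // deg y = i}
  /-- The divided power `y^{(i)}`; in particular `y^{(1)}` is the variable `y` itself. -/
  dpow : Y → ℕ → U
  dpow_mem : ∀ y i, dpow y i ∈ U.grading (i * deg y)
  dpow_zero : ∀ y, dpow y 0 = 1
  dpow_mul : ∀ y, Even (deg y) → ∀ i j,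
    dpow y i * dpow y j = ((i + j).choose i : U) * dpow y (i + j)
  dpow_odd : ∀ y, Odd (deg y) → ∀ i, 2 ≤ i → dpow y i = 0
  d_dpow : ∀ y, Even (deg y) → ∀ i, U.d (dpow y (i + 1)) = U.d (dpow y 1) * dpow y i
  basis : Function.Bijective
    (fun c : {μ : Y →₀ ℕ // ∀ y, Odd (deg y) → μ y ≤ 1} →₀ A =>
      c.sum fun μ a => incl.toRingHom a *
        ((μ.1.support.sort (· ≤ ·)).map fun y => dpow y (μ.1 y)).prod)

namespace GammaExtension

variable {A : CDGA.{u}} (E : GammaExtension A)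

attribute [instance] GammaExtension.linearOrder

/-- The monomial `y₁^{(i₁)} ⋯ yₙ^{(iₙ)}` with exponents `μ`. -/
noncomputable def monomial (μ : E.Y →₀ ℕ) : E.U :=
  ((μ.support.sort (· ≤ ·)).map fun y => E.dpow y (μ y)).prod

/-- The ideal `Y^{(2)}` of `U` generated by the monomials `y₁^{(i₁)} ⋯ yₙ^{(iₙ)}` with
`i₁ + ⋯ + iₙ ≥ 2`. -/
noncomputable def decomposables : Ideal E.U :=
  Ideal.span {u | ∃ μ : E.Y →₀ ℕ, 2 ≤ (μ.sum fun _ i => i) ∧ E.monomial μ = u}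

/-- `A⟨Y⟩` is minimal: `∂(U) ⊆ 𝔪_A U + Y^{(2)} U`. -/
def IsMinimal [A.IsLocal] : Prop :=
  ∀ u : E.U, E.U.d u ∈ A.maxIdeal.map E.incl.toRingHom ⊔ E.decomposables

end GammaExtension

/-- An acyclic closure of `B` over `A`, for a morphism `p : A → B` of local dg-algebras: a minimal
local semifree `Γ`-extension `U = A⟨Y⟩` of `A` together with a local quasi-isomorphism `U → B`
that restricts to `p` on `A`. -/
structure AcyclicClosure {A : CDGA.{u}} {B : CDGA.{v}} [A.IsLocal] [B.IsLocal] (p : Hom A B) :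
    Type (max (u + 1) v) extends GammaExtension A where
  [isLocal : U.IsLocal]
  isMinimal : toGammaExtension.IsMinimal
  q : Hom U B
  q_isLocal : q.IsLocal
  q_isQuasiIso : q.IsQuasiIso
  q_incl : ∀ a : A, q.toRingHom (incl.toRingHom a) = p.toRingHom a

open Classical in
/-- The `i`-th deviation `ε_i^A(𝐤)`: the number of variables of degree `i` in an acyclic closure
of the residue field `𝐤` over `A`. Acyclic closures of `𝐤` exist and are unique up to isomorphism,
so that the value `0` given for want of one is never used. -/
noncomputable def deviation (A : CDGA.{u}) [A.IsLocal] (i : ℕ) : ℕ :=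
  if h : Nonempty (AcyclicClosure A.augmentation) then
    Nat.card {y : h.some.Y // h.some.deg y = i}
  else 0

end CDGA

/-! Let `U = A⟨Y⟩` be an acyclic closure of `𝐤` and suppose that every variable of degree at least
`q` has odd degree. Choose `y` of degree `q`, let `S` be the set of variables of degree less than
`q`, and put `z = ∂y`, a cycle of even degree `e = q - 1` in `A⟨S⟩`. Two facts about the class of
`z` in the homology of `A⟨S⟩` contradict each other.

No power of `z` is a boundary (`dvar_pow_ne_boundary`). Deform `A⟨S⟩` to `A⟨S⟩[t]` with `t` a cycle
of degree `e`, and adjoin `y` with `∂y = z + t` instead of `z`. The later variables are all odd and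
the deformation extends over each of them: the obstruction to lifting `∂y'` to a cycle is an odd
cycle of smaller degree, and odd cycles of small degree bound in the deformation because they do so
modulo `t`. If `z ^ n` were a boundary, so would be `t ^ n`. Dividing by `t` again and again, with
the same vanishing in odd degrees, would make `1` a boundary.

Some power of `z` is a boundary because `A` is derived nilpotent (`exists_dvar_pow_boundary`). The
argument depends on the residue characteristic.

If it is a prime `p`, then `p = ∂π` with `π` of degree one. The operation `P(x) = x^p - π x^{p-1}
∂x` (`frob`) turns elements of positive even degree into cycles, is multiplicative there, is
additive up to boundaries, and sends divided powers of variables to boundaries. Hence `z^p = P(z)`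
is homologous to `P(a)` for some `a` in `A` (`frob_homologous`). A power of `P(a)` bounds: the pair
`(a^p, a^{p-1} ∂a)` can be transported along a quasi-isomorphism between `A` and a nilpotent algebra
(`exists_frob_pow_boundary`).

If it is zero, the nonzero integers are units of `A` and divided powers are ordinary powers up to
units. Minimality then forces `∂y ∈ 𝔪_A U` for every variable (`dvar_mem_maxSub`): otherwise a chain
derivation extending `∂/∂y'` would detect a variable `y'` in `∂y` modulo `𝔪_A`. Adjoining matching
variables to a quasi-isomorphic nilpotent algebra gives a model of `A⟨S⟩` (`IsNilModel`). There an
element of `𝔪_A A⟨S⟩` becomes a combination of nilpotent elements and of boundaries of degree zero,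
so an even cycle in it is homologous to a nilpotent element. -/

namespace CDGA

/-! ### Graded calculus: homogeneous components, signs and the Leibniz rule. -/

section Basic

variable (C : CDGA.{u})

theorem induction_homogeneous {P : C → Prop} (h0 : P 0) (hom : ∀ i, ∀ a ∈ C.grading i, P a)
    (add : ∀ a b, P a → P b → P (a + b)) (a : C) : P a :=
  DirectSum.Decomposition.inductionOn C.grading h0 (fun {i} m => hom i m m.2) add a

/-- The projection onto the homogeneous component of degree `i`. -/
def pr (i : ℕ) : C →+ C := GradedRing.proj C.grading i

theorem pr_mem (i : ℕ) (a : C) : C.pr i a ∈ C.grading i :=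
  (DirectSum.decompose C.grading a i).2

theorem pr_of_mem {i : ℕ} {a : C} (ha : a ∈ C.grading i) : C.pr i a = a :=
  DirectSum.decompose_of_mem_same C.grading ha

theorem pr_of_mem_ne {i j : ℕ} {a : C} (ha : a ∈ C.grading i) (h : i ≠ j) : C.pr j a = 0 :=
  DirectSum.decompose_of_mem_ne C.grading ha h

theorem eq_zero_of_pr {a : C} (h : ∀ i, C.pr i a = 0) : a = 0 := by
  apply (DirectSum.decompose C.grading).injective
  ext i
  rw [DirectSum.decompose_zero]
  exact h i

theorem eq_zero_of_mem_of_mem {i j : ℕ} {a : C} (h : i ≠ j) (hi : a ∈ C.grading i)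
    (hj : a ∈ C.grading j) : a = 0 := by
  rw [← C.pr_of_mem hi, C.pr_of_mem_ne hj h.symm]

theorem mul_mem {i j : ℕ} {a b : C} (ha : a ∈ C.grading i) (hb : b ∈ C.grading j) :
    a * b ∈ C.grading (i + j) := SetLike.mul_mem_graded ha hb

theorem one_mem : (1 : C) ∈ C.grading 0 := SetLike.one_mem_graded _

theorem pow_mem {i : ℕ} {a : C} (ha : a ∈ C.grading i) (n : ℕ) : a ^ n ∈ C.grading (n * i) := by
  simpa using SetLike.pow_mem_graded n ha

theorem pr_d (i : ℕ) (a : C) : C.pr i (C.d a) = C.d (C.pr (i + 1) a) := by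
  induction a using C.induction_homogeneous with
  | h0 => simp
  | hom j a ha =>
    obtain _ | j := j
    · rw [C.d_eq_zero _ ha, C.pr_of_mem_ne ha (by simp)]; simp
    · by_cases h : j = i
      · subst h; rw [C.pr_of_mem ha, C.pr_of_mem (C.d_mem _ _ ha)]
      · rw [C.pr_of_mem_ne ha (by simpa using h), C.pr_of_mem_ne (C.d_mem _ _ ha) h, map_zero]
  | add a b ha hb => simp only [map_add, ha, hb]

theorem pr_mul_of_mem {i : ℕ} {a : C} (ha : a ∈ C.grading i) (b : C) (n : ℕ) :
    C.pr (i + n) (a * b) = a * C.pr n b := by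
  induction b using C.induction_homogeneous with
  | h0 => simp
  | hom j b hb =>
    by_cases h : j = n
    · subst h; rw [C.pr_of_mem hb, C.pr_of_mem (C.mul_mem ha hb)]
    · rw [C.pr_of_mem_ne hb h, C.pr_of_mem_ne (C.mul_mem ha hb) (by omega), mul_zero]
  | add a b ha hb => simp only [map_add, mul_add, ha, hb]

theorem pr_mul_of_mem_lt {i : ℕ} {a : C} (ha : a ∈ C.grading i) (b : C) {n : ℕ} (hn : n < i) :
    C.pr n (a * b) = 0 := by
  induction b using C.induction_homogeneous with
  | h0 => simp
  | hom j b hb => exact C.pr_of_mem_ne (C.mul_mem ha hb) (by omega)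
  | add a b ha hb => simp only [map_add, mul_add, ha, hb, add_zero]

theorem pr_mul_of_mem_right {i : ℕ} {a : C} (ha : a ∈ C.grading i) (b : C) (n : ℕ) :
    C.pr (n + i) (b * a) = C.pr n b * a := by
  induction b using C.induction_homogeneous with
  | h0 => simp
  | hom j b hb =>
    by_cases h : j = n
    · subst h; rw [C.pr_of_mem hb, C.pr_of_mem (C.mul_mem hb ha)]
    · rw [C.pr_of_mem_ne hb h, C.pr_of_mem_ne (C.mul_mem hb ha) (by omega), zero_mul]
  | add a b ha hb => simp only [map_add, add_mul, ha, hb]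

theorem pr_mul_of_mem_right_lt {i : ℕ} {a : C} (ha : a ∈ C.grading i) (b : C) {n : ℕ}
    (hn : n < i) : C.pr n (b * a) = 0 := by
  induction b using C.induction_homogeneous with
  | h0 => simp
  | hom j b hb => exact C.pr_of_mem_ne (C.mul_mem hb ha) (by omega)
  | add a b ha hb => simp only [map_add, add_mul, ha, hb, add_zero]

/-- The additive map underlying the grading involution. -/
def sgnAdd : C →+ C :=
  (DirectSum.toAddMonoid fun i => ((-1 : ℤ) ^ i) • (C.grading i).subtype).comp
    (DirectSum.decomposeAddEquiv C.grading).toAddMonoidHom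

theorem sgnAdd_of_mem {i : ℕ} {a : C} (ha : a ∈ C.grading i) :
    C.sgnAdd a = (-1) ^ i * a := by
  lift a to C.grading i using ha
  simp [sgnAdd, DirectSum.decompose_coe]

/-- The grading involution `a ↦ (-1)^{|a|} a`. -/
def sgn : C →+* C where
  __ := C.sgnAdd
  map_one' := by simpa using C.sgnAdd_of_mem C.one_mem
  map_mul' a b := by
    change C.sgnAdd (a * b) = C.sgnAdd a * C.sgnAdd b
    induction a using C.induction_homogeneous with
    | h0 => simp
    | hom i a ha =>
      induction b using C.induction_homogeneous with
      | h0 => simp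
      | hom j b hb =>
        rw [C.sgnAdd_of_mem ha, C.sgnAdd_of_mem hb, C.sgnAdd_of_mem (C.mul_mem ha hb), pow_add]
        rcases neg_one_pow_eq_or C i with h | h <;> rcases neg_one_pow_eq_or C j with h' | h' <;>
          rw [h, h'] <;> simp
      | add a b ha hb => simp only [map_add, mul_add, ha, hb]
    | add a b ha hb => simp only [map_add, add_mul, ha, hb]

theorem sgn_of_mem {i : ℕ} {a : C} (ha : a ∈ C.grading i) : C.sgn a = (-1) ^ i * a :=
  C.sgnAdd_of_mem ha

theorem sgn_of_even {i : ℕ} {a : C} (ha : a ∈ C.grading i) (h : Even i) : C.sgn a = a := by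
  rw [C.sgn_of_mem ha, h.neg_one_pow, one_mul]

theorem sgn_of_odd {i : ℕ} {a : C} (ha : a ∈ C.grading i) (h : Odd i) : C.sgn a = -a := by
  rw [C.sgn_of_mem ha, h.neg_one_pow, neg_one_mul]

theorem sgn_mem {i : ℕ} {a : C} (ha : a ∈ C.grading i) : C.sgn a ∈ C.grading i := by
  rw [C.sgn_of_mem ha]
  rcases neg_one_pow_eq_or C i with h | h <;> rw [h]
  · simpa
  · simpa using neg_mem ha

@[simp] theorem sgn_sgn (a : C) : C.sgn (C.sgn a) = a := by
  induction a using C.induction_homogeneous with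
  | h0 => simp
  | hom i a ha =>
    rcases Nat.even_or_odd i with h | h
    · rw [C.sgn_of_even ha h, C.sgn_of_even ha h]
    · rw [C.sgn_of_odd ha h, map_neg, C.sgn_of_odd ha h, neg_neg]
  | add a b ha hb => simp only [map_add, ha, hb]

theorem d_sgn (a : C) : C.d (C.sgn a) = -C.sgn (C.d a) := by
  induction a using C.induction_homogeneous with
  | h0 => simp
  | hom i a ha =>
    obtain _ | i := i
    · rw [C.sgn_of_even ha (by simp), C.d_eq_zero _ ha]; simp
    · have := C.d_mem _ _ ha
      rcases Nat.even_or_odd i with h | h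
      · rw [C.sgn_of_odd ha h.add_one, C.sgn_of_even this h, map_neg]
      · rw [C.sgn_of_even ha h.add_one, C.sgn_of_odd this h, neg_neg]
  | add a b ha hb => simp only [map_add, ha, hb, neg_add]

/-- With the grading involution as the sign, the Leibniz rule is additive in `a`, so no homogeneity
is needed. -/
theorem d_mul (a b : C) : C.d (a * b) = C.d a * b + C.sgn a * C.d b := by
  induction a using C.induction_homogeneous with
  | h0 => simp
  | hom i a ha => rw [C.leibniz i a b ha, C.sgn_of_mem ha, mul_assoc]
  | add a b ha hb => simp only [map_add, add_mul, ha, hb]; abel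

theorem d_one : C.d 1 = 0 := C.d_eq_zero _ C.one_mem

theorem comm_even {i : ℕ} {a : C} (ha : a ∈ C.grading i) (hi : Even i) (b : C) : Commute a b := by
  change a * b = b * a
  induction b using C.induction_homogeneous with
  | h0 => simp
  | hom j b hb => rw [C.graded_comm i j a b ha hb, (hi.mul_right j).neg_one_pow, one_mul]
  | add b c hb hc => rw [mul_add, add_mul, hb, hc]

theorem mul_comm_odd {i : ℕ} {a : C} (ha : a ∈ C.grading i) (hi : Odd i) (b : C) :
    a * b = C.sgn b * a := by
  induction b using C.induction_homogeneous with
  | h0 => simp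
  | hom j b hb =>
    rw [C.graded_comm i j a b ha hb, C.sgn_of_mem hb, mul_assoc]
    rcases Nat.even_or_odd j with h | h
    · rw [(h.mul_left i).neg_one_pow, h.neg_one_pow]
    · rw [(hi.mul h).neg_one_pow, h.neg_one_pow]
  | add b c hb hc => rw [mul_add, map_add, add_mul, hb, hc]

/-- The power `sgn^e` of the grading involution. -/
def sgnPow (e : ℕ) : C →+* C := if Even e then RingHom.id C else C.sgn

theorem sgnPow_even {e : ℕ} (he : Even e) (a : C) : C.sgnPow e a = a := by simp [sgnPow, he]

theorem sgnPow_odd {e : ℕ} (he : Odd e) (a : C) : C.sgnPow e a = C.sgn a := by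
  simp [sgnPow, Nat.not_even_iff_odd.2 he]

theorem sgnPow_mem (e : ℕ) {i : ℕ} {a : C} (ha : a ∈ C.grading i) :
    C.sgnPow e a ∈ C.grading i := by
  rcases Nat.even_or_odd e with h | h
  · rwa [C.sgnPow_even h]
  · rw [C.sgnPow_odd h]; exact C.sgn_mem ha

theorem mul_comm_sgnPow {i : ℕ} {a : C} (ha : a ∈ C.grading i) (b : C) :
    a * b = C.sgnPow i b * a := by
  rcases Nat.even_or_odd i with h | h
  · rw [C.sgnPow_even h, (C.comm_even ha h b).eq]
  · rw [C.sgnPow_odd h, C.mul_comm_odd ha h]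

theorem d_mul_of_even {i : ℕ} {a : C} (ha : a ∈ C.grading i) (hi : Even i) (b : C) :
    C.d (a * b) = C.d a * b + a * C.d b := by rw [C.d_mul, C.sgn_of_even ha hi]

theorem d_mul_of_odd {i : ℕ} {a : C} (ha : a ∈ C.grading i) (hi : Odd i) (b : C) :
    C.d (a * b) = C.d a * b - a * C.d b := by
  rw [C.d_mul, C.sgn_of_odd ha hi, neg_mul, sub_eq_add_neg]

theorem d_mul_cycle {b : C} (a : C) (hb : C.d b = 0) : C.d (a * b) = C.d a * b := by
  rw [C.d_mul, hb, mul_zero, add_zero]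

theorem d_pow_of_even {i : ℕ} {a : C} (ha : a ∈ C.grading i) (hi : Even i) (n : ℕ) :
    C.d (a ^ (n + 1)) = (n + 1 : ℕ) * (a ^ n * C.d a) := by
  induction n with
  | zero => simp
  | succ n ih =>
    rw [pow_succ, C.d_mul_of_even (C.pow_mem ha (n + 1)) (hi.mul_left _), ih]
    have h : C.d a * a = a * C.d a := (C.comm_even ha hi _).eq.symm
    have : a ^ n * C.d a * a = a ^ (n + 1) * C.d a := by rw [mul_assoc, h, ← mul_assoc, pow_succ]
    rw [mul_assoc, this]
    push_cast
    noncomm_ring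

end Basic

/-! ### Morphisms of dg-algebras. -/

namespace Hom

variable {A : CDGA.{u}} {B : CDGA.{v}} {C : CDGA.{w}}

instance : CoeFun (Hom A B) (fun _ => A → B) := ⟨fun f => f.toRingHom⟩

theorem map_add (f : Hom A B) (a b : A) : f (a + b) = f a + f b := f.toRingHom.map_add a b
theorem map_sub (f : Hom A B) (a b : A) : f (a - b) = f a - f b := f.toRingHom.map_sub a b
theorem map_mul (f : Hom A B) (a b : A) : f (a * b) = f a * f b := f.toRingHom.map_mul a b
theorem map_zero (f : Hom A B) : f (0 : A) = 0 := f.toRingHom.map_zero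
theorem map_one (f : Hom A B) : f (1 : A) = 1 := f.toRingHom.map_one
theorem map_neg (f : Hom A B) (a : A) : f (-a) = -f a := f.toRingHom.map_neg a
theorem map_pow (f : Hom A B) (a : A) (n : ℕ) : f (a ^ n) = f a ^ n := f.toRingHom.map_pow a n

/-- The identity morphism. -/
def id (A : CDGA.{u}) : Hom A A := ⟨RingHom.id A, fun _ _ h => h, fun _ => rfl⟩

/-- The composite of two morphisms. -/
def comp (g : Hom B C) (f : Hom A B) : Hom A C where
  toRingHom := g.toRingHom.comp f.toRingHom
  map_mem i a ha := g.map_mem i _ (f.map_mem i a ha)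
  map_d a := by simp [f.map_d, g.map_d]

theorem map_pr (f : Hom A B) (i : ℕ) (a : A) : f (A.pr i a) = B.pr i (f a) := by
  induction a using A.induction_homogeneous with
  | h0 => simp
  | hom j a ha =>
    by_cases h : j = i
    · subst h; rw [A.pr_of_mem ha, B.pr_of_mem (f.map_mem _ _ ha)]
    · rw [A.pr_of_mem_ne ha h, B.pr_of_mem_ne (f.map_mem _ _ ha) h, f.map_zero]
  | add a b ha hb => simp only [_root_.map_add, ha, hb]

theorem map_sgn (f : Hom A B) (a : A) : f (A.sgn a) = B.sgn (f a) := by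
  induction a using A.induction_homogeneous with
  | h0 => simp
  | hom j a ha =>
    rw [A.sgn_of_mem ha, B.sgn_of_mem (f.map_mem _ _ ha)]
    simp
  | add a b ha hb => simp only [_root_.map_add, ha, hb]

theorem map_sgnPow (f : Hom A B) (e : ℕ) (a : A) : f (A.sgnPow e a) = B.sgnPow e (f a) := by
  rcases Nat.even_or_odd e with h | h
  · simp only [A.sgnPow_even h, B.sgnPow_even h]
  · simp only [A.sgnPow_odd h, B.sgnPow_odd h, f.map_sgn]

end Hom

/-- A family of additive subgroups with a compatible family of projections is a decomposition. -/
theorem isInternal_of_proj {M : Type u} [AddCommGroup M] (ℳ : ℕ → AddSubgroup M)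
    (pr : ℕ → M →+ M) (h_same : ∀ i, ∀ m ∈ ℳ i, pr i m = m)
    (h_ne : ∀ i j, i ≠ j → ∀ m ∈ ℳ i, pr j m = 0)
    (h_span : ∀ m, m ∈ AddSubgroup.closure (⋃ i, (ℳ i : Set M))) : DirectSum.IsInternal ℳ := by
  have key : ∀ (x : DirectSum ℕ fun i => ℳ i) (j : ℕ),
      pr j (DirectSum.coeAddMonoidHom ℳ x) = x j := by
    intro x j
    induction x using DirectSum.induction_on with
    | zero => simp
    | of i m =>
      rw [DirectSum.coeAddMonoidHom_of]
      by_cases h : i = j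
      · subst h; rw [h_same i _ m.2, DirectSum.of_eq_same]
      · rw [h_ne i j h _ m.2, DirectSum.of_eq_of_ne _ _ _ (Ne.symm h)]; rfl
    | add x y hx hy => rw [map_add, map_add, hx, hy]; rfl
  constructor
  · intro x y hxy
    ext j
    rw [← key x j, ← key y j, hxy]
  · intro m
    induction h_span m using AddSubgroup.closure_induction with
    | mem m hm =>
      obtain ⟨i, hi⟩ := Set.mem_iUnion.1 hm
      exact ⟨DirectSum.of (fun i => ℳ i) i ⟨m, hi⟩, by rw [DirectSum.coeAddMonoidHom_of]⟩
    | zero => exact ⟨0, map_zero _⟩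
    | add x y _ _ hx hy =>
      obtain ⟨a, rfl⟩ := hx
      obtain ⟨b, rfl⟩ := hy
      exact ⟨a + b, map_add _ _ _⟩
    | neg x _ hx =>
      obtain ⟨a, rfl⟩ := hx
      exact ⟨-a, map_neg _ _⟩

/-! ### Homogeneous dg-subrings. -/

section Sub

variable (C : CDGA.{u}) (S : Subring C)

/-- The grading induced on a subring. -/
def subGrading (i : ℕ) : AddSubgroup S := (C.grading i).comap (S.subtype : S →+ C)

instance : SetLike.GradedMonoid (C.subGrading S) where
  one_mem := C.one_mem
  mul_mem _ _ _ _ ha hb := C.mul_mem ha hb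

theorem subGrading_isInternal (hp : ∀ i, ∀ a ∈ S, C.pr i a ∈ S) :
    DirectSum.IsInternal (C.subGrading S) := by
  refine isInternal_of_proj _ (fun i => ((C.pr i).comp (S.subtype : S →+ C)).codRestrict S
    fun a => hp i a a.2) (fun i m hm => Subtype.ext (C.pr_of_mem hm))
    (fun i j h m hm => Subtype.ext (C.pr_of_mem_ne hm h)) ?_
  intro m
  classical
  have : m = ∑ i ∈ (DirectSum.decompose C.grading (m : C)).support, ⟨C.pr i m, hp i m m.2⟩ := by
    apply Subtype.ext
    rw [AddSubmonoidClass.coe_finsetSum]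
    exact (DirectSum.sum_support_decompose C.grading (m : C)).symm
  rw [this]
  exact sum_mem fun i _ => AddSubgroup.subset_closure (Set.mem_iUnion.2 ⟨i, C.pr_mem i m⟩)

variable (hd : ∀ a ∈ S, C.d a ∈ S) (hp : ∀ i, ∀ a ∈ S, C.pr i a ∈ S)

/-- A homogeneous subring stable under the differential, as a dg-algebra. -/
noncomputable def sub : CDGA.{u} :=
  -- The decomposition is determined by the grading, so choosing it loses nothing.
  letI := (C.subGrading_isInternal S hp).chooseDecomposition
  letI : GradedRing (C.subGrading S) := {}
  { carrier := S
    grading := C.subGrading S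
    d := (C.d.comp (S.subtype : S →+ C)).codRestrict S fun a => hd a a.2
    d_mem := fun i a ha => C.d_mem i a ha
    d_eq_zero := fun a ha => Subtype.ext (C.d_eq_zero a ha)
    d_d := fun a => Subtype.ext (C.d_d a)
    leibniz := fun i a b ha => Subtype.ext <| by
      have h := C.leibniz i a b ha
      have h' : ((((-1) ^ i : S)) : C) = (-1) ^ i := by simp
      rw [← h'] at h
      exact h
    graded_comm := fun i j a b ha hb => Subtype.ext (by simpa using C.graded_comm i j a b ha hb)
    sq_eq_zero := fun i a hi ha => Subtype.ext (by simpa using C.sq_eq_zero i a hi ha) }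

/-- The inclusion of a dg-subalgebra. -/
noncomputable def subIncl : Hom (C.sub S hd hp) C where
  toRingHom := S.subtype
  map_mem _ _ h := h
  map_d _ := rfl

theorem subIncl_injective : Function.Injective (C.subIncl S hd hp) := Subtype.val_injective

theorem mem_range_subIncl {a : C} : (∃ x, C.subIncl S hd hp x = a) ↔ a ∈ S :=
  ⟨fun ⟨x, hx⟩ => hx ▸ x.2, fun h => ⟨⟨a, h⟩, rfl⟩⟩

end Sub

/-! ### Shifted gradings and extensions by a variable of square zero. -/

section Shift

variable (C : CDGA.{u})

/-- The grading of `C` shifted by `e`. -/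
def shift (e i : ℕ) : AddSubgroup C := if e ≤ i then C.grading (i - e) else ⊥

theorem mem_shift {e i : ℕ} {b : C} :
    b ∈ C.shift e i ↔ b = 0 ∨ ∃ k, k + e = i ∧ b ∈ C.grading k := by
  unfold shift
  split_ifs with h
  · constructor
    · intro hb; exact Or.inr ⟨i - e, by omega, hb⟩
    · rintro (rfl | ⟨k, rfl, hb⟩)
      · exact zero_mem _
      · simpa using hb
  · constructor
    · intro hb; exact Or.inl (by simpa using hb)
    · rintro (rfl | ⟨k, rfl, hb⟩)
      · exact zero_mem _
      · omega

theorem mem_shift_add {e k : ℕ} {b : C} (hb : b ∈ C.grading k) : b ∈ C.shift e (k + e) :=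
  C.mem_shift.2 (Or.inr ⟨k, rfl, hb⟩)

/-- The projections for the shifted grading. -/
def prShift (e i : ℕ) : C →+ C := if e ≤ i then C.pr (i - e) else 0

theorem prShift_of_mem {e i : ℕ} {b : C} (hb : b ∈ C.shift e i) : C.prShift e i b = b := by
  unfold prShift shift at *
  split_ifs at * with h
  · exact C.pr_of_mem hb
  · simpa using (show b = 0 by simpa using hb).symm

theorem prShift_of_mem_ne {e i j : ℕ} (h : i ≠ j) {b : C} (hb : b ∈ C.shift e i) :
    C.prShift e j b = 0 := by
  rcases C.mem_shift.1 hb with rfl | ⟨k, rfl, hb'⟩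
  · simp
  · unfold prShift
    split_ifs with h'
    · exact C.pr_of_mem_ne hb' (by omega)
    · rfl

end Shift

section Ext1

/-- The underlying additive group of an extension of `C` by a variable `y` with `y ^ 2 = 0`:
the pair `⟨a, b⟩` stands for `a + b y`. The variable has degree `f + 1`. -/
@[ext] structure Ext1 (C : CDGA.{u}) (f : ℕ) : Type u where
  fst : C
  snd : C

namespace Ext1

variable {C : CDGA.{u}} {f : ℕ}

instance : Zero (Ext1 C f) := ⟨⟨0, 0⟩⟩
instance : One (Ext1 C f) := ⟨⟨1, 0⟩⟩
instance : Add (Ext1 C f) := ⟨fun x y => ⟨x.fst + y.fst, x.snd + y.snd⟩⟩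
instance : Neg (Ext1 C f) := ⟨fun x => ⟨-x.fst, -x.snd⟩⟩
-- The rule `y c = sgnPow (f + 1) c · y` moves the variable to the right of a coefficient; the term
-- in `y ^ 2` is dropped.
instance : Mul (Ext1 C f) :=
  ⟨fun x y => ⟨x.fst * y.fst, x.fst * y.snd + x.snd * C.sgnPow (f + 1) y.fst⟩⟩

@[simp] theorem zero_fst : (0 : Ext1 C f).fst = 0 := rfl
@[simp] theorem zero_snd : (0 : Ext1 C f).snd = 0 := rfl
@[simp] theorem one_fst : (1 : Ext1 C f).fst = 1 := rfl
@[simp] theorem one_snd : (1 : Ext1 C f).snd = 0 := rfl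
@[simp] theorem add_fst (x y : Ext1 C f) : (x + y).fst = x.fst + y.fst := rfl
@[simp] theorem add_snd (x y : Ext1 C f) : (x + y).snd = x.snd + y.snd := rfl
@[simp] theorem neg_fst (x : Ext1 C f) : (-x).fst = -x.fst := rfl
@[simp] theorem neg_snd (x : Ext1 C f) : (-x).snd = -x.snd := rfl
@[simp] theorem mul_fst (x y : Ext1 C f) : (x * y).fst = x.fst * y.fst := rfl
@[simp] theorem mul_snd (x y : Ext1 C f) :
    (x * y).snd = x.fst * y.snd + x.snd * C.sgnPow (f + 1) y.fst := rfl

instance : Ring (Ext1 C f) where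
  add_assoc x y z := by ext <;> simp [add_assoc]
  zero_add x := by ext <;> simp
  add_zero x := by ext <;> simp
  add_comm x y := by ext <;> simp [add_comm]
  neg_add_cancel x := by ext <;> simp
  left_distrib x y z := by ext <;> simp [mul_add]; abel
  right_distrib x y z := by ext <;> simp [add_mul]; abel
  zero_mul x := by ext <;> simp
  mul_zero x := by ext <;> simp
  mul_assoc x y z := by ext <;> simp [mul_add, add_mul, mul_assoc, add_assoc]
  one_mul x := by ext <;> simp
  mul_one x := by ext <;> simp
  nsmul := nsmulRec
  zsmul := zsmulRec

@[simp] theorem sub_fst (x y : Ext1 C f) : (x - y).fst = x.fst - y.fst := by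
  rw [sub_eq_add_neg, add_fst, neg_fst, sub_eq_add_neg]
@[simp] theorem sub_snd (x y : Ext1 C f) : (x - y).snd = x.snd - y.snd := by
  rw [sub_eq_add_neg, add_snd, neg_snd, sub_eq_add_neg]

/-- The grading of `C + C y`. -/
def grading (C : CDGA.{u}) (f i : ℕ) : AddSubgroup (Ext1 C f) where
  carrier := {x | x.fst ∈ C.grading i ∧ x.snd ∈ C.shift (f + 1) i}
  add_mem' hx hy := ⟨add_mem hx.1 hy.1, add_mem hx.2 hy.2⟩
  zero_mem' := ⟨zero_mem _, zero_mem _⟩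
  neg_mem' hx := ⟨neg_mem hx.1, neg_mem hx.2⟩

theorem mem_grading {i : ℕ} {x : Ext1 C f} :
    x ∈ grading C f i ↔ x.fst ∈ C.grading i ∧ x.snd ∈ C.shift (f + 1) i := Iff.rfl

instance : SetLike.GradedMonoid (grading C f) where
  one_mem := ⟨C.one_mem, zero_mem _⟩
  mul_mem := by
    intro i j x y hx hy
    refine ⟨C.mul_mem hx.1 hy.1, add_mem ?_ ?_⟩
    · rcases C.mem_shift.1 hy.2 with h | ⟨k, rfl, h⟩
      · rw [h, mul_zero]; exact zero_mem _
      · rw [← add_assoc]; exact C.mem_shift_add (C.mul_mem hx.1 h)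
    · rcases C.mem_shift.1 hx.2 with h | ⟨k, rfl, h⟩
      · rw [h, zero_mul]; exact zero_mem _
      · have : k + (f + 1) + j = (k + j) + (f + 1) := by omega
        rw [this]; exact C.mem_shift_add (C.mul_mem h (C.sgnPow_mem _ hy.1))

theorem isInternal : DirectSum.IsInternal (grading C f) := by
  let inl : C →+ Ext1 C f := ⟨⟨fun a => ⟨a, 0⟩, rfl⟩, fun a b => by ext <;> simp⟩
  let inr : C →+ Ext1 C f := ⟨⟨fun a => ⟨0, a⟩, rfl⟩, fun a b => by ext <;> simp⟩
  refine isInternal_of_proj _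
    (fun i => ⟨⟨fun x => ⟨C.pr i x.fst, C.prShift (f + 1) i x.snd⟩, by ext <;> simp⟩,
      fun x y => by ext <;> simp⟩)
    (fun i m hm => Ext1.ext (C.pr_of_mem hm.1) (C.prShift_of_mem hm.2))
    (fun i j h m hm => Ext1.ext (C.pr_of_mem_ne hm.1 h) (C.prShift_of_mem_ne h hm.2)) ?_
  intro m
  have h1 : ∀ a, inl a ∈ AddSubgroup.closure (⋃ i, (grading C f i : Set (Ext1 C f))) := by
    intro a
    induction a using C.induction_homogeneous with
    | h0 => rw [map_zero]; exact zero_mem _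
    | hom i a ha =>
      exact AddSubgroup.subset_closure (Set.mem_iUnion.2 ⟨i, ha, zero_mem _⟩)
    | add a b ha hb => rw [map_add]; exact add_mem ha hb
  have h2 : ∀ a, inr a ∈ AddSubgroup.closure (⋃ i, (grading C f i : Set (Ext1 C f))) := by
    intro a
    induction a using C.induction_homogeneous with
    | h0 => rw [map_zero]; exact zero_mem _
    | hom i a ha =>
      exact AddSubgroup.subset_closure (Set.mem_iUnion.2 ⟨i + (f + 1), zero_mem _,
        C.mem_shift_add ha⟩)
    | add a b ha hb => rw [map_add]; exact add_mem ha hb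
  have : m = inl m.fst + inr m.snd := by ext <;> simp [inl, inr]
  rw [this]
  exact add_mem (h1 _) (h2 _)

/-- The differential with `∂ y = z`. -/
def d (C : CDGA.{u}) (f : ℕ) (z : C) : Ext1 C f →+ Ext1 C f where
  toFun x := ⟨C.d x.fst + C.sgn x.snd * z, C.d x.snd⟩
  map_zero' := by ext <;> simp
  map_add' x y := by
    ext <;> simp [add_mul]
    abel

@[simp] theorem d_fst (z : C) (x : Ext1 C f) : (d C f z x).fst = C.d x.fst + C.sgn x.snd * z := rfl
@[simp] theorem d_snd (z : C) (x : Ext1 C f) : (d C f z x).snd = C.d x.snd := rfl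

/-- For `y` of even degree, `∂(y ^ 2) = 2 z y` has to vanish together with `y ^ 2`. Hence the
alternative: either `y` is odd or `z = 0`. The second case serves for dual numbers over `C`, whose
homomorphisms encode derivations. -/
theorem d_mul {z : C} (hz : z ∈ C.grading f) (h : Even f ∨ z = 0) (x y : Ext1 C f) :
    d C f z (x * y) =
      d C f z x * y + ⟨C.sgn x.fst, (-1) ^ (f + 1) * C.sgn x.snd⟩ * d C f z y := by
  rcases h with h | rfl
  · have hz' : ∀ c, z * c = c * z := fun c => (C.comm_even hz h c).eq
    have ho : Odd (f + 1) := h.add_one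
    ext
    · simp only [d_fst, add_fst, mul_fst, mul_snd, C.sgnPow_odd ho, C.d_mul, _root_.map_add, _root_.map_mul,
        C.sgn_sgn, add_mul, mul_add, mul_assoc, hz']
      abel
    · simp only [d_fst, d_snd, add_snd, mul_snd, C.sgnPow_odd ho, C.d_mul, _root_.map_add,
        _root_.map_mul, C.sgn_sgn, add_mul, mul_add, mul_assoc, hz', C.sgn_of_even hz h, C.d_sgn,
        ho.neg_one_pow, neg_mul, one_mul, mul_neg]
      abel
  · rcases Nat.even_or_odd (f + 1) with h | h
    · ext
      · simp [C.d_mul]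
      · simp [C.d_mul, C.sgnPow_even h, h.neg_one_pow]; abel
    · ext
      · simp [C.d_mul]
      · simp [C.d_mul, C.sgnPow_odd h, h.neg_one_pow, C.d_sgn]; abel

/-- The inclusion of `C` in `C + C y`. -/
def inclHom (C : CDGA.{u}) (f : ℕ) : C →+* Ext1 C f where
  toFun a := ⟨a, 0⟩
  map_one' := rfl
  map_zero' := rfl
  map_add' a b := by ext <;> simp
  map_mul' a b := by ext <;> simp

/-- The ring homomorphism out of `C + C y` sending `y` to `η`. -/
def liftHom {D : CDGA.{v}} (g : Hom C D) (η : D) (hη : η ∈ D.grading (f + 1)) (hsq : η * η = 0) :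
    Ext1 C f →+* D where
  toFun x := g x.fst + g x.snd * η
  map_one' := by simp
  map_zero' := by simp
  map_add' x y := by simp [add_mul]; abel
  map_mul' x y := by
    have h1 : η * g y.fst = g (C.sgnPow (f + 1) y.fst) * η := by
      rw [D.mul_comm_sgnPow hη, g.map_sgnPow]
    have h2 : η * (g y.snd * η) = 0 := by
      rw [← mul_assoc, D.mul_comm_sgnPow hη, mul_assoc, hsq, mul_zero]
    simp only [mul_fst, mul_snd, g.map_mul, g.map_add, add_mul, mul_add, mul_assoc, h1, h2]
    simp
    abel

end Ext1

variable (C : CDGA.{u}) (f : ℕ) (z : C) (hz : z ∈ C.grading f) (hdz : C.d z = 0)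
  (h : Even f ∨ z = 0)

/-- The extension `C⟨y | ∂ y = z⟩` of `C` by a variable `y` of degree `f + 1` of square zero. -/
noncomputable def ext1 : CDGA.{u} :=
  letI := (Ext1.isInternal (C := C) (f := f)).chooseDecomposition
  letI : GradedRing (Ext1.grading C f) := {}
  { carrier := Ext1 C f
    grading := Ext1.grading C f
    d := Ext1.d C f z
    d_mem := by
      rintro i x ⟨h1, h2⟩
      refine ⟨add_mem (C.d_mem _ _ h1) ?_, ?_⟩
      · rcases C.mem_shift.1 h2 with h | ⟨k, hk, h⟩
        · simp [h]
        · have : i = k + f := by omega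
          subst this
          exact C.mul_mem (C.sgn_mem h) hz
      · rcases C.mem_shift.1 h2 with h | ⟨k, hk, h⟩
        · simp [h]
        · obtain _ | k := k
          · simp [C.d_eq_zero _ h]
          · have : i = k + (f + 1) := by omega
            subst this
            exact C.mem_shift_add (C.d_mem _ _ h)
    d_eq_zero := by
      rintro x ⟨h1, h2⟩
      rcases C.mem_shift.1 h2 with h | ⟨k, hk, h⟩
      · ext <;> simp [C.d_eq_zero _ h1, h]
      · omega
    d_d := fun x => by
      ext
      · simp [C.d_mul, C.d_d, C.d_sgn, hdz]
      · simp [C.d_d]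
    leibniz := by
      rintro i x y ⟨h1, h2⟩
      have h3 : (-1 : C) ^ (f + 1) * C.sgn x.snd = (-1) ^ i * x.snd := by
        rcases C.mem_shift.1 h2 with h | ⟨k, rfl, h⟩
        · simp [h]
        · rw [C.sgn_of_mem h, ← mul_assoc, ← pow_add, add_comm (f + 1)]
      rw [Ext1.d_mul hz h, C.sgn_of_mem h1, h3, ← mul_assoc]
      congr 2
      rcases neg_one_pow_eq_or C i with h | h <;>
        rcases neg_one_pow_eq_or (Ext1 C f) i with h' | h' <;>
        rcases Nat.even_or_odd i with h'' | h'' <;>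
        simp only [h''.neg_one_pow] <;> ext <;> simp
    graded_comm := by
      rintro i j x y ⟨hx1, hx2⟩ ⟨hy1, hy2⟩
      have key : ∀ {i j : ℕ} {a b : C}, a ∈ C.grading i → b ∈ C.shift (f + 1) j →
          a * b = (-1) ^ (i * j) * (b * C.sgnPow (f + 1) a) := by
        intro i j a b ha hb
        rcases C.mem_shift.1 hb with rfl | ⟨k, rfl, hb'⟩
        · simp
        · rw [C.graded_comm i k a b ha hb']
          rcases Nat.even_or_odd (f + 1) with h | h
          · rw [C.sgnPow_even h, mul_add, pow_add, (h.mul_left i).neg_one_pow, mul_one]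
          · rw [C.sgnPow_odd h, C.sgn_of_mem ha, mul_add, pow_add]
            rcases Nat.even_or_odd i with h' | h'
            · simp [h'.neg_one_pow, (h'.mul_right _).neg_one_pow]
            · simp [h'.neg_one_pow, (h'.mul h).neg_one_pow]
      have e1 := C.graded_comm i j _ _ hx1 hy1
      have e2 := key hx1 hy2
      have e3 := key hy1 hx2
      rw [mul_comm j i] at e3
      rcases Nat.even_or_odd (i * j) with h' | h'
      · simp only [h'.neg_one_pow, one_mul] at e1 e2 e3 ⊢
        ext
        · simp [e1]
        · simp only [Ext1.mul_snd]; rw [e2, e3]; abel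
      · simp only [h'.neg_one_pow, neg_mul, one_mul] at e1 e2 e3 ⊢
        ext
        · simp [e1]
        · simp only [Ext1.mul_snd, Ext1.neg_snd]; rw [e2, e3]; abel
    sq_eq_zero := by
      rintro i x hi ⟨h1, h2⟩
      rw [sq]
      ext
      · simpa [sq] using C.sq_eq_zero i _ hi h1
      · simp only [Ext1.mul_snd, Ext1.zero_snd]
        rcases C.mem_shift.1 h2 with h | ⟨k, rfl, h⟩
        · simp [h]
        · rcases Nat.even_or_odd (f + 1) with h' | h'
          · have hk : Odd k := by
              rcases Nat.even_or_odd k with h3 | h3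
              · exact absurd (h3.add h') (Nat.not_even_iff_odd.2 hi)
              · exact h3
            rw [C.sgnPow_even h', C.mul_comm_odd h1 hi, C.sgn_of_odd h hk]; simp
          · have hk : Even k := by
              rcases Nat.even_or_odd k with h3 | h3
              · exact h3
              · exact absurd (h3.add_odd h') (Nat.not_even_iff_odd.2 hi)
            rw [C.sgnPow_odd h', C.sgn_of_odd h1 hi, mul_neg, (C.comm_even h hk x.fst).eq]; simp }

/-- The inclusion of `C` in `C⟨y⟩`. -/
noncomputable def ext1Incl : Hom C (C.ext1 f z hz hdz h) where
  toRingHom := Ext1.inclHom C f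
  map_mem i a ha := ⟨ha, zero_mem _⟩
  map_d a := by
    change Ext1.inclHom C f (C.d a) = Ext1.d C f z (Ext1.inclHom C f a)
    ext <;> simp [Ext1.inclHom]

/-- The variable `y` of `C⟨y⟩`. -/
noncomputable def ext1Var : C.ext1 f z hz hdz h := (⟨0, 1⟩ : Ext1 C f)

theorem ext1Var_mem : C.ext1Var f z hz hdz h ∈ (C.ext1 f z hz hdz h).grading (f + 1) := by
  refine ⟨zero_mem _, ?_⟩
  have := C.mem_shift_add (e := f + 1) C.one_mem
  rwa [zero_add] at this

theorem d_ext1Var : (C.ext1 f z hz hdz h).d (C.ext1Var f z hz hdz h) =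
    C.ext1Incl f z hz hdz h z := by
  change Ext1.d C f z ⟨0, 1⟩ = Ext1.inclHom C f z
  ext <;> simp [Ext1.inclHom, C.d_one]

/-- The coefficients of an element of `C⟨y⟩`. -/
def ext1Fst : C.ext1 f z hz hdz h →+ C := ⟨⟨Ext1.fst, rfl⟩, fun _ _ => rfl⟩

/-- The coefficient at `y` of an element of `C⟨y⟩`. -/
def ext1Snd : C.ext1 f z hz hdz h →+ C := ⟨⟨Ext1.snd, rfl⟩, fun _ _ => rfl⟩

theorem ext1_eq (x : C.ext1 f z hz hdz h) :
    x = C.ext1Incl f z hz hdz h (C.ext1Fst f z hz hdz h x) +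
      C.ext1Incl f z hz hdz h (C.ext1Snd f z hz hdz h x) * C.ext1Var f z hz hdz h := by
  refine Ext1.ext ?_ ?_ 
  · change x.fst = x.fst + x.snd * 0
    simp
  · change x.snd = 0 + (x.snd * 1 + 0 * C.sgnPow _ 0)
    simp

theorem ext1Fst_add_mul (a b : C) : C.ext1Fst f z hz hdz h (C.ext1Incl f z hz hdz h a +
      C.ext1Incl f z hz hdz h b * C.ext1Var f z hz hdz h) = a := by
  change a + b * 0 = a
  simp

theorem ext1Snd_add_mul (a b : C) : C.ext1Snd f z hz hdz h (C.ext1Incl f z hz hdz h a +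
      C.ext1Incl f z hz hdz h b * C.ext1Var f z hz hdz h) = b := by
  change 0 + (b * 1 + 0 * C.sgnPow _ 0) = b
  simp

/-- The universal property of `C⟨y⟩`. -/
noncomputable def ext1Lift {D : CDGA.{v}} (g : Hom C D) (η : D) (hη : η ∈ D.grading (f + 1))
    (hdη : D.d η = g z) (hsq : η * η = 0) : Hom (C.ext1 f z hz hdz h) D where
  toRingHom := Ext1.liftHom g η hη hsq
  map_mem i x hx := by
    refine add_mem (g.map_mem _ _ hx.1) ?_
    rcases C.mem_shift.1 hx.2 with h | ⟨k, rfl, h⟩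
    · rw [h, g.map_zero, zero_mul]; exact zero_mem _
    · exact D.mul_mem (g.map_mem _ _ h) hη
  map_d x := by
    change g (C.d (Ext1.fst x) + C.sgn (Ext1.snd x) * z) + g (C.d (Ext1.snd x)) * η =
      D.d (g (Ext1.fst x) + g (Ext1.snd x) * η)
    rw [D.d.map_add, D.d_mul, hdη, ← g.map_d, ← g.map_d, ← g.map_sgn, g.map_add, g.map_mul]
    abel

@[simp] theorem ext1Lift_apply {D : CDGA.{v}} (g : Hom C D) (η : D) (hη : η ∈ D.grading (f + 1))
    (hdη : D.d η = g z) (hsq : η * η = 0) (x : C.ext1 f z hz hdz h) :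
    C.ext1Lift f z hz hdz h g η hη hdη hsq x =
      g (C.ext1Fst f z hz hdz h x) + g (C.ext1Snd f z hz hdz h x) * η := rfl

end Ext1

/-! ### Polynomial extensions by a variable of even degree. -/

section PolyExt

open Polynomial

/-- Apply additive maps to the coefficients of a polynomial. -/
noncomputable def coeffMap {R : Type u} [Ring R] (φ : ℕ → R →+ R) : R[X] →+ R[X] where
  toFun p := p.sum fun n c => monomial n (φ n c)
  map_zero' := by simp
  map_add' p q := Polynomial.sum_add_index p q _ (by simp) (by simp)

namespace PolyExt

theorem coeffMap_monomial {R : Type u} [Ring R] (φ : ℕ → R →+ R) (n : ℕ) (c : R) :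
    coeffMap φ (monomial n c) = monomial n (φ n c) :=
  Polynomial.sum_monomial_index c (fun n c => monomial n (φ n c)) (by simp)

theorem coeff_coeffMap {R : Type u} [Ring R] (φ : ℕ → R →+ R) (p : R[X]) (n : ℕ) :
    (coeffMap φ p).coeff n = φ n (p.coeff n) := by
  induction p using Polynomial.induction_on' with
  | add p q hp hq => simp only [map_add, coeff_add, hp, hq]
  | monomial m c =>
    rw [coeffMap_monomial, coeff_monomial, coeff_monomial]
    split_ifs with h
    · rw [h]
    · simp

variable {C : CDGA.{u}} {f : ℕ}

/-- The grading of `C[X]` with `X` in degree `f + 1`. -/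
def grading (C : CDGA.{u}) (f i : ℕ) : AddSubgroup C[X] where
  carrier := {p | ∀ n, p.coeff n ∈ C.shift (n * (f + 1)) i}
  add_mem' hx hy n := by rw [coeff_add]; exact add_mem (hx n) (hy n)
  zero_mem' n := by rw [coeff_zero]; exact zero_mem _
  neg_mem' hx n := by rw [coeff_neg]; exact neg_mem (hx n)

theorem mem_grading {i : ℕ} {p : C[X]} :
    p ∈ grading C f i ↔ ∀ n, p.coeff n ∈ C.shift (n * (f + 1)) i := Iff.rfl

theorem monomial_mem {k : ℕ} {c : C} (hc : c ∈ C.grading k) (n : ℕ) :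
    monomial n c ∈ grading C f (k + n * (f + 1)) := by
  intro m
  rw [coeff_monomial]
  split_ifs with h
  · subst h; exact C.mem_shift_add hc
  · exact zero_mem _

theorem grading_induction {i : ℕ} {P : C[X] → Prop} (zero : P 0)
    (mon : ∀ k n, ∀ c ∈ C.grading k, k + n * (f + 1) = i → P (monomial n c))
    (add : ∀ p q, P p → P q → P (p + q)) {p : C[X]} (hp : p ∈ grading C f i) : P p := by
  rw [p.as_sum_support]
  refine Finset.sum_induction _ P add zero fun n _ => ?_
  rcases C.mem_shift.1 (hp n) with h | ⟨k, hk, h⟩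
  · rwa [h, monomial_zero_right]
  · exact mon k n _ h hk

instance : SetLike.GradedMonoid (grading C f) where
  one_mem := by
    have := monomial_mem (f := f) C.one_mem 0
    simpa using this
  mul_mem := by
    intro i j p q hp hq
    refine grading_induction (P := fun p => p * q ∈ grading C f (i + j)) (by simp) ?_
      (fun p p' h h' => by rw [add_mul]; exact add_mem h h') hp
    intro k n c hc hk
    refine grading_induction (P := fun q => monomial n c * q ∈ grading C f (i + j)) (by simp) ?_
      (fun p p' h h' => by rw [mul_add]; exact add_mem h h') hq
    intro k' n' c' hc' hk'
    rw [monomial_mul_monomial]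
    have := monomial_mem (f := f) (C.mul_mem hc hc') (n + n')
    have h : k + k' + (n + n') * (f + 1) = i + j := by rw [← hk, ← hk']; ring
    rwa [h] at this

theorem isInternal : DirectSum.IsInternal (grading C f) := by
  refine isInternal_of_proj _
    (fun i => coeffMap fun n => C.prShift (n * (f + 1)) i)
    (fun i m hm => ?_) (fun i j h m hm => ?_) ?_
  · ext n; rw [coeff_coeffMap, C.prShift_of_mem (hm n)]
  · ext n; rw [coeff_coeffMap, C.prShift_of_mem_ne h (hm n), coeff_zero]
  · intro p
    induction p using Polynomial.induction_on' with
    | add p q hp hq => exact add_mem hp hq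
    | monomial m c =>
      induction c using C.induction_homogeneous with
      | h0 => rw [map_zero]; exact zero_mem _
      | hom i a ha =>
        exact AddSubgroup.subset_closure (Set.mem_iUnion.2 ⟨_, monomial_mem ha m⟩)
      | add a b ha hb => rw [map_add]; exact add_mem ha hb

/-- The differential of `C[X]` with `∂ X = z`. -/
noncomputable def d (C : CDGA.{u}) (z : C) : C[X] →+ C[X] where
  toFun p := coeffMap (fun _ => C.d) p + derivative (p.map C.sgn) * Polynomial.C z
  map_zero' := by simp
  map_add' p q := by simp [add_mul]; abel

theorem d_monomial (z : C) (n : ℕ) (c : C) : d C z (monomial n c) =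
    monomial n (C.d c) + monomial (n - 1) (C.sgn c * n * z) := by
  change coeffMap _ _ + derivative _ * _ = _
  rw [coeffMap_monomial, map_monomial, derivative_monomial, monomial_mul_C]

theorem coeffMap_d_mul (p q : C[X]) : coeffMap (fun _ => C.d) (p * q) =
    coeffMap (fun _ => C.d) p * q + p.map C.sgn * coeffMap (fun _ => C.d) q := by
  induction p using Polynomial.induction_on' with
  | add p q hp hq => simp only [_root_.map_add, add_mul, hp, hq, Polynomial.map_add]; abel
  | monomial m c =>
    induction q using Polynomial.induction_on' with
    | add p q hp hq => simp only [_root_.map_add, mul_add, hp, hq]; abel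
    | monomial n e =>
      simp only [monomial_mul_monomial, coeffMap_monomial, map_monomial, C.d_mul,
        _root_.map_add]

theorem comm_C {z : C} (hz : z ∈ C.grading f) (hf : Odd f) (p : C[X]) :
    Polynomial.C z * p = p.map C.sgn * Polynomial.C z := by
  ext n
  rw [coeff_C_mul, coeff_mul_C, coeff_map, C.mul_comm_odd hz hf]

theorem d_mul {z : C} (hz : z ∈ C.grading f) (hf : Odd f) (p q : C[X]) :
    d C z (p * q) = d C z p * q + p.map C.sgn * d C z q := by
  change coeffMap _ _ + derivative _ * _ = (coeffMap _ _ + derivative _ * _) * _ +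
    _ * (coeffMap _ _ + derivative _ * _)
  rw [coeffMap_d_mul, Polynomial.map_mul, derivative_mul]
  simp only [add_mul, mul_add, mul_assoc, comm_C hz hf]
  abel

theorem graded_comm (hf : Odd f) {i j : ℕ} {p q : C[X]} (hp : p ∈ grading C f i)
    (hq : q ∈ grading C f j) : p * q = (-1) ^ (i * j) * (q * p) := by
  refine grading_induction (f := f)
    (P := fun p => p * q = (-1) ^ (i * j) * (q * p)) (by simp) ?_
    (fun p p' h h' => by rw [add_mul, h, h', mul_add, mul_add]) hp
  intro k n c hc hk
  refine grading_induction (f := f)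
    (P := fun q => monomial n c * q = (-1) ^ (i * j) * (q * monomial n c)) (by simp) ?_
    (fun p p' h h' => by rw [mul_add, h, h', add_mul, mul_add]) hq
  intro k' n' c' hc' hk'
  have hn : Even (n * (f + 1)) := hf.add_one.mul_left n
  have hn' : Even (n' * (f + 1)) := hf.add_one.mul_left n'
  rw [monomial_mul_monomial, monomial_mul_monomial, C.graded_comm _ _ _ _ hc hc', add_comm n',
    ← hk, ← hk']
  have h : (k + n * (f + 1)) * (k' + n' * (f + 1)) =
    k * k' + (k * (n' * (f + 1)) + n * (f + 1) * (k' + n' * (f + 1))) := by ring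
  rw [h, pow_add _ (k * k'), ((hn'.mul_left k).add (hn.mul_right _)).neg_one_pow, mul_one]
  rcases Nat.even_or_odd (k * k') with h | h
  · simp only [h.neg_one_pow, one_mul]
  · simp only [h.neg_one_pow, neg_one_mul, map_neg]

end PolyExt

variable (C : CDGA.{u}) (f : ℕ) (z : C) (hz : z ∈ C.grading f) (hdz : C.d z = 0) (hf : Odd f)

/-- The polynomial extension `C[y | ∂ y = z]` by a variable `y` of even degree `f + 1`. -/
noncomputable def polyExt : CDGA.{u} :=
  letI := (PolyExt.isInternal (C := C) (f := f)).chooseDecomposition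
  letI : GradedRing (PolyExt.grading C f) := {}
  { carrier := C[X]
    grading := PolyExt.grading C f
    d := PolyExt.d C z
    d_mem := by
      intro i p hp
      refine PolyExt.grading_induction (f := f)
        (P := fun p => PolyExt.d C z p ∈ PolyExt.grading C f i)
        (by simp) ?_ (fun p p' h h' => by rw [map_add]; exact add_mem h h') hp
      intro k n c hc hk
      rw [PolyExt.d_monomial]
      refine add_mem ?_ ?_
      · obtain _ | k := k
        · rw [C.d_eq_zero _ hc, map_zero]; exact zero_mem _
        · have := PolyExt.monomial_mem (f := f) (C.d_mem _ _ hc) n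
          rwa [show k + n * (f + 1) = i by omega] at this
      · obtain _ | n := n
        · simp
        · have h : C.sgn c * ((n + 1 : ℕ) : C) * z ∈ C.grading (k + f) := by
            rw [← nsmul_eq_mul', smul_mul_assoc]
            exact nsmul_mem (C.mul_mem (C.sgn_mem hc) hz) _
          have := PolyExt.monomial_mem (f := f) h n
          rwa [show k + f + n * (f + 1) = i by rw [add_mul] at hk; omega] at this
    d_eq_zero := by
      intro p hp
      refine PolyExt.grading_induction (f := f) (P := fun p => PolyExt.d C z p = 0)
        (by simp) ?_ (fun p p' h h' => by rw [map_add, h, h', add_zero]) hp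
      intro k n c hc hk
      obtain ⟨rfl, h⟩ := Nat.add_eq_zero_iff.1 hk
      obtain rfl : n = 0 := by simpa using h
      rw [PolyExt.d_monomial, C.d_eq_zero _ hc]
      simp
    d_d := fun p => by
      -- The second derivative term of `∂∂` carries the factor `z ^ 2`, which vanishes since `z` has
      -- odd degree.
      have hzz : z * z = 0 := by rw [← sq]; exact C.sq_eq_zero _ _ hf hz
      induction p using Polynomial.induction_on' with
      | add p q hp hq => rw [map_add, map_add, hp, hq, add_zero]
      | monomial n c =>
        rw [PolyExt.d_monomial, map_add, PolyExt.d_monomial, PolyExt.d_monomial, C.d_d, map_zero,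
          zero_add, ← add_assoc, ← map_add]
        have e1 : C.sgn (C.d c) * n * z + C.d (C.sgn c * n * z) = 0 := by
          rw [C.d_mul_cycle _ hdz, ← nsmul_eq_mul', ← nsmul_eq_mul', map_nsmul, C.d_sgn]
          simp
        have e2 : C.sgn (C.sgn c * n * z) * ((n - 1 : ℕ) : C) * z = 0 := by
          rw [map_mul, C.sgn_of_odd hz hf, mul_assoc, mul_assoc, (Nat.cast_commute (n - 1) z).eq,
            ← mul_assoc (-z), neg_mul, hzz]
          simp
        rw [e1, e2]
        simp
    leibniz := by
      intro i p q hp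
      rw [PolyExt.d_mul hz hf, ← mul_assoc]
      congr 2
      refine PolyExt.grading_induction (f := f)
        (P := fun p => p.map C.sgn = (-1) ^ i * p) (by simp) ?_
        (fun p p' h h' => by rw [Polynomial.map_add, h, h', mul_add]) hp
      intro k n c hc hk
      have hn : Even (n * (f + 1)) := hf.add_one.mul_left n
      rw [map_monomial, ← hk, pow_add, hn.neg_one_pow, mul_one]
      rcases Nat.even_or_odd k with h | h
      · rw [C.sgn_of_even hc h, h.neg_one_pow, one_mul]
      · rw [C.sgn_of_odd hc h, h.neg_one_pow, neg_one_mul, map_neg]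
    graded_comm := fun i j p q hp hq => PolyExt.graded_comm hf hp hq
    sq_eq_zero := by
      intro i p hi hp
      rw [sq]
      refine (PolyExt.grading_induction (f := f)
        (P := fun p => p ∈ PolyExt.grading C f i ∧ p * p = 0) (by simp) ?_ ?_ hp).2
      · intro k n c hc hk
        have hn : Even (n * (f + 1)) := hf.add_one.mul_left n
        have hk' : Odd k := by
          rcases Nat.even_or_odd k with h | h
          · exact absurd (hk ▸ h.add hn) (Nat.not_even_iff_odd.2 hi)
          · exact h
        refine ⟨hk ▸ PolyExt.monomial_mem hc n, ?_⟩
        rw [monomial_mul_monomial, ← sq c, C.sq_eq_zero _ _ hk' hc, map_zero]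
      · rintro p p' ⟨h1, h2⟩ ⟨h3, h4⟩
        refine ⟨add_mem h1 h3, ?_⟩
        rw [add_mul, mul_add, mul_add, h2, h4, PolyExt.graded_comm hf h1 h3,
          (hi.mul hi).neg_one_pow]
        simp }

/-- The inclusion of `C` in `C[y]`. -/
noncomputable def polyExtIncl : Hom C (C.polyExt f z hz hdz hf) where
  toRingHom := (Polynomial.C : C →+* C[X])
  map_mem i a ha := by
    have := PolyExt.monomial_mem (f := f) ha 0
    rwa [zero_mul, add_zero] at this
  map_d a := by
    change monomial 0 (C.d a) = PolyExt.d C z (monomial 0 a)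
    rw [PolyExt.d_monomial]
    simp

/-- The variable `y` of `C[y]`. -/
noncomputable def polyExtVar : C.polyExt f z hz hdz hf := (Polynomial.X : C[X])

theorem polyExtVar_mem :
    C.polyExtVar f z hz hdz hf ∈ (C.polyExt f z hz hdz hf).grading (f + 1) := by
  have := PolyExt.monomial_mem (f := f) C.one_mem 1
  rwa [zero_add, one_mul] at this

theorem d_polyExtVar : (C.polyExt f z hz hdz hf).d (C.polyExtVar f z hz hdz hf) =
    C.polyExtIncl f z hz hdz hf z := by
  change PolyExt.d C z (monomial 1 1) = Polynomial.C z
  rw [PolyExt.d_monomial, C.d_one]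
  simp

/-- The coefficient at `y ^ n` of an element of `C[y]`. -/
noncomputable def polyExtCoeff (n : ℕ) : C.polyExt f z hz hdz hf →+ C :=
  ⟨⟨fun p : C[X] => p.coeff n, coeff_zero n⟩, fun p q : C[X] => coeff_add p q n⟩

theorem polyExt_eq (p : C.polyExt f z hz hdz hf) : ∃ n, p = ∑ i ∈ Finset.range n,
    C.polyExtIncl f z hz hdz hf (C.polyExtCoeff f z hz hdz hf i p) *
      C.polyExtVar f z hz hdz hf ^ i :=
  ⟨Polynomial.natDegree (p : C[X]) + 1, Polynomial.as_sum_range_C_mul_X_pow (p : C[X])⟩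

theorem polyExtCoeff_sum (n : ℕ) (c : ℕ → C) {j : ℕ} (hj : j < n) :
    C.polyExtCoeff f z hz hdz hf j (∑ i ∈ Finset.range n, C.polyExtIncl f z hz hdz hf (c i) *
      C.polyExtVar f z hz hdz hf ^ i) = c j := by
  change (∑ i ∈ Finset.range n, Polynomial.C (c i) * X ^ i : C[X]).coeff j = c j
  rw [finsetSum_coeff]
  simp [hj]

/-- The universal property of `C[y]`. -/
noncomputable def polyExtLift {D : CDGA.{v}} (g : Hom C D) (η : D) (hη : η ∈ D.grading (f + 1))
    (hdη : D.d η = g z) : Hom (C.polyExt f z hz hdz hf) D where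
  toRingHom := Polynomial.eval₂RingHom' g.toRingHom η
    fun a => (D.comm_even hη hf.add_one (g a)).symm
  map_mem i p hp := by
    refine PolyExt.grading_induction (f := f)
      (P := fun p => Polynomial.eval₂RingHom' g.toRingHom η _ p ∈ D.grading i)
      (by simp) ?_ (fun p p' h h' => by rw [map_add]; exact add_mem h h') hp
    intro k n c hc hk
    change Polynomial.eval₂ _ _ _ ∈ _
    rw [eval₂_monomial, ← hk]
    exact D.mul_mem (g.map_mem _ _ hc) (D.pow_mem hη n)
  map_d p := by
    change Polynomial.eval₂ g.toRingHom η (PolyExt.d C z p) =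
      D.d (Polynomial.eval₂ g.toRingHom η p)
    induction p using Polynomial.induction_on' with
    | add p q hp hq => rw [map_add, eval₂_add, hp, hq, eval₂_add, map_add]
    | monomial n c =>
      rw [PolyExt.d_monomial, eval₂_add, eval₂_monomial, eval₂_monomial, eval₂_monomial, D.d_mul,
        g.map_d, ← g.map_sgn]
      obtain _ | n := n
      · simp [D.d_one]
      · rw [D.d_pow_of_even hη hf.add_one, hdη]
        have h : η ^ n * g z = g z * η ^ n :=
          (D.comm_even (D.pow_mem hη n) (hf.add_one.mul_left n) _).eq
        rw [Nat.add_sub_cancel, h, g.map_mul, g.map_mul]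
        simp [mul_assoc]

theorem polyExtLift_incl {D : CDGA.{v}} (g : Hom C D) (η : D) (hη : η ∈ D.grading (f + 1))
    (hdη : D.d η = g z) (c : C) :
    C.polyExtLift f z hz hdz hf g η hη hdη (C.polyExtIncl f z hz hdz hf c) = g c :=
  Polynomial.eval₂_C _ _

theorem polyExtLift_var {D : CDGA.{v}} (g : Hom C D) (η : D) (hη : η ∈ D.grading (f + 1))
    (hdη : D.d η = g z) :
    C.polyExtLift f z hz hdz hf g η hη hdη (C.polyExtVar f z hz hdz hf) = η :=
  Polynomial.eval₂_X _ _

end PolyExt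

/-- Equality up to sign. -/
def SignEq {R : Type u} [Ring R] (a b : R) : Prop := a = b ∨ a = -b

namespace SignEq

variable {R : Type u} [Ring R] {a b c : R}

theorem refl (a : R) : SignEq a a := Or.inl rfl

theorem symm (h : SignEq a b) : SignEq b a := by
  rcases h with rfl | rfl
  · exact refl _
  · exact Or.inr (neg_neg b).symm

theorem trans (h : SignEq a b) (h' : SignEq b c) : SignEq a c := by
  rcases h with rfl | rfl
  · exact h'
  · rcases h' with rfl | rfl
    · exact Or.inr rfl
    · exact Or.inl (neg_neg c)

theorem mul_left (h : SignEq a b) (c : R) : SignEq (c * a) (c * b) := by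
  rcases h with rfl | rfl
  · exact refl _
  · exact Or.inr (mul_neg c b)

theorem mul_right (h : SignEq a b) (c : R) : SignEq (a * c) (b * c) := by
  rcases h with rfl | rfl
  · exact refl _
  · exact Or.inr (neg_mul b c)

theorem exists_zsmul (h : SignEq a b) : ∃ n : ℤ, a = n • b := by
  rcases h with rfl | rfl
  · exact ⟨1, (one_zsmul a).symm⟩
  · exact ⟨-1, by simp⟩

theorem mem {S : Type v} [SetLike S R] [NegMemClass S R] {s : S} (h : SignEq a b) (hb : b ∈ s) :
    a ∈ s := by
  rcases h with rfl | rfl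
  · exact hb
  · exact neg_mem hb

end SignEq

theorem signEq_comm (C : CDGA.{u}) {i j : ℕ} {a b : C} (ha : a ∈ C.grading i)
    (hb : b ∈ C.grading j) : SignEq (a * b) (b * a) := by
  rw [C.graded_comm i j a b ha hb]
  rcases neg_one_pow_eq_or C (i * j) with h | h <;> rw [h]
  · exact Or.inl (one_mul _)
  · exact Or.inr (neg_one_mul _)

/-! ### Monomials, coefficients and subalgebras of a `Γ`-extension. -/

namespace GammaExtension

variable {A : CDGA.{u}} (E : GammaExtension A)

theorem prod_perm (μ : E.Y → ℕ) {l l' : List E.Y} (h : l.Perm l') :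
    SignEq (l.map fun y => E.dpow y (μ y)).prod (l'.map fun y => E.dpow y (μ y)).prod := by
  induction h with
  | nil => exact SignEq.refl _
  | cons x _ ih =>
    simp only [List.map_cons, List.prod_cons]
    exact ih.mul_left _
  | swap x y l =>
    simp only [List.map_cons, List.prod_cons, ← mul_assoc]
    exact (signEq_comm _ (E.dpow_mem _ _) (E.dpow_mem _ _)).mul_right _
  | trans _ _ h1 h2 => exact h1.trans h2

/-- The factor at `y` is moved to the end past homogeneous factors, which costs only a sign. This
lets any variable be treated as the last one, whatever the auxiliary order. -/
theorem monomial_erase (μ : E.Y →₀ ℕ) (y : E.Y) :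
    SignEq (E.monomial μ) (E.monomial (μ.erase y) * E.dpow y (μ y)) := by
  by_cases hy : y ∈ μ.support
  · have hp : (μ.support.sort (· ≤ ·)).Perm (((μ.erase y).support.sort (· ≤ ·)) ++ [y]) := by
      refine (List.perm_ext_iff_of_nodup (Finset.sort_nodup _ _) ?_).2 ?_
      · refine List.Nodup.append (Finset.sort_nodup _ _) (List.nodup_singleton y) ?_
        simp [Finsupp.support_erase]
      · intro z
        simp only [Finset.mem_sort, List.mem_append, Finsupp.support_erase, Finset.mem_erase,
          List.mem_singleton]
        by_cases hz : z = y
        · simp [hz, Finsupp.mem_support_iff.1 hy]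
        · simp [hz]
    refine (E.prod_perm μ hp).trans ?_
    rw [List.map_append, List.prod_append]
    have : ((μ.erase y).support.sort (· ≤ ·)).map (fun z => E.dpow z (μ z)) =
        ((μ.erase y).support.sort (· ≤ ·)).map fun z => E.dpow z (μ.erase y z) := by
      refine List.map_congr_left fun z hz => ?_
      rw [Finset.mem_sort, Finsupp.support_erase, Finset.mem_erase] at hz
      rw [Finsupp.erase_ne hz.1]
    rw [this]
    simp only [List.map_cons, List.map_nil, List.prod_cons, List.prod_nil, mul_one]
    exact SignEq.refl _
  · have h0 : μ y = 0 := by simpa using hy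
    rw [h0, E.dpow_zero, mul_one, Finsupp.erase_of_notMem_support hy]
    exact SignEq.refl _

theorem monomial_zero : E.monomial 0 = 1 := by simp [monomial]

theorem monomial_add_single {μ : E.Y →₀ ℕ} {y : E.Y} (h : μ y = 0) (i : ℕ) :
    SignEq (E.monomial (μ + Finsupp.single y i)) (E.monomial μ * E.dpow y i) := by
  have := E.monomial_erase (μ + Finsupp.single y i) y
  have h1 : (μ + Finsupp.single y i).erase y = μ := by
    rw [Finsupp.erase_add, Finsupp.erase_single, add_zero,
      Finsupp.erase_of_notMem_support (by simpa using h)]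
  rwa [h1, Finsupp.add_apply, h, Finsupp.single_eq_same, zero_add] at this

theorem monomial_induction {P : (E.Y →₀ ℕ) → Prop} (zero : P 0)
    (add : ∀ μ y i, μ y = 0 → P μ → P (μ + Finsupp.single y i)) (μ : E.Y →₀ ℕ) : P μ := by
  induction μ using Finsupp.induction with
  | zero => exact zero
  | single_add y i μ hy _ ih =>
    rw [add_comm]
    exact add μ y i (by simpa using hy) ih

/-- The degree of a monomial. -/
def weight (μ : E.Y →₀ ℕ) : ℕ := μ.sum fun y i => i * E.deg y

theorem weight_add_single (μ : E.Y →₀ ℕ) (y : E.Y) (i : ℕ) :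
    E.weight (μ + Finsupp.single y i) = E.weight μ + i * E.deg y := by
  unfold weight
  rw [Finsupp.sum_add_index' (by simp) (by intros; ring), Finsupp.sum_single_index (by simp)]

theorem le_weight {μ : E.Y →₀ ℕ} {y : E.Y} (hy : μ y ≠ 0) : E.deg y ≤ E.weight μ := by
  have h : μ y * E.deg y ≤ E.weight μ :=
    Finset.single_le_sum (f := fun z => μ z * E.deg z) (fun _ _ => Nat.zero_le _)
      (Finsupp.mem_support_iff.2 hy)
  exact (Nat.le_mul_of_pos_left _ (Nat.pos_of_ne_zero hy)).trans h

theorem monomial_mem (μ : E.Y →₀ ℕ) : E.monomial μ ∈ E.U.grading (E.weight μ) := by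
  induction μ using E.monomial_induction with
  | zero => rw [monomial_zero]; exact E.U.one_mem
  | add μ y i h ih =>
    rw [weight_add_single]
    exact (E.monomial_add_single h i).mem (E.U.mul_mem ih (E.dpow_mem y i))

theorem dpow_mul_dpow (y : E.Y) (i j : ℕ) :
    ∃ n : ℤ, E.dpow y i * E.dpow y j = n • E.dpow y (i + j) := by
  rcases Nat.even_or_odd (E.deg y) with h | h
  · refine ⟨(i + j).choose i, ?_⟩
    rw [E.dpow_mul y h]
    simp
  · obtain _ | i := i
    · exact ⟨1, by simp [E.dpow_zero]⟩
    obtain _ | j := j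
    · exact ⟨1, by simp [E.dpow_zero]⟩
    refine ⟨0, ?_⟩
    rw [zero_zsmul]
    obtain _ | i := i
    · obtain _ | j := j
      · rw [← sq]
        exact E.U.sq_eq_zero _ _ h (by simpa using E.dpow_mem y 1)
      · rw [E.dpow_odd y h (j + 1 + 1) (by omega), mul_zero]
    · rw [E.dpow_odd y h (i + 1 + 1) (by omega), zero_mul]

theorem dpow_mul_monomial (y : E.Y) (i : ℕ) (ν : E.Y →₀ ℕ) :
    ∃ n : ℤ, E.dpow y i * E.monomial ν = n • E.monomial (ν + Finsupp.single y i) := by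
  obtain ⟨n1, h1⟩ := ((E.monomial_erase ν y).mul_left (E.dpow y i)).exists_zsmul
  obtain ⟨n2, h2⟩ := ((signEq_comm E.U (E.dpow_mem y i)
    (E.monomial_mem (ν.erase y))).mul_right (E.dpow y (ν y))).exists_zsmul
  obtain ⟨n3, h3⟩ := E.dpow_mul_dpow y i (ν y)
  have h4 := E.monomial_add_single (Finsupp.erase_same (f := ν) (a := y)) (ν y + i)
  have h5 : ν.erase y + Finsupp.single y (ν y + i) = ν + Finsupp.single y i := by
    rw [Finsupp.single_add, ← add_assoc, Finsupp.erase_add_single]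
  rw [h5] at h4
  obtain ⟨n4, h4⟩ := h4.symm.exists_zsmul
  refine ⟨n1 * (n2 * (n3 * n4)), ?_⟩
  rw [h1, ← mul_assoc, h2, mul_assoc, h3, mul_smul_comm, add_comm i, h4]
  simp only [mul_smul]

/-- The integer collects signs and binomial coefficients, and is zero when an odd variable is
repeated. -/
theorem monomial_mul_monomial (μ ν : E.Y →₀ ℕ) :
    ∃ n : ℤ, E.monomial μ * E.monomial ν = n • E.monomial (μ + ν) := by
  induction μ using E.monomial_induction generalizing ν with
  | zero => exact ⟨1, by simp [monomial_zero]⟩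
  | add μ y i h ih =>
    obtain ⟨n1, h1⟩ := ((E.monomial_add_single h i).mul_right (E.monomial ν)).exists_zsmul
    obtain ⟨n2, h2⟩ := E.dpow_mul_monomial y i ν
    obtain ⟨n3, h3⟩ := ih (ν + Finsupp.single y i)
    refine ⟨n1 * (n2 * n3), ?_⟩
    rw [h1, mul_assoc, h2, mul_smul_comm, h3, add_assoc, add_comm ν]
    simp only [mul_smul]

/-- The exponents of normal monomials. -/
def Admissible (μ : E.Y →₀ ℕ) : Prop := ∀ y, Odd (E.deg y) → μ y ≤ 1

theorem monomial_of_not_admissible {μ : E.Y →₀ ℕ} (h : ¬E.Admissible μ) : E.monomial μ = 0 := by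
  simp only [Admissible, not_forall, not_le] at h
  obtain ⟨y, hy, hμ⟩ := h
  have := E.monomial_erase μ y
  rw [E.dpow_odd y hy _ hμ, mul_zero] at this
  rcases this with h | h
  · exact h
  · rw [h, neg_zero]

/-- The basis expansion of the elements of `A⟨Y⟩`. -/
noncomputable def expansion : ({μ : E.Y →₀ ℕ // E.Admissible μ} →₀ A) ≃+ E.U :=
  AddEquiv.ofBijective (Finsupp.liftAddHom fun μ : {μ : E.Y →₀ ℕ // E.Admissible μ} =>
    (AddMonoidHom.mulRight (E.monomial μ.1)).comp E.incl.toRingHom.toAddMonoidHom) E.basis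

theorem expansion_single (μ : {μ : E.Y →₀ ℕ // E.Admissible μ}) (a : A) :
    E.expansion (Finsupp.single μ a) = E.incl a * E.monomial μ.1 := by
  simp [expansion]

open Classical in
/-- The coefficient of an element of `A⟨Y⟩` at a monomial. -/
noncomputable def coef (ν : E.Y →₀ ℕ) : E.U →+ A :=
  if h : E.Admissible ν then
    (Finsupp.applyAddHom (⟨ν, h⟩ : {μ : E.Y →₀ ℕ // E.Admissible μ})).comp
      E.expansion.symm.toAddMonoidHom
  else 0

theorem induction_on {P : E.U → Prop} (mon : ∀ a μ, P (E.incl a * E.monomial μ))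
    (add : ∀ u v, P u → P v → P (u + v)) (u : E.U) : P u := by
  obtain ⟨c, rfl⟩ := E.expansion.surjective u
  induction c using Finsupp.induction_linear with
  | zero => simpa using mon 0 0
  | add c c' h h' => rw [map_add]; exact add _ _ h h'
  | single μ a => rw [E.expansion_single]; exact mon a μ.1

theorem coef_of_not_admissible {ν : E.Y →₀ ℕ} (h : ¬E.Admissible ν) (u : E.U) :
    E.coef ν u = 0 := by simp [coef, h]

theorem coef_monomial_self {ν : E.Y →₀ ℕ} (h : E.Admissible ν) (a : A) :
    E.coef ν (E.incl a * E.monomial ν) = a := by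
  rw [show E.incl a * E.monomial ν = E.expansion (Finsupp.single ⟨ν, h⟩ a) from
    (E.expansion_single ⟨ν, h⟩ a).symm]
  simp [coef, h]

theorem coef_monomial_ne {μ ν : E.Y →₀ ℕ} (hne : μ ≠ ν) (a : A) :
    E.coef ν (E.incl a * E.monomial μ) = 0 := by
  by_cases hν : E.Admissible ν
  · by_cases h : E.Admissible μ
    · rw [show E.incl a * E.monomial μ = E.expansion (Finsupp.single ⟨μ, h⟩ a) from
        (E.expansion_single ⟨μ, h⟩ a).symm]
      simp [coef, hν, hne]
    · rw [E.monomial_of_not_admissible h]; simp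
  · exact E.coef_of_not_admissible hν _

theorem eq_zero_of_coef {u : E.U} (h : ∀ ν, E.coef ν u = 0) : u = 0 := by
  apply E.expansion.symm.injective
  rw [map_zero]
  ext ν
  have := h ν.1
  simpa [coef, ν.2] using this

theorem coef_mul_left (ν : E.Y →₀ ℕ) (a : A) (u : E.U) :
    E.coef ν (E.incl a * u) = a * E.coef ν u := by
  induction u using E.induction_on with
  | mon b μ =>
    rw [← mul_assoc, ← E.incl.map_mul]
    by_cases h : μ = ν
    · subst h
      by_cases hν : E.Admissible μ
      · rw [E.coef_monomial_self hν, E.coef_monomial_self hν]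
      · simp [E.coef_of_not_admissible hν]
    · rw [E.coef_monomial_ne h, E.coef_monomial_ne h, mul_zero]
  | add u v hu hv => rw [mul_add, map_add, map_add, hu, hv, mul_add]

theorem incl_injective : Function.Injective E.incl := by
  intro a b h
  have h0 : E.Admissible 0 := fun y _ => by simp
  have e := fun a => E.coef_monomial_self h0 a
  simp only [monomial_zero, mul_one] at e
  rw [← e a, h, e b]

/-- The set of elements `a y₁^{(i₁)} ⋯ yₙ^{(iₙ)}` with `y₁, …, yₙ` in `S`. -/
def terms (S : Set E.Y) : Set E.U :=
  {u | ∃ a μ, (∀ y, μ y ≠ 0 → y ∈ S) ∧ u = E.incl a * E.monomial μ}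

theorem mul_mem_closure_terms {S : Set E.Y} {u v : E.U}
    (hu : u ∈ AddSubgroup.closure (E.terms S)) (hv : v ∈ AddSubgroup.closure (E.terms S)) :
    u * v ∈ AddSubgroup.closure (E.terms S) := by
  induction hu using AddSubgroup.closure_induction with
  | zero => rw [zero_mul]; exact zero_mem _
  | add x y _ _ hx hy => rw [add_mul]; exact add_mem hx hy
  | neg x _ hx => rw [neg_mul]; exact neg_mem hx
  | mem x hx =>
    obtain ⟨a, μ, hμ, rfl⟩ := hx
    induction hv using AddSubgroup.closure_induction with
    | zero => rw [mul_zero]; exact zero_mem _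
    | add x y _ _ hx hy => rw [mul_add]; exact add_mem hx hy
    | neg x _ hx => rw [mul_neg]; exact neg_mem hx
    | mem x hx =>
      obtain ⟨b, ν, hν, rfl⟩ := hx
      obtain ⟨n, hn⟩ := E.monomial_mul_monomial μ ν
      have : E.incl a * E.monomial μ * (E.incl b * E.monomial ν) =
          n • (E.incl (a * A.sgnPow (E.weight μ) b) * E.monomial (μ + ν)) := by
        rw [mul_assoc, ← mul_assoc (E.monomial μ), E.U.mul_comm_sgnPow (E.monomial_mem μ),
          ← E.incl.map_sgnPow, mul_assoc (E.incl _), hn, mul_smul_comm, mul_smul_comm,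
          ← mul_assoc, E.incl.map_mul]
      rw [this]
      refine AddSubgroup.zsmul_mem _ (AddSubgroup.subset_closure ?_) _
      refine ⟨_, _, fun y hy => ?_, rfl⟩
      by_cases h : μ y = 0
      · exact hν y (by simpa [h] using hy)
      · exact hμ y h

/-- The subalgebra `A⟨S⟩` for a set `S` of variables. -/
def adjoin (S : Set E.Y) : Subring E.U where
  toSubmonoid :=
    { carrier := AddSubgroup.closure (E.terms S)
      one_mem' := show (1 : E.U) ∈ AddSubgroup.closure (E.terms S) from
        AddSubgroup.subset_closure ⟨1, 0, by simp, by simp [monomial_zero]⟩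
      mul_mem' := E.mul_mem_closure_terms }
  add_mem' := add_mem (S := AddSubgroup E.U)
  zero_mem' := zero_mem (AddSubgroup.closure (E.terms S))
  neg_mem' := neg_mem (S := AddSubgroup E.U)

variable {E}

theorem incl_mem_adjoin (S : Set E.Y) (a : A) : E.incl a ∈ E.adjoin S :=
  AddSubgroup.subset_closure ⟨a, 0, by simp, by simp [monomial_zero]⟩

theorem dpow_mem_adjoin {S : Set E.Y} {y : E.Y} (hy : y ∈ S) (i : ℕ) :
    E.dpow y i ∈ E.adjoin S := by
  have h := E.monomial_add_single (μ := 0) (y := y) rfl i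
  rw [zero_add, monomial_zero, one_mul] at h
  refine h.symm.mem (AddSubgroup.subset_closure ⟨1, Finsupp.single y i, fun z hz => ?_, ?_⟩)
  · by_contra h
    have hzy : z ≠ y := fun h' => h (h' ▸ hy)
    exact hz (Finsupp.single_eq_of_ne hzy)
  · simp

theorem adjoin_induction_terms {S : Set E.Y} {P : E.U → Prop}
    (mon : ∀ a μ, (∀ y, μ y ≠ 0 → y ∈ S) → P (E.incl a * E.monomial μ))
    (add : ∀ u v, P u → P v → P (u + v)) {u : E.U} (hu : u ∈ E.adjoin S) : P u := by
  -- `P` is not assumed stable under negation; the sign is absorbed by the coefficient `a` of a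
  -- term.
  suffices h : P u ∧ P (-u) from h.1
  change u ∈ AddSubgroup.closure (E.terms S) at hu
  induction hu using AddSubgroup.closure_induction with
  | zero => simpa using mon 0 0 (by simp)
  | add x y _ _ hx hy =>
    exact ⟨add _ _ hx.1 hy.1, by rw [neg_add]; exact add _ _ hx.2 hy.2⟩
  | neg x _ hx => exact ⟨hx.2, by rw [neg_neg]; exact hx.1⟩
  | mem x hx =>
    obtain ⟨a, μ, hμ, rfl⟩ := hx
    exact ⟨mon _ _ hμ, by rw [← neg_mul, ← E.incl.map_neg]; exact mon _ _ hμ⟩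

theorem adjoin_induction {S : Set E.Y} {P : E.U → Prop} (incl : ∀ a, P (E.incl a))
    (dpow : ∀ y ∈ S, ∀ i, P (E.dpow y i)) (add : ∀ u v, P u → P v → P (u + v))
    (mul : ∀ u ∈ E.adjoin S, ∀ v ∈ E.adjoin S, P u → P v → P (u * v))
    {u : E.U} (hu : u ∈ E.adjoin S) : P u := by
  refine adjoin_induction_terms ?_ add hu
  intro a μ hμ
  suffices h : E.monomial μ ∈ E.adjoin S ∧ P (E.monomial μ) from
    mul _ (incl_mem_adjoin S a) _ h.1 (incl a) h.2
  have hneg : ∀ u ∈ E.adjoin S, P u → P (-u) := by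
    intro u hu h
    have := mul _ (incl_mem_adjoin S (-1)) _ hu (incl (-1)) h
    simpa [E.incl.map_neg] using this
  induction μ using E.monomial_induction with
  | zero =>
    rw [monomial_zero]
    exact ⟨OneMemClass.one_mem _, by simpa using incl 1⟩
  | add μ y i h ih =>
    have hμ' : ∀ z, μ z ≠ 0 → z ∈ S := fun z hz => hμ z (by simp; omega)
    obtain ⟨h1, h2⟩ := ih hμ'
    by_cases hi : i = 0
    · subst hi; simpa using ih hμ'
    have hy : y ∈ S := hμ y (by simp [hi])
    have h3 := dpow_mem_adjoin hy i
    have h4 := mul _ h1 _ h3 h2 (dpow y hy i)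
    rcases E.monomial_add_single h i with h' | h' <;> rw [h']
    · exact ⟨MulMemClass.mul_mem h1 h3, h4⟩
    · exact ⟨neg_mem (MulMemClass.mul_mem h1 h3), hneg _ (MulMemClass.mul_mem h1 h3) h4⟩

theorem adjoin_mono {S T : Set E.Y} (h : S ⊆ T) : E.adjoin S ≤ E.adjoin T :=
  fun _ hu => adjoin_induction (P := (· ∈ E.adjoin T)) (incl_mem_adjoin T)
    (fun _ hy i => dpow_mem_adjoin (h hy) i) (fun _ _ => add_mem)
    (fun _ _ _ _ => MulMemClass.mul_mem) hu

theorem pr_mem_adjoin {S : Set E.Y} (i : ℕ) {u : E.U} (hu : u ∈ E.adjoin S) :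
    E.U.pr i u ∈ E.adjoin S := by
  refine adjoin_induction_terms (P := fun u => E.U.pr i u ∈ E.adjoin S) ?_
    (fun u v h h' => by rw [map_add]; exact add_mem h h') hu
  intro a μ hμ
  rcases Nat.lt_or_ge i (E.weight μ) with h | h
  · rw [E.U.pr_mul_of_mem_right_lt (E.monomial_mem μ) _ h]; exact zero_mem _
  · obtain ⟨n, rfl⟩ := Nat.exists_eq_add_of_le' h
    rw [E.U.pr_mul_of_mem_right (E.monomial_mem μ), ← E.incl.map_pr]
    exact AddSubgroup.subset_closure ⟨_, μ, hμ, rfl⟩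

/-- Coefficients have nonnegative degree, so a term of degree `n` involves only variables of degree
at most `n`. -/
theorem mem_adjoin_of_mem_grading {S : Set E.Y} {n : ℕ} (hS : ∀ y, E.deg y ≤ n → y ∈ S) {u : E.U}
    (hu : u ∈ E.U.grading n) : u ∈ E.adjoin S := by
  rw [← E.U.pr_of_mem hu]
  clear hu
  induction u using E.induction_on with
  | add u v h h' => rw [map_add]; exact add_mem h h'
  | mon a μ =>
    rcases Nat.lt_or_ge n (E.weight μ) with h | h
    · rw [E.U.pr_mul_of_mem_right_lt (E.monomial_mem μ) _ h]; exact zero_mem _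
    · obtain ⟨k, rfl⟩ := Nat.exists_eq_add_of_le' h
      rw [E.U.pr_mul_of_mem_right (E.monomial_mem μ), ← E.incl.map_pr]
      exact AddSubgroup.subset_closure ⟨_, μ, fun y hy => hS y ((E.le_weight hy).trans h), rfl⟩

/-- A set of variables that contains all the variables of degree less than that of any of its
members. -/
def Good (S : Set E.Y) : Prop := ∀ y ∈ S, ∀ y', E.deg y' < E.deg y → y' ∈ S

theorem dvar_mem_adjoin {S : Set E.Y} {y : E.Y} (h : ∀ y', E.deg y' < E.deg y → y' ∈ S) :
    E.U.d (E.dpow y 1) ∈ E.adjoin S := by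
  obtain ⟨n, hn⟩ := Nat.exists_eq_succ_of_ne_zero (E.deg_pos y).ne'
  have := E.dpow_mem y 1
  rw [one_mul, hn] at this
  exact mem_adjoin_of_mem_grading (fun y' hy' => h y' (by omega)) (E.U.d_mem _ _ this)

/-- By the Leibniz rule and `∂(y^{(i+1)}) = ∂(y) y^{(i)}`, the differential is controlled by its
values on `A` and on the variables. It serves for `M = A⟨S⟩` and for `M = 𝔪_A U`. -/
theorem d_mem_of_dvar_mem {S : Set E.Y} {M : AddSubgroup E.U}
    (hl : ∀ u ∈ E.adjoin S, ∀ v ∈ M, u * v ∈ M) (hr : ∀ u ∈ E.adjoin S, ∀ v ∈ M, v * u ∈ M)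
    (hi : ∀ a, E.U.d (E.incl a) ∈ M) (hy : ∀ y ∈ S, E.U.d (E.dpow y 1) ∈ M) {u : E.U}
    (hu : u ∈ E.adjoin S) : E.U.d u ∈ M := by
  have hs : ∀ u ∈ E.adjoin S, E.U.sgn u ∈ E.adjoin S := by
    intro u hu
    refine adjoin_induction (P := fun u => E.U.sgn u ∈ E.adjoin S) ?_ ?_ ?_ ?_ hu
    · intro a; rw [← E.incl.map_sgn]; exact incl_mem_adjoin S _
    · intro y hy i
      rw [E.U.sgn_of_mem (E.dpow_mem y i)]
      exact MulMemClass.mul_mem (_root_.pow_mem (neg_mem (OneMemClass.one_mem _)) _) (dpow_mem_adjoin hy i)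
    · intro u v h h'; rw [map_add]; exact add_mem h h'
    · intro u _ v _ h h'; rw [map_mul]; exact MulMemClass.mul_mem h h'
  refine adjoin_induction (P := fun u => E.U.d u ∈ M) hi ?_ ?_ ?_ hu
  · intro y hyS i
    obtain _ | i := i
    · rw [E.dpow_zero, E.U.d_one]; exact zero_mem _
    · rcases Nat.even_or_odd (E.deg y) with h | h
      · rw [E.d_dpow y h]
        exact hr _ (dpow_mem_adjoin hyS i) _ (hy y hyS)
      · obtain _ | i := i
        · exact hy y hyS
        · rw [E.dpow_odd y h _ (by omega), map_zero]; exact zero_mem _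
  · intro u v h h'; rw [map_add]; exact add_mem h h'
  · intro u hu v hv h h'
    rw [E.U.d_mul]
    exact add_mem (hr v hv _ h) (hl _ (hs u hu) _ h')

theorem d_mem_adjoin {S : Set E.Y} (hS : Good S) {u : E.U} (hu : u ∈ E.adjoin S) :
    E.U.d u ∈ E.adjoin S :=
  d_mem_of_dvar_mem (M := (E.adjoin S).toAddSubgroup) (fun _ hu _ hv => (E.adjoin S).mul_mem hu hv)
    (fun _ hu _ hv => (E.adjoin S).mul_mem hv hu)
    (fun a => by rw [← E.incl.map_d]; exact incl_mem_adjoin S _)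
    (fun y hy => dvar_mem_adjoin (hS y hy)) hu

/-- The dg-subalgebra `A⟨S⟩` for a good set `S` of variables. -/
noncomputable def subAlg (S : Set E.Y) (hS : Good S) : CDGA.{u} :=
  E.U.sub (E.adjoin S) (fun _ => d_mem_adjoin hS) (fun i _ => pr_mem_adjoin i)

/-- The inclusion of `A⟨S⟩`. -/
noncomputable def subAlgIncl (S : Set E.Y) (hS : Good S) : Hom (subAlg S hS) E.U :=
  E.U.subIncl (E.adjoin S) (fun _ => d_mem_adjoin hS) (fun i _ => pr_mem_adjoin i)

theorem subAlgIncl_injective (S : Set E.Y) (hS : Good S) :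
    Function.Injective (subAlgIncl S hS) := E.U.subIncl_injective _ _ _

theorem mem_range_subAlgIncl (S : Set E.Y) (hS : Good S) {u : E.U} :
    (∃ x, subAlgIncl S hS x = u) ↔ u ∈ E.adjoin S := E.U.mem_range_subIncl _ _ _

section Freeness

variable {S : Set E.Y} {y : E.Y}

theorem mem_adjoin_insert {u : E.U} (hu : u ∈ E.adjoin (insert y S)) :
    ∃ n, (Odd (E.deg y) → n ≤ 2) ∧ ∃ c : ℕ → E.U, (∀ i, c i ∈ E.adjoin S) ∧
      u = ∑ i ∈ Finset.range n, c i * E.dpow y i := by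
  suffices h : ∃ c : ℕ →₀ E.U, (∀ i, c i ∈ E.adjoin S) ∧ u = c.sum fun i a => a * E.dpow y i by
    obtain ⟨c, hc, rfl⟩ := h
    rcases Nat.even_or_odd (E.deg y) with h | h
    · refine ⟨c.support.sup id + 1, fun h' => absurd h (Nat.not_even_iff_odd.2 h'), c, hc, ?_⟩
      refine Finsupp.sum_of_support_subset c (fun i hi => ?_) _ (by simp)
      have : i ≤ c.support.sup id := Finset.le_sup (f := id) hi
      simp; omega
    · refine ⟨2, fun _ => le_rfl, c, hc, ?_⟩
      refine Finset.sum_congr_of_eq_on_inter ?_ ?_ (fun _ _ _ => rfl)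
      · intro i _ hi'
        rw [Finset.mem_range, not_lt] at hi'
        simp only [E.dpow_odd y h i hi', mul_zero]
      · intro i _ hi'
        simp only [Finsupp.notMem_support_iff.1 hi', zero_mul]
  refine adjoin_induction_terms (P := fun u => ∃ c : ℕ →₀ E.U, (∀ i, c i ∈ E.adjoin S) ∧
    u = c.sum fun i a => a * E.dpow y i) ?_ ?_ hu
  · intro a μ hμ
    have hmem : E.incl a * E.monomial (μ.erase y) ∈ E.adjoin S := by
      refine AddSubgroup.subset_closure ⟨a, _, fun z hz => ?_, rfl⟩
      have hzy : z ≠ y := by rintro rfl; simp at hz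
      rw [Finsupp.erase_ne hzy] at hz
      exact (hμ z hz).resolve_left hzy
    have key : ∀ v ∈ E.adjoin S, ∃ c : ℕ →₀ E.U, (∀ i, c i ∈ E.adjoin S) ∧
        v * E.dpow y (μ y) = c.sum fun i a => a * E.dpow y i := by
      intro v hv
      refine ⟨Finsupp.single (μ y) v, fun i => ?_, ?_⟩
      · rw [Finsupp.single_apply]
        split_ifs
        · exact hv
        · exact zero_mem _
      · rw [Finsupp.sum_single_index (by simp)]
    rcases E.monomial_erase μ y with h | h <;> rw [h]
    · rw [← mul_assoc]; exact key _ hmem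
    · rw [mul_neg, ← mul_assoc, ← neg_mul]; exact key _ (neg_mem hmem)
  · rintro u v ⟨c, hc, rfl⟩ ⟨c', hc', rfl⟩
    exact ⟨c + c', fun i => add_mem (hc i) (hc' i),
      (Finsupp.sum_add_index' (by simp) (by intros; rw [add_mul])).symm⟩

theorem coef_mul_dpow_ne {c : E.U} (hc : c ∈ E.adjoin S) (hy : y ∉ S) {μ : E.Y →₀ ℕ}
    (hμ : μ y = 0) {i j : ℕ} (hij : i ≠ j) :
    E.coef (μ + Finsupp.single y j) (c * E.dpow y i) = 0 := by
  refine adjoin_induction_terms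
    (P := fun c => E.coef (μ + Finsupp.single y j) (c * E.dpow y i) = 0) ?_ ?_ hc
  · intro a ν hν
    have hν0 : ν y = 0 := by by_contra h; exact hy (hν y h)
    have hne : ν + Finsupp.single y i ≠ μ + Finsupp.single y j := by
      intro h
      have := DFunLike.congr_fun h y
      simp [hν0, hμ] at this
      exact hij this
    rw [mul_assoc]
    rcases (E.monomial_add_single hν0 i).symm with h | h <;> rw [h]
    · exact E.coef_monomial_ne hne a
    · rw [mul_neg, map_neg, E.coef_monomial_ne hne a, neg_zero]
  · intro u v h h'
    rw [add_mul, map_add, h, h', add_zero]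

/-- The sign records the position of `y` among the variables of `μ` and is the same for all `c`; so
the alternative stands outside the quantifier. -/
theorem coef_mul_dpow_self (hy : y ∉ S) {μ : E.Y →₀ ℕ} (hμ : μ y = 0) {i : ℕ}
    (hi : Odd (E.deg y) → i ≤ 1) :
    (∀ c ∈ E.adjoin S, E.coef (μ + Finsupp.single y i) (c * E.dpow y i) = E.coef μ c) ∨
    (∀ c ∈ E.adjoin S, E.coef (μ + Finsupp.single y i) (c * E.dpow y i) = -E.coef μ c) := by
  have hadm : E.Admissible (μ + Finsupp.single y i) ↔ E.Admissible μ := by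
    constructor
    · intro h z hz
      have := h z hz
      rw [Finsupp.add_apply] at this
      omega
    · intro h z hz
      by_cases hzy : z = y
      · subst hzy; simpa [hμ] using hi hz
      · simpa [Finsupp.single_eq_of_ne hzy] using h z hz
  have key : ∀ ν : E.Y →₀ ℕ, ν ≠ μ → (∀ z, ν z ≠ 0 → z ∈ S) → ∀ a,
      E.coef (μ + Finsupp.single y i) (E.incl a * E.monomial ν * E.dpow y i) = 0 := by
    intro ν hne hν a
    have hν0 : ν y = 0 := by by_contra h; exact hy (hν y h)
    have hne' : ν + Finsupp.single y i ≠ μ + Finsupp.single y i :=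
      fun h => hne (add_right_cancel h)
    rw [mul_assoc]
    rcases (E.monomial_add_single hν0 i).symm with h | h <;> rw [h]
    · exact E.coef_monomial_ne hne' a
    · rw [mul_neg, map_neg, E.coef_monomial_ne hne' a, neg_zero]
  by_cases h0 : E.Admissible μ
  · rcases (E.monomial_add_single hμ i).symm with h | h
    · left
      intro c hc
      refine adjoin_induction_terms
        (P := fun c => E.coef (μ + Finsupp.single y i) (c * E.dpow y i) = E.coef μ c)
        ?_ (fun u v h h' => by rw [add_mul, map_add, map_add, h, h']) hc
      intro a ν hν
      by_cases hνμ : ν = μ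
      · subst hνμ
        rw [mul_assoc, h, E.coef_monomial_self (hadm.2 h0), E.coef_monomial_self h0]
      · rw [key ν hνμ hν, E.coef_monomial_ne hνμ]
    · right
      intro c hc
      refine adjoin_induction_terms
        (P := fun c => E.coef (μ + Finsupp.single y i) (c * E.dpow y i) = -E.coef μ c)
        ?_ (fun u v h h' => by rw [add_mul, map_add, map_add, h, h', neg_add]) hc
      intro a ν hν
      by_cases hνμ : ν = μ
      · subst hνμ
        rw [mul_assoc, h, mul_neg, map_neg, E.coef_monomial_self (hadm.2 h0),
          E.coef_monomial_self h0]
      · rw [key ν hνμ hν, E.coef_monomial_ne hνμ, neg_zero]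
  · left
    intro c _
    rw [E.coef_of_not_admissible h0, E.coef_of_not_admissible (fun h => h0 (hadm.1 h))]

theorem coef_eq_zero_of_notMem {c : E.U} (hc : c ∈ E.adjoin S) (hy : y ∉ S) {μ : E.Y →₀ ℕ}
    (hμ : μ y ≠ 0) : E.coef μ c = 0 := by
  refine adjoin_induction_terms (P := fun c => E.coef μ c = 0) ?_
    (fun u v h h' => by rw [map_add, h, h', add_zero]) hc
  intro a ν hν
  exact E.coef_monomial_ne (fun h => hμ (by by_contra h'; exact hy (hν y (h ▸ h')))) a

/-- `A⟨S ∪ {y}⟩` is free over `A⟨S⟩` on the divided powers of `y`, also modulo a subgroup of the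
coefficients. -/
theorem coef_mem_of_sum (J : AddSubgroup A) (hy : y ∉ S) {n : ℕ} (hn : Odd (E.deg y) → n ≤ 2)
    (c : ℕ → E.U) (hc : ∀ i, c i ∈ E.adjoin S)
    (h : ∀ ν, E.coef ν (∑ i ∈ Finset.range n, c i * E.dpow y i) ∈ J) {i : ℕ} (hi : i < n)
    (μ : E.Y →₀ ℕ) : E.coef μ (c i) ∈ J := by
  by_cases hμ : μ y = 0
  · have h1 := h (μ + Finsupp.single y i)
    rw [map_sum, Finset.sum_eq_single i (fun j _ hj => coef_mul_dpow_ne (hc j) hy hμ hj)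
      (fun h => absurd (Finset.mem_range.2 hi) h)] at h1
    rcases coef_mul_dpow_self (S := S) hy hμ (i := i) (fun h => by have := hn h; omega)
      with h' | h'
    · rwa [h' _ (hc i)] at h1
    · rw [h' _ (hc i)] at h1
      simpa using neg_mem h1
  · rw [coef_eq_zero_of_notMem (hc i) hy hμ]; exact zero_mem _

end Freeness

/-- Good sets of variables can be built by adjoining one variable at a time. -/
theorem good_induction {S₀ T : Set E.Y} (hT : Good T) (h₀ : Good S₀) (h₀T : S₀ ⊆ T)
    (hfin : (T \ S₀).Finite) {P : Set E.Y → Prop} (base : P S₀)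
    (step : ∀ S y, Good S → S₀ ⊆ S → y ∈ T → y ∉ S → (∀ y', E.deg y' < E.deg y → y' ∈ S) → P S →
      P (insert y S)) : P T := by
  suffices h : ∀ n (S : Set E.Y), Good S → S₀ ⊆ S → S ⊆ T → P S → (T \ S).ncard = n → P T from
    h _ S₀ h₀ le_rfl h₀T base rfl
  intro n
  induction n with
  | zero =>
    intro S _ hS1 hS2 hP hn
    have hf : (T \ S).Finite := hfin.subset (Set.sdiff_subset_sdiff_right hS1)
    rw [Set.ncard_eq_zero hf, Set.sdiff_eq_empty] at hn
    rwa [← hS2.antisymm hn]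
  | succ n ih =>
    intro S hS hS1 hS2 hP hn
    have hf : (T \ S).Finite := hfin.subset (Set.sdiff_subset_sdiff_right hS1)
    have hne : (T \ S).Nonempty := by
      rw [← Set.ncard_pos hf]; omega
    -- Taking a missing variable of least degree puts all variables of smaller degree in `S`, so
    -- that `∂y` lies in `A⟨S⟩`.
    obtain ⟨y, hy, hmin⟩ := Set.exists_min_image (T \ S) E.deg hf hne
    have hlow : ∀ y', E.deg y' < E.deg y → y' ∈ S := by
      intro y' hy'
      by_contra h
      exact absurd (hmin y' ⟨hT y hy.1 y' hy', h⟩) (by omega)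
    refine ih (insert y S) ?_ (hS1.trans (Set.subset_insert _ _))
      (Set.insert_subset hy.1 hS2) (step S y hS hS1 hy.1 hy.2 hlow hP) ?_
    · rintro z (rfl | hz) y' hy'
      · exact Or.inr (hlow y' hy')
      · exact Or.inr (hS z hz y' hy')
    · have : T \ insert y S = (T \ S) \ {y} := by
        ext z; simp only [Set.mem_sdiff, Set.mem_insert_iff, Set.mem_singleton_iff]; tauto
      rw [this, Set.ncard_sdiff_singleton_of_mem hy]
      omega

theorem finite_deg_lt (n : ℕ) : {y : E.Y | E.deg y < n}.Finite := by
  have : {y : E.Y | E.deg y < n} = ⋃ i ∈ Finset.range n, {y : E.Y | E.deg y = i} := by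
    ext y; simp
  rw [this]
  exact Set.Finite.biUnion (Finset.finite_toSet _) fun i _ => E.finite_deg i

theorem good_deg_lt (n : ℕ) : Good {y : E.Y | E.deg y < n} := fun _ hy _ hy' => hy'.trans hy

end GammaExtension

theorem d_pow_cycle (C : CDGA.{u}) {x : C} (hx : C.d x = 0) (n : ℕ) : C.d (x ^ n) = 0 := by
  induction n with
  | zero => rw [pow_zero, C.d_one]
  | succ n ih => rw [pow_succ, C.d_mul_cycle _ hx, ih, zero_mul]

/-- Powers of homologous even cycles are homologous, by telescoping `x^{n+1} - y^{n+1} = x^n (x - y)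
+ (x^n - y^n) y`. The subring `H` records where the bounding element can be found. -/
theorem exists_d_eq_pow_sub_pow (C : CDGA.{u}) (H : Subring C) {e : ℕ} (he : Even e) {x y b : C}
    (hxH : x ∈ H) (hyH : y ∈ H) (hbH : b ∈ H) (hx : x ∈ C.grading e) (hdx : C.d x = 0)
    (hdy : C.d y = 0) (hb : C.d b = x - y) (n : ℕ) : ∃ b' ∈ H, C.d b' = x ^ n - y ^ n := by
  induction n with
  | zero => exact ⟨0, zero_mem _, by simp⟩
  | succ n ih =>
    obtain ⟨b', hb'H, hb'⟩ := ih
    refine ⟨x ^ n * b + b' * y, H.add_mem (H.mul_mem (H.pow_mem hxH n) hbH) (H.mul_mem hb'H hyH),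
      ?_⟩
    rw [map_add, C.d_mul_cycle _ hdy, C.d_mul_of_even (C.pow_mem hx n) (he.mul_left n),
      C.d_pow_cycle hdx, hb', hb, pow_succ, pow_succ]
    noncomm_ring

section Poly

open Polynomial

variable (C : CDGA.{u}) (f : ℕ) (z : C) (hz : z ∈ C.grading f) (hdz : C.d z = 0) (hf : Odd f)

theorem polyExtVar_regular (p : C.polyExt f z hz hdz hf)
    (h : C.polyExtVar f z hz hdz hf * p = 0) : p = 0 := by
  have key : ∀ p : C[X], X * p = 0 → p = 0 := by
    intro p h'
    rw [X_mul] at h'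
    ext n
    have := congrArg (fun p : C[X] => p.coeff (n + 1)) h'
    simpa [coeff_mul_X] using this
  exact key p h

theorem exists_eq_polyExtVar_mul (p : C.polyExt f z hz hdz hf)
    (h : C.polyExtCoeff f z hz hdz hf 0 p = 0) :
    ∃ p', p = C.polyExtVar f z hz hdz hf * p' := by
  obtain ⟨p', hp'⟩ := (X_dvd_iff (f := (p : C[X]))).2 h
  exact ⟨p', hp'⟩

theorem polyExtLift_zero {D : CDGA.{v}} (g : Hom C D) (hdη : D.d 0 = g z)
    (p : C.polyExt f z hz hdz hf) :
    C.polyExtLift f z hz hdz hf g 0 (zero_mem _) hdη p = g (C.polyExtCoeff f z hz hdz hf 0 p) := by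
  have key : ∀ p : C[X], eval₂ g.toRingHom 0 p = g (p.coeff 0) := fun p => by
    induction p using Polynomial.induction_on' with
    | add p q hp hq => rw [eval₂_add, coeff_add, g.map_add, hp, hq]
    | monomial n c =>
      rw [eval₂_monomial, coeff_monomial]
      obtain _ | n := n
      · simp
      · simp
  exact key p

end Poly

/-! ### Deformations over `ℤ[t]`: boundaries of odd variables are not nilpotent in homology. -/

namespace GammaExtension

variable {A : CDGA.{u}} {E : GammaExtension A}

theorem eq_zero_of_add_mul_dpow {S : Set E.Y} {y : E.Y} (hy : y ∉ S) {a b : E.U}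
    (ha : a ∈ E.adjoin S) (hb : b ∈ E.adjoin S) (h : a + b * E.dpow y 1 = 0) :
    a = 0 ∧ b = 0 := by
  let c : ℕ → E.U := fun i => if i = 0 then a else b
  have hsum : ∑ i ∈ Finset.range 2, c i * E.dpow y i = 0 := by
    simp [Finset.sum_range_succ, c, E.dpow_zero, h]
  have key : ∀ i < 2, c i = 0 := fun i hi => E.eq_zero_of_coef fun ν => by
    have := coef_mem_of_sum (S := S) (y := y) ⊥ hy (n := 2) (fun _ => le_rfl) c
      (fun i => by by_cases h : i = 0 <;> simp [c, h, ha, hb])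
      (fun ν => by rw [hsum, map_zero]; exact zero_mem _) hi ν
    simpa using this
  exact ⟨by simpa [c] using key 0 (by norm_num), by simpa [c] using key 1 (by norm_num)⟩

/-- A deformation of `A⟨S⟩` over `ℤ[t]`, with `t` a variable of degree `e`. -/
structure IsDeformation (S : Set E.Y) (e : ℕ) {G : CDGA.{u}} (ρ : Hom G E.U) (t : G) : Prop where
  mem : t ∈ G.grading e
  cycle : G.d t = 0
  regular : ∀ x, t * x = 0 → x = 0
  map : ρ t = 0
  ker : ∀ x, ρ x = 0 → ∃ x', x = t * x'
  range : ∀ u, (∃ x, ρ x = u) ↔ u ∈ E.adjoin S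

namespace IsDeformation

variable {S : Set E.Y} {e : ℕ} {G : CDGA.{u}} {ρ : Hom G E.U} {t : G}

theorem lift (hG : IsDeformation S e ρ t) {i : ℕ} {u : E.U} (hu : u ∈ E.adjoin S)
    (hi : u ∈ E.U.grading i) : ∃ x ∈ G.grading i, ρ x = u := by
  obtain ⟨x, rfl⟩ := (hG.range u).2 hu
  exact ⟨G.pr i x, G.pr_mem i x, by rw [ρ.map_pr, E.U.pr_of_mem hi]⟩

/-- The cofactor of `t` may be replaced by its component of degree `i - e`; if `i < e` there is none
and `x` vanishes. -/
theorem ker_homogeneous (hG : IsDeformation S e ρ t) {i : ℕ} {x : G} (hx : x ∈ G.grading i)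
    (h : ρ x = 0) : x = 0 ∨ ∃ k, k + e = i ∧ ∃ x' ∈ G.grading k, x = t * x' := by
  obtain ⟨x', hx'⟩ := hG.ker x h
  rcases Nat.lt_or_ge i e with hi | hi
  · left
    rw [← G.pr_of_mem hx, hx', G.pr_mul_of_mem_lt hG.mem _ hi]
  · right
    obtain ⟨k, rfl⟩ := Nat.exists_eq_add_of_le' hi
    refine ⟨k, rfl, G.pr k x', G.pr_mem _ _, ?_⟩
    rw [← G.pr_mul_of_mem hG.mem, add_comm e, ← hx', G.pr_of_mem hx]

theorem d_mul (hG : IsDeformation S e ρ t) (he : Even e) (x : G) : G.d (t * x) = t * G.d x := by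
  rw [G.d_mul_of_even hG.mem he, hG.cycle, zero_mul, zero_add]

/-- The cycles of `A⟨S⟩` of odd degree less than `s` are boundaries. -/
def OddExact (S : Set E.Y) (s : ℕ) : Prop := ∀ i, Odd i → i < s → ∀ u ∈ E.U.grading i,
  u ∈ E.adjoin S → E.U.d u = 0 → ∃ w ∈ E.U.grading (i + 1), w ∈ E.adjoin S ∧ E.U.d w = u

/-- The element bounding `ρ c` is lifted to `g`; then `c - ∂g` dies modulo `t`. The cofactor of `t`
has degree smaller by `e`, and this drives the two descents that follow. -/
theorem sub_boundary (hG : IsDeformation S e ρ t) {s : ℕ} (H : OddExact S s) {i : ℕ} (hi : Odd i)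
    (his : i < s) {c : G} (hc : c ∈ G.grading i) (hdc : E.U.d (ρ c) = 0) :
    ∃ g ∈ G.grading (i + 1),
      c = G.d g ∨ ∃ k, k + e = i ∧ ∃ x' ∈ G.grading k, c = G.d g + t * x' := by
  obtain ⟨w, hw, hwS, hdw⟩ := H i hi his (ρ c) (ρ.map_mem _ _ hc) ((hG.range _).1 ⟨c, rfl⟩) hdc
  obtain ⟨g, hg, rfl⟩ := hG.lift hwS hw
  refine ⟨g, hg, ?_⟩
  rcases hG.ker_homogeneous (sub_mem hc (G.d_mem _ _ hg))
    (by rw [ρ.map_sub, ρ.map_d, hdw, sub_self]) with h | ⟨k, hk, x', hx', h⟩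
  · exact Or.inl (sub_eq_zero.1 h)
  · exact Or.inr ⟨k, hk, x', hx', by rw [← h]; abel⟩

/-- Subtracting a boundary leaves `t * x`, where `x` is a cycle because `t` is regular. It is again
of odd degree, as `e` is even, and of smaller degree, as `e > 0`; so induction applies. -/
theorem oddExact (hG : IsDeformation S e ρ t) (he : Even e) (he0 : 0 < e) {s : ℕ}
    (H : OddExact S s) : ∀ i, Odd i → i < s → ∀ c ∈ G.grading i, G.d c = 0 →
      ∃ g ∈ G.grading (i + 1), G.d g = c := by
  intro i
  induction i using Nat.strong_induction_on with
  | _ i ih =>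
    intro hi his c hc hdc
    obtain ⟨g, hg, h | ⟨k, hk, x, hx, h⟩⟩ := hG.sub_boundary H hi his hc
      (by rw [← ρ.map_d, hdc, ρ.map_zero])
    · exact ⟨g, hg, h.symm⟩
    · have hdx : G.d x = 0 := by
        apply hG.regular
        rw [← hG.d_mul he]
        have := congrArg G.d h
        rw [map_add, G.d_d, zero_add, hdc] at this
        exact this.symm
      have hk' : Odd k := by
        rcases Nat.even_or_odd k with h' | h'
        · exact absurd (hk ▸ h'.add he) (Nat.not_even_iff_odd.2 hi)
        · exact h'
      obtain ⟨g', hg', rfl⟩ := ih k (by omega) hk' (by omega) x hx hdx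
      refine ⟨g + t * g', add_mem hg ?_, by rw [map_add, hG.d_mul he, h]⟩
      have := G.mul_mem hG.mem hg'
      rwa [show e + (k + 1) = i + 1 by omega] at this

/-- If `∂f = t ^ (m + 1)`, then `ρ f` is an odd cycle, so `f = ∂g + t x`, and cancelling `t` gives
`∂x = t ^ m`. The descent ends with `1` a boundary in `U`. -/
theorem pow_ne_boundary (hG : IsDeformation S e ρ t) (he : Even e) {s : ℕ} (H : OddExact S s)
    (h1 : ∀ w, E.U.d w ≠ 1) (m : ℕ) : ∀ i, Odd i → i < s → ∀ f ∈ G.grading i, G.d f ≠ t ^ m := by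
  induction m with
  | zero =>
    intro i _ _ f _ hf
    apply h1 (ρ f)
    rw [← ρ.map_d, hf, pow_zero, ρ.map_one]
  | succ m ih =>
    intro i hi his f hf hdf
    obtain ⟨g, hg, h | ⟨k, hk, x, hx, h⟩⟩ := hG.sub_boundary H hi his hf
      (by rw [← ρ.map_d, hdf, ρ.map_pow, hG.map, zero_pow (Nat.succ_ne_zero m)])
    · rw [h, G.d_d] at hdf
      -- When `f` is itself a boundary, `t ^ (m + 1) = 0`; regularity of `t` then gives `1 = 0`, and
      -- `1` would again be a boundary.
      have h0 : ∀ n, t ^ n = 0 → (1 : G) = 0 := by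
        intro n
        induction n with
        | zero => intro h; simpa using h
        | succ n ih => intro h; exact ih (hG.regular _ (by rw [← pow_succ', h]))
      apply h1 0
      rw [← ρ.map_one, h0 _ hdf.symm, ρ.map_zero, map_zero]
    · have hk' : Odd k := by
        rcases Nat.even_or_odd k with h' | h'
        · exact absurd (hk ▸ h'.add he) (Nat.not_even_iff_odd.2 hi)
        · exact h'
      refine ih k hk' (by omega) x hx ?_
      rw [← sub_eq_zero]
      apply hG.regular
      rw [mul_sub, ← hG.d_mul he, ← pow_succ', ← hdf, h, map_add, G.d_d, zero_add, sub_self]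

/-- The only datum needed to extend a deformation over an odd variable is a cycle `Z` lifting `∂y`.
The choice of `Z` is free, and the twist `z + t` uses this freedom. -/
theorem adjoin (hG : IsDeformation S e ρ t) {y : E.Y} (hy : y ∉ S) (ho : Odd (E.deg y)) {f : ℕ}
    (hf : E.deg y = f + 1) {Z : G} (hZ : Z ∈ G.grading f) (hdZ : G.d Z = 0)
    (hρZ : E.U.d (E.dpow y 1) = ρ Z) (h : Even f ∨ Z = 0) :
    ∃ (G' : CDGA.{u}) (ρ' : Hom G' E.U) (i : Hom G G'), IsDeformation (insert y S) e ρ' (i t) ∧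
      ∃ v, G'.d v = i Z := by
  have hη : E.dpow y 1 ∈ E.U.grading (f + 1) := by rw [← hf]; simpa using E.dpow_mem y 1
  have hsq : E.dpow y 1 * E.dpow y 1 = 0 := by
    rw [← sq]; exact E.U.sq_eq_zero _ _ (hf ▸ ho) hη
  refine ⟨G.ext1 f Z hZ hdZ h, G.ext1Lift f Z hZ hdZ h ρ _ hη hρZ hsq, G.ext1Incl f Z hZ hdZ h,
    ?_, _, G.d_ext1Var f Z hZ hdZ h⟩
  have hρ : ∀ a b, G.ext1Lift f Z hZ hdZ h ρ _ hη hρZ hsq (G.ext1Incl f Z hZ hdZ h a +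
      G.ext1Incl f Z hZ hdZ h b * G.ext1Var f Z hZ hdZ h) = ρ a + ρ b * E.dpow y 1 := by
    intro a b
    rw [G.ext1Lift_apply, G.ext1Fst_add_mul, G.ext1Snd_add_mul]
  have ht : ∀ a b, G.ext1Incl f Z hZ hdZ h t * (G.ext1Incl f Z hZ hdZ h a +
      G.ext1Incl f Z hZ hdZ h b * G.ext1Var f Z hZ hdZ h) = G.ext1Incl f Z hZ hdZ h (t * a) +
      G.ext1Incl f Z hZ hdZ h (t * b) * G.ext1Var f Z hZ hdZ h := by
    intro a b
    rw [mul_add, ← mul_assoc, ← Hom.map_mul, ← Hom.map_mul]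
  have hS : ∀ x, ρ x ∈ E.adjoin S := fun x => (hG.range _).1 ⟨x, rfl⟩
  constructor
  · exact Hom.map_mem _ _ _ hG.mem
  · rw [← Hom.map_d, hG.cycle, Hom.map_zero]
  · intro x hx
    rw [G.ext1_eq f Z hZ hdZ h x] at hx ⊢
    rw [ht] at hx
    have h1 := G.ext1Fst_add_mul f Z hZ hdZ h (t * G.ext1Fst f Z hZ hdZ h x)
      (t * G.ext1Snd f Z hZ hdZ h x)
    have h2 := G.ext1Snd_add_mul f Z hZ hdZ h (t * G.ext1Fst f Z hZ hdZ h x)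
      (t * G.ext1Snd f Z hZ hdZ h x)
    rw [hx, map_zero] at h1 h2
    rw [hG.regular _ h1.symm, hG.regular _ h2.symm]
    simp
  · have := hρ t 0
    simpa [hG.map] using this
  · intro x hx
    rw [G.ext1_eq f Z hZ hdZ h x] at hx ⊢
    rw [hρ] at hx
    obtain ⟨h1, h2⟩ := eq_zero_of_add_mul_dpow hy (hS _) (hS _) hx
    obtain ⟨a, ha⟩ := hG.ker _ h1
    obtain ⟨b, hb⟩ := hG.ker _ h2
    rw [ha, hb]
    exact ⟨_, (ht a b).symm⟩
  · intro u
    constructor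
    · rintro ⟨x, rfl⟩
      rw [G.ext1_eq f Z hZ hdZ h x, hρ]
      exact add_mem (adjoin_mono (Set.subset_insert _ _) (hS _))
        (MulMemClass.mul_mem (adjoin_mono (Set.subset_insert _ _) (hS _))
          (dpow_mem_adjoin (Set.mem_insert _ _) 1))
    · intro hu
      obtain ⟨n, hn, c, hc, rfl⟩ := mem_adjoin_insert hu
      have hcl : ∀ i, ∃ x, ρ x = c i := fun i => (hG.range _).2 (hc i)
      choose x hx using hcl
      have hn := hn ho
      interval_cases n
      · exact ⟨0, by simp⟩
      · refine ⟨_, (hρ (x 0) 0).trans ?_⟩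
        simp [hx, E.dpow_zero]
      · refine ⟨_, (hρ (x 0) (x 1)).trans ?_⟩
        simp [hx, E.dpow_zero, Finset.sum_range_succ]

end IsDeformation

/-- The constant deformation `A⟨S⟩[t]`, with `∂t = 0` and `t` sent to `0`. -/
theorem isDeformation_subAlg {S : Set E.Y} (hS : Good S) {e : ℕ} (he : Even e) (he0 : 0 < e) :
    ∃ (G : CDGA.{u}) (ρ : Hom G E.U) (i : Hom (subAlg S hS) G) (t : G), IsDeformation S e ρ t ∧
      ∀ x, ρ (i x) = subAlgIncl S hS x := by
  obtain ⟨f, rfl⟩ := Nat.exists_eq_succ_of_ne_zero he0.ne'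
  have hf : Odd f := by
    rcases Nat.even_or_odd f with h | h
    · exact absurd he (Nat.not_even_iff_odd.2 h.add_one)
    · exact h
  let V := subAlg S hS
  have hz : (0 : V) ∈ V.grading f := zero_mem _
  have hdz : V.d 0 = 0 := map_zero _
  have hdη : E.U.d 0 = subAlgIncl S hS 0 := by rw [map_zero, Hom.map_zero]
  refine ⟨V.polyExt f 0 hz hdz hf, V.polyExtLift f 0 hz hdz hf (subAlgIncl S hS) 0 (zero_mem _) hdη,
    V.polyExtIncl f 0 hz hdz hf, V.polyExtVar f 0 hz hdz hf, ?_, fun x => V.polyExtLift_incl ..⟩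
  constructor
  · exact V.polyExtVar_mem f 0 hz hdz hf
  · rw [V.d_polyExtVar, Hom.map_zero]
  · exact V.polyExtVar_regular f 0 hz hdz hf
  · exact V.polyExtLift_var f 0 hz hdz hf _ _ _ _
  · intro x hx
    rw [V.polyExtLift_zero] at hx
    refine V.exists_eq_polyExtVar_mul f 0 hz hdz hf x (subAlgIncl_injective S hS ?_)
    rw [hx, Hom.map_zero]
  · intro u
    rw [← mem_range_subAlgIncl S hS]
    constructor
    · rintro ⟨x, rfl⟩
      exact ⟨_, (V.polyExtLift_zero f 0 hz hdz hf _ hdη x).symm⟩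
    · rintro ⟨x, rfl⟩
      exact ⟨_, V.polyExtLift_incl f 0 hz hdz hf (subAlgIncl S hS) 0 (zero_mem _) hdη x⟩

/-- `A⟨Y⟩` is acyclic in positive degrees, and the unit is not a boundary. -/
structure IsAcyclic (E : GammaExtension A) : Prop where
  exact : ∀ i, 0 < i → ∀ u ∈ E.U.grading i, E.U.d u = 0 → ∃ w ∈ E.U.grading (i + 1), E.U.d w = u
  one_ne : ∀ w, E.U.d w ≠ 1

/-- An element bounding a cycle of degree `i < s` has degree at most `s`, so it involves only
variables in `S`. -/
theorem IsAcyclic.oddExact (hE : IsAcyclic E) {S : Set E.Y} {s : ℕ}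
    (hS : ∀ y, E.deg y ≤ s → y ∈ S) : IsDeformation.OddExact S s := by
  intro i hi his u hu _ hdu
  obtain ⟨w, hw, rfl⟩ := hE.exact i hi.pos u hu hdu
  exact ⟨w, hw, mem_adjoin_of_mem_grading (fun y hy => hS y (by omega)) hw, rfl⟩

/-- If all the variables of degree at least `q` have odd degree, then the boundary of a variable of
degree `q` is not nilpotent in the homology of `A⟨Y_{< q}⟩`. -/
theorem dvar_pow_ne_boundary (hE : IsAcyclic E) {q : ℕ} (hq : 1 < q) (hodd : Odd q)
    (hY : ∀ y, q ≤ E.deg y → Odd (E.deg y)) {y₀ : E.Y} (hy₀ : E.deg y₀ = q) (n : ℕ) {w : E.U}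
    (hw : w ∈ E.adjoin {y | E.deg y < q}) : E.U.d w ≠ E.U.d (E.dpow y₀ 1) ^ n := by
  intro hdw
  obtain ⟨e, rfl⟩ : ∃ e, q = e + 1 := ⟨q - 1, by omega⟩
  have he : Even e := by
    rcases Nat.even_or_odd e with h | h
    · exact h
    · exact absurd h.add_one (Nat.not_even_iff_odd.2 hodd)
  have he0 : 0 < e := by omega
  set S₀ : Set E.Y := {y | E.deg y < e + 1}
  have hS₀ : Good S₀ := good_deg_lt _
  have hz : E.U.d (E.dpow y₀ 1) ∈ E.U.grading e := by
    refine E.U.d_mem _ _ ?_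
    rw [← hy₀]; simpa using E.dpow_mem y₀ 1
  have hy₀S : y₀ ∉ S₀ := fun h => absurd h (by simp [S₀, hy₀])
  have hlow₀ : ∀ y', E.deg y' < E.deg y₀ → y' ∈ S₀ := fun y' h => by
    rw [hy₀] at h; exact h
  have hP₁ : ∃ (G : CDGA.{u}) (ρ : Hom G E.U) (t : G), IsDeformation (insert y₀ S₀) e ρ t ∧
      ∃ f, G.d f = t ^ n := by
    obtain ⟨G, ρ, i, t, hG, hi⟩ := isDeformation_subAlg hS₀ he he0
    let x : subAlg S₀ hS₀ := ⟨_, dvar_mem_adjoin hlow₀⟩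
    have hx : x ∈ (subAlg S₀ hS₀).grading e := hz
    have hdx : (subAlg S₀ hS₀).d x = 0 := Subtype.ext (E.U.d_d _)
    have hix : i x ∈ G.grading e := i.map_mem _ _ hx
    have hdix : G.d (i x) = 0 := by rw [← i.map_d, hdx, i.map_zero]
    -- The twist: `y₀` is adjoined with `∂y₀ = z + t`, which makes `z` homologous to `-t`.
    obtain ⟨G', ρ', j, hG', v, hv⟩ := hG.adjoin hy₀S (hy₀ ▸ hodd) hy₀ (Z := i x + t)
      (add_mem hix hG.mem) (by rw [map_add, hdix, hG.cycle, add_zero])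
      (by rw [ρ.map_add, hi, hG.map, add_zero]; rfl) (Or.inl he)
    refine ⟨G', ρ', j t, hG', ?_⟩
    obtain ⟨b, -, hb⟩ := G'.exists_d_eq_pow_sub_pow ⊤ he (x := j (i x)) (y := -(j t)) (b := v)
      trivial trivial trivial
      (j.map_mem _ _ hix) (by rw [← j.map_d, hdix, j.map_zero])
      (by rw [map_neg, ← j.map_d, hG.cycle, j.map_zero, neg_zero])
      (by rw [hv, j.map_add, sub_neg_eq_add]) n
    let x' : subAlg S₀ hS₀ := ⟨w, hw⟩
    have hx' : (subAlg S₀ hS₀).d x' = x ^ n := Subtype.ext hdw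
    have hw' : G'.d (j (i x')) = j (i x) ^ n := by
      rw [← j.map_d, ← i.map_d, ← j.map_pow, ← i.map_pow, hx']
    have h3 : G'.d (j (i x') - b) = (-(j t)) ^ n := by rw [map_sub, hw', hb, sub_sub_cancel]
    rcases Nat.even_or_odd n with h | h
    · exact ⟨_, h3.trans (h.neg_pow _)⟩
    · exact ⟨-(j (i x') - b), by rw [map_neg, h3, h.neg_pow, neg_neg]⟩
  -- Exactness in odd degrees below `n * e + 2` needs the variables of degree up to `n * e + 2`; the
  -- summand `e + 2` ensures that `y₀` and the smaller variables are included even when `n` is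
  -- small.
  set T : Set E.Y := {y | E.deg y < n * e + 2 + (e + 2)}
  have hS₁T : insert y₀ S₀ ⊆ T := by
    intro y hy
    have : E.deg y ≤ e + 1 := by
      rcases hy with rfl | hy
      · exact hy₀.le
      · exact (show E.deg y < e + 1 from hy).le
    change E.deg y < _
    omega
  have hgood₁ : Good (insert y₀ S₀) := by
    rintro z (rfl | hz) y' hy'
    · exact Or.inr (hlow₀ _ hy')
    · exact Or.inr (hS₀ z hz y' hy')
  obtain ⟨G, ρ, t, hG, f, hf⟩ := good_induction (E := E) (T := T) (good_deg_lt _) hgood₁ hS₁T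
    ((finite_deg_lt _).subset Set.sdiff_subset)
    (P := fun S => ∃ (G : CDGA.{u}) (ρ : Hom G E.U) (t : G), IsDeformation S e ρ t ∧
      ∃ f, G.d f = t ^ n) hP₁ (by
    rintro S y hS hS₁ _ hyS hlow ⟨G, ρ, t, hG, f, hf⟩
    have hyq : e + 1 ≤ E.deg y := by
      by_contra h
      exact hyS (hS₁ (Or.inr (not_le.1 h)))
    have hyo := hY y hyq
    obtain ⟨s, hs⟩ := Nat.exists_eq_succ_of_ne_zero (E.deg_pos y).ne'
    have hse : Even s := by
      rcases Nat.even_or_odd s with h | h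
      · exact h
      · rw [hs] at hyo; exact absurd h.add_one (Nat.not_even_iff_odd.2 hyo)
    have hds : E.U.d (E.dpow y 1) ∈ E.U.grading s := by
      refine E.U.d_mem _ _ ?_
      have := E.dpow_mem y 1
      rwa [one_mul, hs] at this
    have H : IsDeformation.OddExact S s := hE.oddExact fun y' hy' => hlow y' (by omega)
    obtain ⟨Z₀, hZ₀, hρZ₀⟩ := hG.lift (dvar_mem_adjoin hlow) hds
    obtain ⟨s', rfl⟩ : ∃ s', s = s' + 1 := ⟨s - 1, by omega⟩
    -- For a lift `Z₀` of `∂y`, the boundary `∂Z₀` has the form `t * c` with `c` an odd cycle. Since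
    -- `c = ∂g`, the corrected lift `Z₀ - t * g` is a cycle. Here it matters that `y` has odd
    -- degree, for this makes the degree of `c` odd.
    have hZ : ∃ Z ∈ G.grading (s' + 1), G.d Z = 0 ∧ ρ Z = E.U.d (E.dpow y 1) := by
      rcases hG.ker_homogeneous (G.d_mem _ _ hZ₀) (by rw [ρ.map_d, hρZ₀, E.U.d_d])
        with h | ⟨k, hk, c, hc, h⟩
      · exact ⟨Z₀, hZ₀, h, hρZ₀⟩
      · have hko : Odd k := by
          rcases Nat.even_or_odd k with h' | h'
          · exact absurd hse (Nat.not_even_iff_odd.2 (hk ▸ h'.add he).add_one)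
          · exact h'
        have hdc : G.d c = 0 := by
          apply hG.regular
          rw [← hG.d_mul he, ← h, G.d_d]
        obtain ⟨g, hg, rfl⟩ := hG.oddExact he he0 H k hko (by omega) c hc hdc
        refine ⟨Z₀ - t * g, sub_mem hZ₀ ?_, ?_, ?_⟩
        · have := G.mul_mem hG.mem hg
          rwa [show e + (k + 1) = s' + 1 by omega] at this
        · rw [map_sub, hG.d_mul he, h, sub_self]
        · rw [ρ.map_sub, ρ.map_mul, hG.map, zero_mul, sub_zero, hρZ₀]
    obtain ⟨Z, hZm, hdZ, hρZ⟩ := hZ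
    obtain ⟨G', ρ', j, hG', -⟩ := hG.adjoin hyS hyo hs hZm hdZ hρZ.symm (Or.inl hse)
    exact ⟨G', ρ', j t, hG', j f, by rw [← j.map_d, hf, j.map_pow]⟩)
  -- As `t ^ n` has degree `n * e`, only the component of `f` in the odd degree `n * e + 1` matters.
  refine hG.pow_ne_boundary he (s := n * e + 2)
    (hE.oddExact fun y hy => show E.deg y < _ by omega) hE.one_ne n (n * e + 1)
    (he.mul_left n).add_one (by omega) (G.pr _ f) (G.pr_mem _ f) ?_
  rw [← G.pr_d, hf, G.pr_of_mem (G.pow_mem hG.mem n)]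

end GammaExtension

/-! ### Quasi-isomorphisms as morphisms with acyclic cone. -/

theorem exists_sum_pr (C : CDGA.{u}) (a : C) :
    ∃ n, ∀ m, n ≤ m → a = ∑ i ∈ Finset.range m, C.pr i a := by
  induction a using C.induction_homogeneous with
  | h0 => exact ⟨0, fun m _ => by simp⟩
  | hom i a ha =>
    refine ⟨i + 1, fun m hm => ?_⟩
    rw [Finset.sum_eq_single i (fun j _ hj => C.pr_of_mem_ne ha hj.symm)
      (fun h => absurd (Finset.mem_range.2 hm) h), C.pr_of_mem ha]
  | add a b ha hb =>
    obtain ⟨n, hn⟩ := ha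
    obtain ⟨n', hn'⟩ := hb
    refine ⟨max n n', fun m hm => ?_⟩
    simp only [map_add, Finset.sum_add_distrib]
    rw [← hn m (le_of_max_le_left hm), ← hn' m (le_of_max_le_right hm)]

/-- The mapping cone of `f`, with target restricted to the subring `H`, is acyclic. -/
def Hom.ConeExact {A : CDGA.{u}} {B : CDGA.{v}} (f : Hom A B) (H : Subring B) : Prop :=
  ∀ v ∈ H, ∀ x, B.d v = f x → A.d x = 0 → ∃ u, ∃ e ∈ H, A.d u = x ∧ v = f u + B.d e

/-- In each degree, injectivity on homology gives `u` with `∂u = x`, and surjectivity corrects `u`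
by a cycle so that `v - f u` becomes a boundary. Summing the components removes homogeneity, which
makes the property convenient for inductions over free extensions. -/
theorem coneExact_of_isQuasiIso {A : CDGA.{u}} {B : CDGA.{v}} {f : Hom A B} (hf : f.IsQuasiIso) :
    f.ConeExact ⊤ := by
  have key : ∀ i, ∀ v ∈ B.grading (i + 1), ∀ x ∈ A.grading i, B.d v = f x → A.d x = 0 →
      ∃ u e, A.d u = x ∧ v = f u + B.d e := by
    intro i v hv x hx hvx hdx
    obtain ⟨u, hu, rfl⟩ := (hf i).1 x ⟨hx, hdx⟩ ⟨v, hv, hvx⟩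
    obtain ⟨a, ⟨ha, hda⟩, e, -, he⟩ := (hf (i + 1)).2 (v - f u)
      ⟨sub_mem hv (f.map_mem _ _ hu), by rw [map_sub, hvx, f.map_d, sub_self]⟩
    refine ⟨u + a, e, by rw [map_add, hda, add_zero], ?_⟩
    rw [f.map_add, he]; abel
  have key0 : ∀ v ∈ B.grading 0, ∃ u e, A.d u = 0 ∧ v = f u + B.d e := by
    intro v hv
    obtain ⟨a, ⟨_, hda⟩, e, -, he⟩ := (hf 0).2 v ⟨hv, B.d_eq_zero _ hv⟩
    exact ⟨a, e, hda, by rw [he]; abel⟩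
  intro v _ x hvx hdx
  obtain ⟨n, hn⟩ := B.exists_sum_pr v
  obtain ⟨n', hn'⟩ := A.exists_sum_pr x
  have h : ∀ i, ∃ u e, A.d u = A.pr i x ∧ B.pr (i + 1) v = f u + B.d e := fun i =>
    key i _ (B.pr_mem _ _) _ (A.pr_mem _ _) (by rw [← B.pr_d, hvx, f.map_pr])
      (by
        obtain _ | i := i
        · exact A.d_eq_zero _ (A.pr_mem _ _)
        · rw [← A.pr_d, hdx, map_zero])
  choose u e hu he using h
  obtain ⟨u₀, e₀, hu₀, he₀⟩ := key0 _ (B.pr_mem 0 v)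
  refine ⟨u₀ + ∑ i ∈ Finset.range (max n n'), u i, e₀ + ∑ i ∈ Finset.range (max n n'), e i,
    trivial, ?_, ?_⟩
  · rw [map_add, hu₀, zero_add, map_sum, Finset.sum_congr rfl (fun i _ => hu i)]
    exact (hn' _ (le_max_right _ _)).symm
  · have h1 := hn (max n n' + 1) (by omega)
    rw [Finset.sum_range_succ', he₀, Finset.sum_congr rfl (fun i _ => he i),
      Finset.sum_add_distrib] at h1
    have h2 : f (∑ i ∈ Finset.range (max n n'), u i) = ∑ i ∈ Finset.range (max n n'), f (u i) :=
      _root_.map_sum f.toRingHom _ _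
    rw [h1, f.map_add, h2, map_add, map_sum]
    abel

/-! ### The operation `P(x) = x^p - π x^{p-1} ∂x`. -/

section Frobenius

variable (C : CDGA.{u}) (p : ℕ) (π : C)

/-- The operation `x ↦ x^p - π x^{p-1} ∂x`. -/
def frob (x : C) : C := x ^ p - π * (x ^ (p - 1) * C.d x)

variable {C p π}

/-- `∂(x^p) = p x^{p-1} ∂x` is cancelled by `∂π = p`, and the remaining term contains the square of
the odd element `∂x`. -/
theorem d_frob (hp : p ≠ 0) (hπ : π ∈ C.grading 1) (hdπ : C.d π = p) {e : ℕ} (he : Even e) {x : C}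
    (hx : x ∈ C.grading (e + 2)) : C.d (C.frob p π x) = 0 := by
  obtain ⟨m, rfl⟩ := Nat.exists_eq_succ_of_ne_zero hp
  have he2 : Even (e + 2) := he.add (by decide)
  have hdd : C.d x * C.d x = 0 := by
    rw [← sq]; exact C.sq_eq_zero _ _ he.add_one (C.d_mem _ _ hx)
  have h1 : C.d (x ^ m * C.d x) = 0 := by
    rw [C.d_mul_cycle _ (C.d_d x)]
    obtain _ | m := m
    · simp [C.d_one]
    · rw [C.d_pow_of_even hx he2, mul_assoc, mul_assoc, hdd]; simp
  rw [frob, map_sub, C.d_mul_of_odd hπ odd_one, hdπ, Nat.succ_sub_one, h1,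
    C.d_pow_of_even hx he2]
  simp

theorem frob_zero (hp : p ≠ 0) : C.frob p π 0 = 0 := by simp [frob, hp]

/-- This is an equality on the nose: the only unwanted cross term contains `π ^ 2 = 0`, and the
others assemble by the Leibniz rule. -/
theorem frob_mul {e f : ℕ} (hp : p ≠ 0) (hπ : π ∈ C.grading 1) (he : Even e) (hf : Even f)
    {x y : C} (hx : x ∈ C.grading (e + 2)) (hy : y ∈ C.grading f) :
    C.frob p π (x * y) = C.frob p π x * C.frob p π y := by
  obtain ⟨m, rfl⟩ := Nat.exists_eq_succ_of_ne_zero hp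
  have he2 : Even (e + 2) := he.add (by decide)
  have cx : ∀ b, x * b = b * x := fun b => (C.comm_even hx he2 b).eq
  have cy : ∀ b, y * b = b * y := fun b => (C.comm_even hy hf b).eq
  have cxn : ∀ n b, x ^ n * b = b * x ^ n := fun n b => ((C.comm_even hx he2 b).pow_left n).eq
  have cyn : ∀ n b, y ^ n * b = b * y ^ n := fun n b => ((C.comm_even hy hf b).pow_left n).eq
  have hππ : π * π = 0 := by rw [← sq]; exact C.sq_eq_zero _ _ odd_one hπ
  have h3 : C.d x * π = -(π * C.d x) := by
    rw [C.mul_comm_odd hπ odd_one, C.sgn_of_odd (C.d_mem _ _ hx) he.add_one, neg_mul, neg_neg]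
  have e1 : (x * y) ^ (m + 1) = x ^ (m + 1) * y ^ (m + 1) :=
    (C.comm_even hx he2 y).mul_pow _
  have e2 : (x * y) ^ m = x ^ m * y ^ m := (C.comm_even hx he2 y).mul_pow _
  have e3 : π * (x ^ m * C.d x) * (π * (y ^ m * C.d y)) = 0 := by
    calc π * (x ^ m * C.d x) * (π * (y ^ m * C.d y))
        = π * x ^ m * (C.d x * π) * (y ^ m * C.d y) := by noncomm_ring
      _ = -(π * (x ^ m * π) * C.d x * (y ^ m * C.d y)) := by rw [h3]; noncomm_ring
      _ = -(π * π * x ^ m * C.d x * (y ^ m * C.d y)) := by rw [cxn m π]; noncomm_ring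
      _ = 0 := by rw [hππ]; simp
  have e4 : π * (x ^ m * y ^ m * (C.d x * y + x * C.d y)) =
      x ^ (m + 1) * (π * (y ^ m * C.d y)) + π * (x ^ m * C.d x) * y ^ (m + 1) := by
    have a1 : x ^ (m + 1) * (π * (y ^ m * C.d y)) = π * (x ^ m * y ^ m * (x * C.d y)) := by
      calc x ^ (m + 1) * (π * (y ^ m * C.d y)) = x ^ (m + 1) * π * (y ^ m * C.d y) := by
            rw [mul_assoc]
        _ = π * (x ^ m * (x * y ^ m) * C.d y) := by rw [cxn, pow_succ]; noncomm_ring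
        _ = π * (x ^ m * y ^ m * (x * C.d y)) := by rw [cx]; noncomm_ring
    have a2 : π * (x ^ m * C.d x) * y ^ (m + 1) = π * (x ^ m * y ^ m * (C.d x * y)) := by
      rw [mul_assoc, mul_assoc, mul_assoc, ← mul_assoc (y ^ m), cyn m (C.d x), mul_assoc (C.d x),
        pow_succ]
    rw [mul_add, mul_add, a1, a2, add_comm]
  rw [frob, frob, frob, C.d_mul_of_even hx he2, Nat.succ_sub_one, Nat.succ_eq_add_one, e1, e2, e4,
    sub_mul, mul_sub, mul_sub, e3, sub_zero, sub_sub]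

/-- For odd `x` and `y`, both `(xy)^2` and `xy ∂(xy)` vanish since `x ^ 2 = y ^ 2 = 0`. The exponent
`p - 1` is at least one, so both terms of `P(xy)` disappear. -/
theorem frob_mul_of_odd {e f : ℕ} (hp : 2 ≤ p) (he : Odd e) (hf : Odd f)
    {x y : C} (hx : x ∈ C.grading e) (hy : y ∈ C.grading f) : C.frob p π (x * y) = 0 := by
  obtain ⟨m, rfl⟩ := Nat.exists_eq_add_of_le' hp
  have hxx : x * x = 0 := by rw [← sq]; exact C.sq_eq_zero _ _ he hx
  have hyy : y * y = 0 := by rw [← sq]; exact C.sq_eq_zero _ _ hf hy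
  have hyx : y * x = -(x * y) := by
    rw [C.mul_comm_odd hy hf, C.sgn_of_odd hx he, neg_mul]
  have h1 : x * y * (x * y) = 0 := by
    rw [mul_assoc, ← mul_assoc y, hyx, neg_mul, mul_assoc x y y, hyy]; simp
  have hdx : ∀ b, C.d x * b = b * C.d x := by
    obtain ⟨k, rfl⟩ : ∃ k, e = k + 1 := ⟨e - 1, by have := he.pos; omega⟩
    have hk : Even k := by
      rcases Nat.even_or_odd k with h | h
      · exact h
      · exact absurd h.add_one (Nat.not_even_iff_odd.2 he)
    exact fun b => (C.comm_even (C.d_mem _ _ hx) hk b).eq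
  have h2 : x * y * C.d (x * y) = 0 := by
    rw [C.d_mul_of_odd hx he, hdx, mul_sub, ← mul_assoc (x * y) y, mul_assoc x y y, hyy,
      ← mul_assoc (x * y) x, mul_assoc x y x, hyx, mul_neg, ← mul_assoc, hxx]
    simp
  have e1 : (x * y) ^ (m + 2) = 0 := by rw [pow_add, sq, h1, mul_zero]
  have e2 : (x * y) ^ (m + 2 - 1) * C.d (x * y) = 0 := by
    rw [show m + 2 - 1 = m + 1 by omega, pow_succ, mul_assoc, h2, mul_zero]
  rw [frob, e1, e2]
  simp

/-- For `p` prime, `(x+y)^p - x^p - y^p = p Q` with `Q` an integral polynomial in `x` and `y`. The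
additivity defect of `P` is exactly `∂(π Q) = p Q - π ∂Q`. -/
theorem frob_add {H : Subring C} (hp : p.Prime) (hπ : π ∈ C.grading 1) (hπH : π ∈ H)
    (hdπ : C.d π = p) {e : ℕ} (he : Even e) {x y : C} (hx : x ∈ C.grading e)
    (hy : y ∈ C.grading e) (hxH : x ∈ H) (hyH : y ∈ H) :
    ∃ b ∈ H, C.frob p π (x + y) = C.frob p π x + C.frob p π y + C.d b := by
  obtain ⟨m, rfl⟩ := Nat.exists_eq_succ_of_ne_zero hp.ne_zero
  have hdvd : ∀ j, j < m → m + 1 ∣ (m + 1).choose (j + 1) := fun j hj =>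
    hp.dvd_choose_self (Nat.succ_ne_zero j) (by omega)
  -- The coefficients of `Q` are binomial coefficients divided by `p = m + 1`. Differentiating `Q`
  -- multiplies them by exponents and turns them into binomial coefficients of order `m`, as the
  -- next two identities say. Thus no division by `p` is needed to find `∂Q`.
  let c : ℕ → ℕ := fun j => (m + 1).choose (j + 1) / (m + 1)
  have hc : ∀ j < m, (m + 1) * c j = (m + 1).choose (j + 1) := fun j hj =>
    Nat.mul_div_cancel' (hdvd j hj)
  have hc1 : ∀ j < m, c j * (j + 1) = m.choose j := by
    intro j hj
    apply Nat.eq_of_mul_eq_mul_left (Nat.succ_pos m)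
    rw [← mul_assoc, Nat.succ_eq_add_one, hc j hj]
    exact (Nat.add_one_mul_choose_eq m j).symm
  have hc2 : ∀ j < m, c j * (m - j) = m.choose (j + 1) := by
    intro j hj
    apply Nat.eq_of_mul_eq_mul_left (Nat.succ_pos m)
    rw [← mul_assoc, Nat.succ_eq_add_one, hc j hj, mul_comm (m + 1) (m.choose _),
      Nat.choose_mul_succ_eq]
    congr 1; omega
  let Q : C := ∑ j ∈ Finset.range m, (c j) • (x ^ (j + 1) * y ^ (m - j))
  have hxy : Commute x y := C.comm_even hx he y
  have hQH : Q ∈ H := sum_mem fun j _ => nsmul_mem (H.mul_mem (H.pow_mem hxH _) (H.pow_mem hyH _)) _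
  have hpQ : ((m + 1 : ℕ) : C) * Q = (x + y) ^ (m + 1) - x ^ (m + 1) - y ^ (m + 1) := by
    rw [hxy.add_pow, Finset.sum_range_succ, Finset.sum_range_succ', Finset.mul_sum]
    have : ∀ j ∈ Finset.range m, ((m + 1 : ℕ) : C) * ((c j) • (x ^ (j + 1) * y ^ (m - j))) =
        x ^ (j + 1) * y ^ (m + 1 - (j + 1)) * ((m + 1).choose (j + 1) : ℕ) := by
      intro j hj
      rw [← hc j (Finset.mem_range.1 hj), Nat.add_sub_add_right, ← nsmul_eq_mul, ← nsmul_eq_mul',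
        mul_smul]
    rw [Finset.sum_congr rfl this]
    simp
  have hdQ : C.d Q = (x + y) ^ m * C.d (x + y) - x ^ m * C.d x - y ^ m * C.d y := by
    have hterm : ∀ j ∈ Finset.range m, C.d ((c j) • (x ^ (j + 1) * y ^ (m - j))) =
        (x ^ j * y ^ (m - j) * (m.choose j : ℕ)) * C.d x +
        (x ^ (j + 1) * y ^ (m - (j + 1)) * (m.choose (j + 1) : ℕ)) * C.d y := by
      intro j hj
      have hj' := Finset.mem_range.1 hj
      obtain ⟨k, hk⟩ : ∃ k, m - j = k + 1 := ⟨m - j - 1, by omega⟩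
      have hk' : m - (j + 1) = k := by omega
      have b1 : C.d x * y ^ (k + 1) = y ^ (k + 1) * C.d x :=
        ((C.comm_even hy he (C.d x)).pow_left (k + 1)).eq.symm
      rw [map_nsmul, C.d_mul_of_even (C.pow_mem hx (j + 1)) (he.mul_left _), hk, hk',
        C.d_pow_of_even hx he, C.d_pow_of_even hy he, ← hc1 j hj', ← hc2 j hj', hk]
      simp only [← nsmul_eq_mul, ← nsmul_eq_mul', smul_mul_assoc, mul_smul_comm, smul_add, mul_smul,
        mul_assoc, b1]
    rw [map_sum, Finset.sum_congr rfl hterm, Finset.sum_add_distrib, ← Finset.sum_mul,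
      ← Finset.sum_mul, map_add, mul_add]
    have s1 : (x + y) ^ m = (∑ j ∈ Finset.range m, x ^ j * y ^ (m - j) * (m.choose j : ℕ)) +
        x ^ m := by
      rw [hxy.add_pow, Finset.sum_range_succ]; simp
    have s2 : (x + y) ^ m = (∑ j ∈ Finset.range m,
        x ^ (j + 1) * y ^ (m - (j + 1)) * (m.choose (j + 1) : ℕ)) + y ^ m := by
      rw [hxy.add_pow, Finset.sum_range_succ']; simp
    rw [← sub_eq_iff_eq_add.2 s1, ← sub_eq_iff_eq_add.2 s2]
    noncomm_ring
  refine ⟨π * Q, H.mul_mem hπH hQH, ?_⟩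
  rw [C.d_mul_of_odd hπ odd_one, hdπ, Nat.succ_eq_add_one, hpQ, hdQ, frob, frob, frob]
  simp only [Nat.add_sub_cancel]
  noncomm_ring

end Frobenius

theorem IsNil.isNilpotent {A : CDGA.{u}} (h : A.IsNil) {i : ℕ} (hi : i ≠ 0) {a : A}
    (ha : a ∈ A.grading i) : IsNilpotent a := by
  obtain ⟨n, -, hn⟩ := h a (A.toZeroRing_of_mem hi ha)
  exact ⟨n, hn⟩

/-! ### Cycles `x - π w` handled as pairs `(x, w)`, and nilpotence of `P(a)`. -/

section Pairs

/-- If `f` is a quasi-isomorphism and `f x = 0`, `f w = 0`, then the cycle `x - π w`, where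
`∂ π = p`, is a boundary. -/
theorem exists_of_map_eq_zero {A : CDGA.{u}} {B : CDGA.{v}} {f : Hom A B} (hf : f.ConeExact ⊤)
    (p : ℕ) {x w : A} (hx : A.d x = p * w) (hw : A.d w = 0) (hfx : f x = 0) (hfw : f w = 0) :
    ∃ g h, x = A.d g + p * h ∧ w = A.d h := by
  -- Two applications of cone exactness: `w = ∂h` with `f h` a boundary `-∂e`, and then `x - p h` is
  -- a cycle mapping to the boundary of `p e`.
  obtain ⟨h, e, -, hh, he⟩ := hf 0 trivial w (by rw [map_zero, hfw]) hw
  have hdp : ∀ c, B.d (p * c) = p * B.d c := fun c => by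
    rw [← nsmul_eq_mul, map_nsmul, nsmul_eq_mul]
  obtain ⟨g, -, -, hg, -⟩ := hf (p * e) trivial (x - p * h)
    (by
      rw [f.map_sub, hfx, hdp, zero_sub, f.map_mul, map_natCast, ← mul_neg]
      congr 1
      exact eq_neg_of_add_eq_zero_right he.symm)
    (by rw [map_sub, hx, ← nsmul_eq_mul, ← nsmul_eq_mul, map_nsmul, hh, sub_self])
  exact ⟨g, h, by rw [hg]; abel, hh.symm⟩

/-- If `f` is a quasi-isomorphism, every cycle `x - π w`, where `∂ π = p`, is homologous to one in
the image of `f`. -/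
theorem exists_preimage_pair {A : CDGA.{u}} {B : CDGA.{v}} {f : Hom A B} (hf : f.ConeExact ⊤)
    (p : ℕ) {i : ℕ} {x w : B} (hx : x ∈ B.grading (i + 1)) (hw : w ∈ B.grading i)
    (hdx : B.d x = p * w) (hdw : B.d w = 0) :
    ∃ x' ∈ A.grading (i + 1), ∃ w' ∈ A.grading i, A.d x' = p * w' ∧ A.d w' = 0 ∧
      ∃ g h, x = f x' + B.d g + p * h ∧ w = f w' + B.d h := by
  have hdp : ∀ (C : CDGA.{v}) (c : C), C.d (p * c) = p * C.d c := fun C c => by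
    rw [← nsmul_eq_mul, map_nsmul, nsmul_eq_mul]
  have hdp' : ∀ (C : CDGA.{u}) (c : C), C.d (p * c) = p * C.d c := fun C c => by
    rw [← nsmul_eq_mul, map_nsmul, nsmul_eq_mul]
  have hprp : ∀ (C : CDGA.{v}) (c : C) (j : ℕ), C.pr j (p * c) = p * C.pr j c := fun C c j => by
    rw [← nsmul_eq_mul, map_nsmul, nsmul_eq_mul]
  have hprp' : ∀ (C : CDGA.{u}) (c : C) (j : ℕ), C.pr j (p * c) = p * C.pr j c := fun C c j => by
    rw [← nsmul_eq_mul, map_nsmul, nsmul_eq_mul]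
  obtain ⟨w', h, -, hw', hh⟩ := hf w trivial 0 (by rw [hdw, f.map_zero]) (map_zero _)
  obtain ⟨x', g, -, hx', hg⟩ := hf (x - p * h) trivial (p * w')
    (by rw [map_sub, hdx, hdp, hh, f.map_mul, map_natCast]; noncomm_ring)
    (by rw [hdp', hw', mul_zero])
  have hw'' : A.d (A.pr i w') = 0 := by
    obtain _ | i := i
    · exact A.d_eq_zero _ (A.pr_mem _ _)
    · rw [← A.pr_d, hw', map_zero]
  refine ⟨A.pr (i + 1) x', A.pr_mem _ _, A.pr i w', A.pr_mem _ _, ?_, hw'',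
    B.pr (i + 2) g, B.pr (i + 1) h, ?_, ?_⟩
  · rw [← A.pr_d, hx', hprp']
  · rw [f.map_pr, ← B.pr_d, ← hprp, ← map_add, ← map_add, ← hg, sub_add_cancel, B.pr_of_mem hx]
  · rw [f.map_pr, ← B.pr_d, ← map_add, ← hh, B.pr_of_mem hw]

end Pairs

/-- Since `π ^ 2 = 0`, the binomial expansion stops after the term linear in `π w`. -/
theorem sub_pow_succ (C : CDGA.{u}) {e : ℕ} (he : Even e) {x π w : C} (hx : x ∈ C.grading e)
    (hπ : π ∈ C.grading 1) (hww : w * π = -(π * w)) (n : ℕ) :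
    (x - π * w) ^ (n + 1) = x ^ (n + 1) - π * ((n + 1 : ℕ) * (x ^ n * w)) := by
  have hππ : π * π = 0 := by rw [← sq]; exact C.sq_eq_zero _ _ odd_one hπ
  have cx : ∀ n b, x ^ n * b = b * x ^ n := fun n b => ((C.comm_even hx he b).pow_left n).eq
  induction n with
  | zero => simp
  | succ n ih =>
    have e1 : π * ((n + 1 : ℕ) * (x ^ n * w)) * (π * w) = 0 := by
      rw [mul_assoc, mul_assoc, mul_assoc, ← mul_assoc w, hww, ← mul_assoc (x ^ n),
        cx n (-(π * w)), ← mul_assoc, ← mul_assoc, ← mul_assoc, mul_assoc π,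
        (Nat.cast_commute (n + 1) (-(π * w))).eq, ← mul_assoc, mul_neg, ← mul_assoc π π, hππ]
      simp
    have e2 : w * x = x * w := by simpa using (cx 1 w).symm
    have e3 : x ^ (n + 1) * (π * w) = π * (x ^ (n + 1) * w) := by
      rw [← mul_assoc, cx, mul_assoc]
    have e4 : π * ((n + 1 : ℕ) * (x ^ n * w)) * x = π * ((n + 1 : ℕ) * (x ^ (n + 1) * w)) := by
      rw [mul_assoc, mul_assoc, mul_assoc, e2, pow_succ, mul_assoc]
    rw [pow_succ, ih, mul_sub, sub_mul, sub_mul, e1, e3, e4, ← pow_succ]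
    push_cast
    noncomm_ring

/-- The element is the second component of the pair that represents `(x - π w) ^ (n + 1)`. -/
theorem d_pow_mul_of_sq {C : CDGA.{u}} {e : ℕ} (he : Even e) {x w : C} (hx : x ∈ C.grading e)
    {p : ℕ} (hdx : C.d x = p * w) (hdw : C.d w = 0) (hww : w * w = 0) (n : ℕ) :
    C.d (((n + 1 : ℕ) : C) * (x ^ n * w)) = 0 := by
  rw [← nsmul_eq_mul, map_nsmul, C.d_mul_cycle _ hdw]
  obtain _ | n := n
  · simp [C.d_one]
  · rw [C.d_pow_of_even hx he, hdx, mul_assoc, mul_assoc, mul_assoc, hww]; simp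

/-- The powers of `P(a)` become boundaries if `A` is derived nilpotent. -/
theorem exists_frob_pow_boundary {A : CDGA.{u}} [A.IsLocal] (hA : IsDerivedNilpotent.{u, w} A)
    {U : CDGA.{u}} (i : Hom A U) (H : Subring U) (hi : ∀ a, i a ∈ H) {p : ℕ} (hp : p ≠ 0) {π : U}
    (hπ : π ∈ U.grading 1) (hπH : π ∈ H) (hdπ : U.d π = p) {e : ℕ} (he : Even e) {a : A}
    (ha : a ∈ A.grading (e + 2)) : ∃ N, ∃ b ∈ H, U.d b = U.frob p π (i a) ^ N := by
  obtain ⟨m, rfl⟩ := Nat.exists_eq_succ_of_ne_zero hp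
  have he2 : Even (e + 2) := he.add (by decide)
  set x : A := a ^ (m + 1) with hx
  set w : A := a ^ m * A.d a with hw
  set k := m * (e + 2) + (e + 1) with hk
  have hko : Odd k := (he2.mul_left m).add_odd he.add_one
  have hxm : x ∈ A.grading (k + 1) := by
    have := A.pow_mem ha (m + 1)
    rwa [show (m + 1) * (e + 2) = k + 1 by rw [hk, add_mul]; omega] at this
  have hwm : w ∈ A.grading k := A.mul_mem (A.pow_mem ha m) (A.d_mem _ _ ha)
  have hdx : A.d x = (m + 1 : ℕ) * w := A.d_pow_of_even ha he2 m
  have hww : w * w = 0 := by rw [← sq]; exact A.sq_eq_zero _ _ hko hwm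
  have hdw : A.d w = 0 := by
    rw [hw, A.d_mul_cycle _ (A.d_d a)]
    obtain _ | m := m
    · simp [A.d_one]
    · have : A.d a * A.d a = 0 := by
        rw [← sq]; exact A.sq_eq_zero _ _ he.add_one (A.d_mem _ _ ha)
      rw [A.d_pow_of_even ha he2, mul_assoc, mul_assoc, this]; simp
  have hfrob : U.frob (m + 1) π (i a) = i x - π * i w := by
    rw [frob, hx, hw, i.map_mul, i.map_pow, i.map_pow, i.map_d, Nat.add_sub_cancel]
  have hanti : ∀ c ∈ U.grading k, c * π = -(π * c) := fun c hc => by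
    rw [U.mul_comm_odd hc hko, U.sgn_of_odd hπ odd_one, neg_mul]
  -- A pair of the form `(∂g + p h, ∂h)` therefore represents the boundary of `g + π h`, with `π`
  -- present only in `U` and not in `A`.
  have hD : ∀ g h : A, U.d (i g + π * i h) = i (A.d g + (m + 1 : ℕ) * h) - π * i (A.d h) := by
    intro g h
    rw [map_add, U.d_mul_of_odd hπ odd_one, hdπ, i.map_add, i.map_mul, i.map_d, i.map_d,
      map_natCast, Nat.succ_eq_add_one]
    abel
  obtain ⟨B, _, hB, ⟨f, -, hf⟩ | ⟨f, -, hf⟩⟩ := hA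
  -- For `A → B`, the image of `a` is nilpotent. Both components of the pair of `P(a) ^ (M + 1)`
  -- contain `x ^ M` and so die in `B`; the pair is then a boundary pair in `A`.
  · obtain ⟨M, hM⟩ := hB.isNilpotent (by omega) (f.map_mem _ _ ha)
    have hMx : f (x ^ M) = 0 := by
      rw [hx, ← pow_mul, f.map_pow, mul_comm, pow_mul, hM, zero_pow (Nat.succ_ne_zero m)]
    obtain ⟨g, h, hg, hh⟩ := exists_of_map_eq_zero (coneExact_of_isQuasiIso hf) (m + 1)
      (x := x ^ (M + 1)) (w := ((M + 1 : ℕ) : A) * (x ^ M * w))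
      (by
        rw [A.d_pow_of_even hxm hko.add_one, hdx, ← nsmul_eq_mul, ← nsmul_eq_mul, ← nsmul_eq_mul,
          ← nsmul_eq_mul, mul_smul_comm, smul_comm])
      (d_pow_mul_of_sq hko.add_one hxm hdx hdw hww M)
      (by rw [pow_succ, f.map_mul, hMx, zero_mul])
      (by rw [f.map_mul, f.map_mul, hMx, zero_mul, mul_zero])
    refine ⟨M + 1, i g + π * i h, H.add_mem (hi _) (H.mul_mem hπH (hi _)), ?_⟩
    rw [hD, ← hg, ← hh, hfrob, U.sub_pow_succ hko.add_one (i.map_mem _ _ hxm) hπ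
      (hanti _ (i.map_mem _ _ hwm))]
    simp only [i.map_mul, i.map_pow, map_natCast]
  -- For `B → A`, the pair of `P(a)` is homologous to the image of a pair from `B` whose first
  -- component `x'` is nilpotent. A power of that cycle is zero, since both of its terms contain `x'
  -- ^ M`.
  · obtain ⟨x', hx', w', hw', -, -, g, h, hg, hh⟩ := exists_preimage_pair
      (coneExact_of_isQuasiIso hf) (m + 1) hxm hwm hdx hdw
    obtain ⟨M, hM⟩ := hB.isNilpotent (Nat.succ_ne_zero k) hx'
    have hxU : i (f x') ∈ U.grading (k + 1) := i.map_mem _ _ (f.map_mem _ _ hx')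
    have hwU : i (f w') ∈ U.grading k := i.map_mem _ _ (f.map_mem _ _ hw')
    have hsub : U.frob (m + 1) π (i a) =
        (i (f x') - π * i (f w')) + U.d (i g + π * i h) := by
      rw [hD, hfrob, hg, hh]
      simp only [i.map_add, mul_add]
      abel
    have hcyc : U.d (U.frob (m + 1) π (i a)) = 0 :=
      d_frob (Nat.succ_ne_zero m) hπ hdπ he (i.map_mem _ _ ha)
    have hpow : (i (f x') - π * i (f w')) ^ (M + 1) = 0 := by
      rw [U.sub_pow_succ hko.add_one hxU hπ (hanti _ hwU), ← i.map_pow, ← f.map_pow, ← i.map_pow,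
        ← f.map_pow, hM, pow_succ, hM]
      simp
    have hmem : U.frob (m + 1) π (i a) ∈ U.grading (k + 1) := by
      rw [hfrob, add_comm k]
      refine sub_mem ?_ (U.mul_mem hπ (i.map_mem _ _ hwm))
      rw [add_comm 1]
      exact i.map_mem _ _ hxm
    have hbH : i g + π * i h ∈ H := H.add_mem (hi _) (H.mul_mem hπH (hi _))
    have hyH : i (f x') - π * i (f w') ∈ H := H.sub_mem (hi _) (H.mul_mem hπH (hi _))
    have hfH : U.frob (m + 1) π (i a) ∈ H := by
      rw [hfrob]; exact H.sub_mem (hi _) (H.mul_mem hπH (hi _))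
    obtain ⟨b, hb, hdb⟩ := U.exists_d_eq_pow_sub_pow H hko.add_one hfH hyH hbH hmem hcyc
      (by
        have h2 := congrArg U.d hsub
        rw [hcyc, map_add, U.d_d, add_zero] at h2
        exact h2.symm)
      (by rw [hsub]; abel) (M + 1)
    exact ⟨M + 1, b, hb, by rw [hdb, hpow, sub_zero]⟩

/-! ### Positive residue characteristic: reduction to elements of `A`. -/

namespace GammaExtension

variable {A : CDGA.{u}} {E : GammaExtension A}

theorem dpow_pow (y : E.Y) (hy : Even (E.deg y)) (i k : ℕ) :
    ∃ n : ℕ, E.dpow y i ^ k = n • E.dpow y (i * k) := by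
  induction k with
  | zero => exact ⟨1, by simp [E.dpow_zero]⟩
  | succ k ih =>
    obtain ⟨n, hn⟩ := ih
    refine ⟨n * (i * k + i).choose (i * k), ?_⟩
    rw [pow_succ, hn, smul_mul_assoc, E.dpow_mul y hy, mul_smul, nsmul_eq_mul, nsmul_eq_mul,
      nsmul_eq_mul, mul_add_one]

/-- `(y^{(i)})^p` is `p` times an integer multiple `r y^{(ip)}`, and `(y^{(i)})^{p-1} ∂(y^{(i)})` is
`r ∂(y^{(ip)})` with the same `r`. Hence `P(y^{(i)}) = ∂(π r y^{(ip)})`. -/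
theorem frob_dpow {S : Set E.Y} {y : E.Y} (hyS : y ∈ S) (hy : Even (E.deg y)) {p : ℕ} (hp : p ≠ 0)
    {π : E.U} (hπ : π ∈ E.U.grading 1) (hπS : π ∈ E.adjoin S) (hdπ : E.U.d π = p) {i : ℕ}
    (hi : i ≠ 0) : ∃ b ∈ E.adjoin S, E.U.frob p π (E.dpow y i) = E.U.d b := by
  obtain ⟨m, rfl⟩ := Nat.exists_eq_succ_of_ne_zero hp
  obtain ⟨j, rfl⟩ := Nat.exists_eq_succ_of_ne_zero hi
  obtain ⟨M, hM⟩ := dpow_pow y hy (j + 1) m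
  set l := (j + 1) * m with hl
  -- Here `l + (j + 1) = (m + 1)(j + 1)`, so the factor `p = m + 1` comes out of the binomial
  -- coefficient.
  have hch : (l + (j + 1)).choose (j + 1) = (m + 1) * (l + j).choose j := by
    apply Nat.eq_of_mul_eq_mul_right (Nat.succ_pos j)
    have := Nat.add_one_mul_choose_eq (l + j) j
    rw [Nat.succ_eq_add_one, ← add_assoc, ← this, hl]
    ring
  have hpw : E.dpow y (j + 1) ^ (m + 1) =
      ((m + 1 : ℕ) : E.U) * ((M * (l + j).choose j) • E.dpow y (l + (j + 1))) := by
    rw [pow_succ, hM, smul_mul_assoc, E.dpow_mul y hy, ← Nat.choose_symm_add.symm, hch,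
      ← nsmul_eq_mul, ← nsmul_eq_mul, ← mul_smul, ← mul_smul]
    congr 1
    ring
  have hpd : E.dpow y (j + 1) ^ m * E.U.d (E.dpow y (j + 1)) =
      (M * (l + j).choose j) • E.U.d (E.dpow y (l + (j + 1))) := by
    have hc := (E.U.comm_even (E.dpow_mem y l) (hy.mul_left l) (E.U.d (E.dpow y 1))).eq
    rw [hM, ← add_assoc, E.d_dpow y hy j, E.d_dpow y hy (l + j), smul_mul_assoc, ← mul_assoc, hc, mul_assoc,
      E.dpow_mul y hy, Nat.choose_symm_add, mul_smul, ← nsmul_eq_mul, mul_smul_comm]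
  refine ⟨π * ((M * (l + j).choose j) • E.dpow y (l + (j + 1))),
    MulMemClass.mul_mem hπS (nsmul_mem (dpow_mem_adjoin hyS _) _), ?_⟩
  rw [E.U.d_mul_of_odd hπ odd_one, hdπ, map_nsmul, frob, Nat.succ_eq_add_one, Nat.succ_eq_add_one,
    Nat.add_sub_cancel, hpw, hpd]

/-- `P` is additive up to boundaries, and a term that involves a variable contributes only a
boundary: split off one divided power and use multiplicativity. What is left is the contribution of
`A`. -/
theorem frob_homologous {S : Set E.Y} {p : ℕ} (hp : p.Prime) {π : E.U} (hπ : π ∈ E.U.grading 1)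
    (hπS : π ∈ E.adjoin S) (hdπ : E.U.d π = p) {e : ℕ} (he : Even e) {u : E.U}
    (hS : Good S) (hu : u ∈ E.adjoin S) : ∃ a ∈ A.grading (e + 2), ∃ b ∈ E.adjoin S,
      E.U.frob p π (E.U.pr (e + 2) u) = E.U.frob p π (E.incl a) + E.U.d b := by
  have he2 : Even (e + 2) := he.add (by decide)
  have hnull : ∀ x, (∃ b ∈ E.adjoin S, E.U.frob p π x = E.U.d b) →
      ∃ a ∈ A.grading (e + 2), ∃ b ∈ E.adjoin S,
        E.U.frob p π x = E.U.frob p π (E.incl a) + E.U.d b := by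
    rintro x ⟨b, hb, h⟩
    exact ⟨0, zero_mem _, b, hb, by rw [E.incl.map_zero, frob_zero hp.ne_zero, zero_add, h]⟩
  have hadd : ∀ u v, u ∈ E.adjoin S ∧ (∃ a ∈ A.grading (e + 2), ∃ b ∈ E.adjoin S,
      E.U.frob p π (E.U.pr (e + 2) u) = E.U.frob p π (E.incl a) + E.U.d b) →
      v ∈ E.adjoin S ∧ (∃ a ∈ A.grading (e + 2), ∃ b ∈ E.adjoin S,
      E.U.frob p π (E.U.pr (e + 2) v) = E.U.frob p π (E.incl a) + E.U.d b) →
      ∃ a ∈ A.grading (e + 2), ∃ b ∈ E.adjoin S,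
      E.U.frob p π (E.U.pr (e + 2) (u + v)) = E.U.frob p π (E.incl a) + E.U.d b := by
    rintro u v ⟨huS, a, ha, b, hb, h⟩ ⟨hvS, a', ha', b', hb', h'⟩
    obtain ⟨c, hc, hcd⟩ := frob_add hp hπ hπS hdπ he2 (E.U.pr_mem (e + 2) u)
      (E.U.pr_mem (e + 2) v) (pr_mem_adjoin _ huS) (pr_mem_adjoin _ hvS)
    obtain ⟨c', hc', hcd'⟩ := frob_add hp hπ hπS hdπ he2 (E.incl.map_mem _ _ ha)
      (E.incl.map_mem _ _ ha') (incl_mem_adjoin S a) (incl_mem_adjoin S a')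
    refine ⟨a + a', add_mem ha ha', b + b' + c - c', sub_mem (add_mem (add_mem hb hb') hc) hc', ?_⟩
    rw [map_add, hcd, h, h', E.incl.map_add, hcd', map_sub, map_add, map_add]
    abel
  suffices h : u ∈ E.adjoin S ∧ _ from h.2
  refine adjoin_induction_terms (P := fun u => u ∈ E.adjoin S ∧ ∃ a ∈ A.grading (e + 2), ∃ b ∈ E.adjoin S,
      E.U.frob p π (E.U.pr (e + 2) u) = E.U.frob p π (E.incl a) + E.U.d b) ?_ ?_ hu
  · intro a μ hμ
    refine ⟨AddSubgroup.subset_closure ⟨a, μ, hμ, rfl⟩, ?_⟩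
    rcases Nat.lt_or_ge (e + 2) (E.weight μ) with h | h
    · apply hnull
      rw [E.U.pr_mul_of_mem_right_lt (E.monomial_mem μ) _ h, frob_zero hp.ne_zero]
      exact ⟨0, zero_mem _, by simp⟩
    obtain ⟨k, hk⟩ := Nat.exists_eq_add_of_le' h
    rw [hk, E.U.pr_mul_of_mem_right (E.monomial_mem μ), ← E.incl.map_pr, ← hk]
    have ha := A.pr_mem k a
    set a' := A.pr k a
    by_cases hμ0 : μ = 0
    · subst hμ0
      have hw : E.weight 0 = 0 := by simp [weight]
      rw [hw, add_zero] at hk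
      refine ⟨a', hk ▸ ha, 0, zero_mem _, ?_⟩
      rw [E.monomial_zero, mul_one, map_zero, add_zero]
    apply hnull
    obtain ⟨y, hy⟩ := Finsupp.ne_iff.1 hμ0
    rw [Finsupp.zero_apply] at hy
    have hyS := hμ y hy
    have hwt : E.weight μ = E.weight (μ.erase y) + μ y * E.deg y := by
      rw [← E.weight_add_single, Finsupp.erase_add_single]
    have hx : ∃ x ∈ E.U.grading (k + E.weight (μ.erase y)), x ∈ E.adjoin S ∧
        E.incl a' * E.monomial μ = x * E.dpow y (μ y) := by
      have hm := E.U.mul_mem (E.incl.map_mem _ _ ha) (E.monomial_mem (μ.erase y))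
      have hmS : E.incl a' * E.monomial (μ.erase y) ∈ E.adjoin S := by
        refine AddSubgroup.subset_closure ⟨_, _, fun z hz => ?_, rfl⟩
        have hzy : z ≠ y := by rintro rfl; simp at hz
        rw [Finsupp.erase_ne hzy] at hz
        exact hμ z hz
      rcases E.monomial_erase μ y with h | h
      · exact ⟨_, hm, hmS, by rw [h, mul_assoc]⟩
      · exact ⟨_, neg_mem hm, neg_mem hmS, by rw [h, mul_neg, neg_mul, mul_assoc]⟩
    obtain ⟨x, hx, hxS, hxe⟩ := hx
    rw [hxe]
    set l := k + E.weight (μ.erase y) with hl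
    have htot : l + μ y * E.deg y = e + 2 := by omega
    -- The term is a product of two factors of equal parity. If both are odd, `P` kills it. If both
    -- are even, either `y` is even and `P` of its divided power bounds, or `y` is odd with exponent
    -- at least two and the term is zero.
    rcases Nat.even_or_odd (μ y * E.deg y) with hpar | hpar
    · have hle : Even l := by
        rcases Nat.even_or_odd l with h' | h'
        · exact h'
        · exact absurd he2 (Nat.not_even_iff_odd.2 (htot ▸ h'.add_even hpar))
      rcases Nat.even_or_odd (E.deg y) with hd | hd
      · obtain ⟨b, hb, hfb⟩ := frob_dpow hyS hd hp.ne_zero hπ hπS hdπ hy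
        obtain ⟨r, hr⟩ : ∃ r, μ y * E.deg y = r + 2 := by
          have : 0 < μ y * E.deg y := Nat.mul_pos (Nat.pos_of_ne_zero hy) (E.deg_pos y)
          exact ⟨μ y * E.deg y - 2, by obtain ⟨s, hs⟩ := hpar; omega⟩
        have hre : Even r := by
          rw [hr] at hpar
          exact (Nat.even_add.1 hpar).2 (by decide)
        have hdy := E.dpow_mem y (μ y)
        rw [hr] at hdy
        have hcomm := E.U.comm_even hx hle (E.dpow y (μ y))
        -- `P(x)` is a cycle. When `x` has degree zero the general lemma does not apply, but then
        -- `∂x = 0` and `P(x) = x^p`.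
        have hfx : E.U.d b * E.U.frob p π x = E.U.d (b * E.U.frob p π x) := by
          obtain _ | _ | l := l
          · have hdx : E.U.d x = 0 := E.U.d_eq_zero _ hx
            have : E.U.d (E.U.frob p π x) = 0 := by
              rw [frob, hdx, mul_zero, mul_zero, sub_zero, E.U.d_pow_cycle hdx]
            rw [E.U.d_mul_cycle _ this]
          · exact absurd hle (by decide)
          · have : Even l := by
              obtain ⟨s, hs⟩ := hle
              exact ⟨s - 1, by omega⟩
            rw [E.U.d_mul_cycle _ (d_frob hp.ne_zero hπ hdπ this hx)]
        have hdxS : x ^ (p - 1) * E.U.d x ∈ E.adjoin S := by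
          exact MulMemClass.mul_mem (_root_.pow_mem hxS _) (d_mem_adjoin hS hxS)
        refine ⟨b * E.U.frob p π x, MulMemClass.mul_mem hb (sub_mem (_root_.pow_mem hxS _)
          (MulMemClass.mul_mem hπS hdxS)), ?_⟩
        -- Multiplicativity asks for positive degree of its first factor, so the divided power is
        -- moved in front.
        rw [hcomm.eq, frob_mul hp.ne_zero hπ hre hle hdy hx, hfb, hfx]
      · have h2 : 2 ≤ μ y := by
          rcases Nat.even_or_odd (μ y) with h' | h'
          · obtain ⟨s, hs⟩ := h'; omega
          · exact absurd hpar (Nat.not_even_iff_odd.2 (h'.mul hd))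
        rw [E.dpow_odd y hd _ h2, mul_zero, frob_zero hp.ne_zero]
        exact ⟨0, zero_mem _, by simp⟩
    · have hlo : Odd l := by
        rcases Nat.even_or_odd l with h' | h'
        · exact absurd he2 (Nat.not_even_iff_odd.2 (htot ▸ h'.add_odd hpar))
        · exact h'
      rw [frob_mul_of_odd hp.two_le hlo hpar hx (E.dpow_mem y (μ y))]
      exact ⟨0, zero_mem _, by simp⟩
  · exact fun u v h h' => ⟨add_mem h.1 h'.1, hadd u v h h'⟩

/-- If `p` is a boundary, powers of cycles of even positive degree become boundaries. -/
theorem exists_pow_boundary_of_prime [A.IsLocal] (hA : IsDerivedNilpotent.{u, w} A) {S : Set E.Y}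
    (hS : Good S) {p : ℕ} (hp : p.Prime) {π : E.U} (hπ : π ∈ E.U.grading 1)
    (hπS : π ∈ E.adjoin S) (hdπ : E.U.d π = p) {e : ℕ} (he : Even e) {z : E.U}
    (hz : z ∈ E.U.grading (e + 2)) (hzS : z ∈ E.adjoin S) (hdz : E.U.d z = 0) :
    ∃ N, ∃ b ∈ E.adjoin S, E.U.d b = z ^ N := by
  obtain ⟨a, ha, b, hb, h⟩ := frob_homologous hp hπ hπS hdπ he hS hzS
  rw [E.U.pr_of_mem hz] at h
  -- On a cycle `P` is the `p`-th power, so `z ^ p` is homologous to `P(a)`.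
  have hzp : E.U.frob p π z = z ^ p := by rw [frob, hdz]; simp
  rw [hzp] at h
  obtain ⟨N, c, hc, hdc⟩ := exists_frob_pow_boundary hA E.incl (E.adjoin S)
    (incl_mem_adjoin S) hp.ne_zero hπ hπS hdπ he ha
  have hae := E.incl.map_mem _ _ ha
  have hfS : E.U.frob p π (E.incl a) ∈ E.adjoin S :=
    sub_mem (_root_.pow_mem (incl_mem_adjoin S a) _) (MulMemClass.mul_mem hπS
      (MulMemClass.mul_mem (_root_.pow_mem (incl_mem_adjoin S a) _)
        (d_mem_adjoin hS (incl_mem_adjoin S a))))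
  obtain ⟨b', hb', hdb'⟩ := E.U.exists_d_eq_pow_sub_pow (E.adjoin S) (e := p * (e + 2))
    ((he.add (by decide)).mul_left p) (_root_.pow_mem hzS p) hfS hb (E.U.pow_mem hz p)
    (E.U.d_pow_cycle hdz p) (d_frob hp.ne_zero hπ hdπ he hae) (by rw [h]; abel) N
  refine ⟨p * N, b' + c, add_mem hb' hc, ?_⟩
  rw [map_add, hdb', hdc, pow_mul]
  abel

end GammaExtension

/-! ### Free extensions by one variable and their effect on quasi-isomorphisms. -/

namespace Hom

variable {B : CDGA.{u}} {C : CDGA.{v}}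

/-- The inverse of a bijective morphism. -/
noncomputable def inv (f : Hom B C) (hf : Function.Bijective f) : Hom C B where
  toRingHom := (RingEquiv.ofBijective f.toRingHom hf).symm
  map_mem i c hc := by
    set b : B := (RingEquiv.ofBijective f.toRingHom hf).symm c with hb
    have hfb : f b = c := (RingEquiv.ofBijective f.toRingHom hf).apply_symm_apply c
    change b ∈ B.grading i
    have : B.pr i b = b := hf.1 (by rw [f.map_pr, hfb, C.pr_of_mem hc])
    exact this ▸ B.pr_mem i b
  map_d c := by
    apply hf.1
    have hfb : ∀ c, f ((RingEquiv.ofBijective f.toRingHom hf).symm c) = c :=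
      (RingEquiv.ofBijective f.toRingHom hf).apply_symm_apply
    change f ((RingEquiv.ofBijective f.toRingHom hf).symm (C.d c)) =
      f (B.d ((RingEquiv.ofBijective f.toRingHom hf).symm c))
    rw [hfb, f.map_d, hfb]

theorem inv_apply (f : Hom B C) (hf : Function.Bijective f) (b : B) : f.inv hf (f b) = b :=
  (RingEquiv.ofBijective f.toRingHom hf).symm_apply_apply b

end Hom

section PowSpan

variable {C : CDGA.{u}} {E : CDGA.{v}} {i : Hom C E} {y : E} {k : ℕ}

/-- The elements `∑ i(c_j) y ^ j` with `j < n`. -/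
def powSpan (i : Hom C E) (y : E) (n : ℕ) : AddSubgroup E :=
  AddSubgroup.closure {u | ∃ c, ∃ j < n, u = i c * y ^ j}

theorem mul_pow_mem_powSpan (i : Hom C E) (y : E) (c : C) {j n : ℕ} (h : j < n) :
    i c * y ^ j ∈ powSpan i y n := AddSubgroup.subset_closure ⟨c, j, h, rfl⟩

theorem powSpan_mono {m n : ℕ} (h : m ≤ n) : powSpan i y m ≤ powSpan i y n :=
  AddSubgroup.closure_mono fun _ ⟨c, j, hj, hu⟩ => ⟨c, j, hj.trans_le h, hu⟩

theorem powSpan_zero : powSpan i y 0 = ⊥ := by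
  refine le_bot_iff.1 ((AddSubgroup.closure_le _).2 ?_)
  rintro u ⟨c, j, hj, -⟩
  exact absurd hj (Nat.not_lt_zero j)

theorem exists_sub_mem_powSpan {n : ℕ} {u : E} (hu : u ∈ powSpan i y (n + 1)) :
    ∃ c, u - i c * y ^ n ∈ powSpan i y n := by
  induction hu using AddSubgroup.closure_induction with
  | zero => exact ⟨0, by simp⟩
  | add u v _ _ hu hv =>
    obtain ⟨c, hc⟩ := hu
    obtain ⟨c', hc'⟩ := hv
    refine ⟨c + c', ?_⟩
    rw [i.map_add, add_mul, add_sub_add_comm]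
    exact add_mem hc hc'
  | neg u _ hu =>
    obtain ⟨c, hc⟩ := hu
    refine ⟨-c, ?_⟩
    rw [i.map_neg, neg_mul, ← neg_sub']
    exact neg_mem hc
  | mem u hu =>
    obtain ⟨c, j, hj, rfl⟩ := hu
    rcases Nat.lt_succ_iff_lt_or_eq.1 hj with hj | rfl
    · exact ⟨0, by simpa using mul_pow_mem_powSpan i y c hj⟩
    · exact ⟨c, by simp⟩

theorem powSpan_map_le {n : ℕ} {M : AddSubgroup E} (f : E →+ E)
    (h : ∀ c, ∀ j < n, f (i c * y ^ j) ∈ M) {u : E} (hu : u ∈ powSpan i y n) : f u ∈ M := by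
  have : powSpan i y n ≤ M.comap f := (AddSubgroup.closure_le _).2 <| by
    rintro _ ⟨c, j, hj, rfl⟩
    exact h c j hj
  exact this hu

theorem incl_mul_mem_powSpan (a : C) {n : ℕ} {u : E} (hu : u ∈ powSpan i y n) :
    i a * u ∈ powSpan i y n :=
  powSpan_map_le (AddMonoidHom.mulLeft (i a)) (fun c j hj => by
    change i a * (i c * y ^ j) ∈ _
    rw [← mul_assoc, ← i.map_mul]
    exact mul_pow_mem_powSpan i y _ hj) hu

theorem mul_var_mem_powSpan {n : ℕ} {u : E} (hu : u ∈ powSpan i y n) :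
    u * y ∈ powSpan i y (n + 1) :=
  powSpan_map_le (AddMonoidHom.mulRight y) (fun c j hj => by
    change i c * y ^ j * y ∈ _
    rw [mul_assoc, ← pow_succ]
    exact mul_pow_mem_powSpan i y _ (by omega)) hu

theorem mul_incl_mem_powSpan (hy : y ∈ E.grading k) {e : C} {l : ℕ} (he : e ∈ C.grading l) {n : ℕ}
    {u : E} (hu : u ∈ powSpan i y n) : u * i e ∈ powSpan i y n :=
  powSpan_map_le (AddMonoidHom.mulRight (i e)) (fun c j hj => by
    change i c * y ^ j * i e ∈ _
    rw [mul_assoc]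
    refine ((signEq_comm E (E.pow_mem hy j) (i.map_mem _ _ he)).mul_left (i c)).mem ?_
    rw [← mul_assoc, ← i.map_mul]
    exact mul_pow_mem_powSpan i y _ hj) hu

theorem mul_sub_pow_sub_mem (hy : y ∈ E.grading k) {e : C} {l : ℕ} (he : e ∈ C.grading l) (c : C)
    (n : ℕ) : i c * (y - i e) ^ n - i c * y ^ n ∈ powSpan i y n := by
  induction n with
  | zero => simp
  | succ n ih =>
    have h1 := powSpan_mono (Nat.le_succ n) (mul_incl_mem_powSpan hy he ih)
    have h2 := mul_incl_mem_powSpan hy he (mul_pow_mem_powSpan i y c (Nat.lt_succ_self n))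
    have h3 := mul_var_mem_powSpan ih
    have : i c * (y - i e) ^ (n + 1) - i c * y ^ (n + 1) =
        (i c * (y - i e) ^ n - i c * y ^ n) * y - ((i c * (y - i e) ^ n - i c * y ^ n) * i e +
          i c * y ^ n * i e) := by
      rw [pow_succ, pow_succ]
      noncomm_ring
    rw [this]
    exact sub_mem h3 (add_mem h1 h2)

theorem powSpan_sub_le (hy : y ∈ E.grading k) {e : C} {l : ℕ} (he : e ∈ C.grading l) (n : ℕ) :
    powSpan i (y - i e) n ≤ powSpan i y n := by
  refine (AddSubgroup.closure_le _).2 ?_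
  rintro _ ⟨c, j, hj, rfl⟩
  have := add_mem (powSpan_mono hj.le (mul_sub_pow_sub_mem hy he c j))
    (mul_pow_mem_powSpan i y c hj)
  rwa [sub_add_cancel] at this

/-- The substitution `y ↦ y - e` does not change leading terms, so it preserves the filtration by
degree in `y`. -/
theorem powSpan_sub (hy : y ∈ E.grading k) {e : C} (he : e ∈ C.grading k) (n : ℕ) :
    powSpan i (y - i e) n = powSpan i y n := by
  refine le_antisymm (powSpan_sub_le hy he n) ?_
  have := powSpan_sub_le (i := i) (sub_mem hy (i.map_mem _ _ he)) (neg_mem he) n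
  rwa [i.map_neg, sub_neg_eq_add, sub_add_cancel] at this

theorem map_powSpan {C' : CDGA.{w}} {E' : CDGA.{w}} {i' : Hom C' E'} {y' : E'} {φ : Hom C C'}
    {Φ : Hom E E'} (hi : ∀ c, Φ (i c) = i' (φ c)) (hy : Φ y = y') {n : ℕ} {u : E}
    (hu : u ∈ powSpan i y n) : Φ u ∈ powSpan i' y' n := by
  have : powSpan i y n ≤ (powSpan i' y' n).comap Φ.toRingHom.toAddMonoidHom :=
    (AddSubgroup.closure_le _).2 <| by
      rintro _ ⟨c, j, hj, rfl⟩
      change Φ (i c * y ^ j) ∈ powSpan i' y' n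
      rw [Φ.map_mul, Φ.map_pow, hi, hy]
      exact mul_pow_mem_powSpan i' y' _ hj
  exact this hu

end PowSpan

section FreeExt

/-- `E` is the free extension of `C` (along `i`) by the variable `y` of degree `k` with
`∂ y = z`: exterior if `k` is odd, polynomial if `k` is even. -/
structure IsFreeExt {C : CDGA.{u}} {E : CDGA.{v}} (i : Hom C E) (k : ℕ) (z : C) (y : E) : Prop where
  mem : y ∈ E.grading k
  d_var : E.d y = i z
  top : ∀ n, (Odd k → n ≤ 1) → ∀ c, i c * y ^ n ∈ powSpan i y n → c = 0
  span : ∀ u, ∃ n, u ∈ powSpan i y n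

variable {C : CDGA.{u}} {E : CDGA.{v}} {i : Hom C E} {f : ℕ} {z : C} {y : E}

namespace IsFreeExt

/-- Freeness is expressed by leading coefficients with respect to the filtration by powers of `y`,
and this survives the substitution `y ↦ y - e`. It allows `z` to be replaced by any homologous
cycle. -/
theorem sub (h : IsFreeExt i (f + 1) z y) {e : C} (he : e ∈ C.grading (f + 1)) :
    IsFreeExt i (f + 1) (z - C.d e) (y - i e) where
  mem := sub_mem h.mem (i.map_mem _ _ he)
  d_var := by rw [map_sub, h.d_var, i.map_sub, i.map_d]
  top n hn c hc := by
    rw [powSpan_sub h.mem he] at hc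
    refine h.top n hn c ?_
    have := sub_mem hc (mul_sub_pow_sub_mem h.mem he c n)
    rwa [sub_sub_cancel] at this
  span u := by
    obtain ⟨n, hn⟩ := h.span u
    exact ⟨n, by rwa [powSpan_sub h.mem he]⟩

theorem injective (h : IsFreeExt i (f + 1) z y) {c : C} (hc : i c = 0) : c = 0 :=
  h.top 0 (fun _ => Nat.zero_le _) c (by rw [hc]; simp)

theorem mem_base (h : IsFreeExt i (f + 1) z y) : z ∈ C.grading f := by
  have h1 : E.pr f (i z) = i z := E.pr_of_mem (h.d_var ▸ E.d_mem _ _ h.mem)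
  have h2 : C.pr f z - z = 0 := h.injective (by rw [i.map_sub, i.map_pr, h1, sub_self])
  exact sub_eq_zero.1 h2 ▸ C.pr_mem f z

theorem d_base (h : IsFreeExt i (f + 1) z y) : C.d z = 0 :=
  h.injective (by rw [i.map_d, ← h.d_var, E.d_d])

theorem pow_eq_zero (h : IsFreeExt i (f + 1) z y) (hf : Odd (f + 1)) {n : ℕ} (hn : 2 ≤ n) :
    y ^ n = 0 := by
  obtain ⟨m, rfl⟩ := Nat.exists_eq_add_of_le hn
  rw [pow_add, E.sq_eq_zero _ _ hf h.mem, zero_mul]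

theorem exists_mem (h : IsFreeExt i (f + 1) z y) (u : E) :
    ∃ n, (Odd (f + 1) → n ≤ 2) ∧ u ∈ powSpan i y n := by
  obtain ⟨n, hn⟩ := h.span u
  rcases Nat.even_or_odd (f + 1) with hf | hf
  · exact ⟨n, fun h' => absurd hf (Nat.not_even_iff_odd.2 h'), hn⟩
  · refine ⟨2, fun _ => le_rfl, ?_⟩
    refine powSpan_map_le (AddMonoidHom.id E) (fun c j _ => ?_) hn
    rcases Nat.lt_or_ge j 2 with hj | hj
    · exact mul_pow_mem_powSpan i y c hj
    · rw [h.pow_eq_zero hf hj, mul_zero]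
      exact zero_mem _

theorem indep (h : IsFreeExt i (f + 1) z y) {n : ℕ} (hn : Odd (f + 1) → n ≤ 2) (c : ℕ → C)
    (hc : ∑ j ∈ Finset.range n, i (c j) * y ^ j = 0) : ∀ j < n, c j = 0 := by
  induction n with
  | zero => exact fun j hj => absurd hj (Nat.not_lt_zero j)
  | succ n ih =>
    rw [Finset.sum_range_succ] at hc
    have h0 : c n = 0 := h.top n (fun h' => by have := hn h'; omega) _ (by
      rw [eq_neg_of_add_eq_zero_right hc]
      exact neg_mem (sum_mem fun j hj => mul_pow_mem_powSpan i y _ (Finset.mem_range.1 hj)))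
    rw [h0, i.map_zero, zero_mul, add_zero] at hc
    intro j hj
    rcases Nat.lt_succ_iff_lt_or_eq.1 hj with hj | rfl
    · exact ih (fun h' => by have := hn h'; omega) hc j hj
    · exact h0

theorem surjective_of_mem_range {D : CDGA.{w}} {F : Hom D E} (h : IsFreeExt i (f + 1) z y)
    (hF : ∀ c n, ∃ x, F x = i c * y ^ n) : Function.Surjective F := by
  intro u
  obtain ⟨n, hn⟩ := h.span u
  have : powSpan i y n ≤ F.toRingHom.toAddMonoidHom.range := (AddSubgroup.closure_le _).2 <| by
    rintro _ ⟨c, j, -, rfl⟩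
    exact hF c j
  exact this hn

/-- The universal property of a free extension. -/
theorem exists_lift (h : IsFreeExt i (f + 1) z y) {D : CDGA.{w}} (g : Hom C D) {η : D}
    (hη : η ∈ D.grading (f + 1)) (hdη : D.d η = g z) :
    ∃ g' : Hom E D, (∀ c, g' (i c) = g c) ∧ g' y = η := by
  have hz := h.mem_base
  have hdz := h.d_base
  rcases Nat.even_or_odd f with hf | hf
  -- The concrete extension is compared with `E` by a morphism `F`, which freeness shows to be
  -- bijective; its universal property is carried over by the inverse of `F`. The even case below
  -- goes in the same way.
  · let F := C.ext1Lift f z hz hdz (Or.inl hf) i y h.mem h.d_var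
      (by rw [← sq]; exact E.sq_eq_zero _ _ hf.add_one h.mem)
    let G := C.ext1Lift f z hz hdz (Or.inl hf) g η hη hdη
      (by rw [← sq]; exact D.sq_eq_zero _ _ hf.add_one hη)
    have hFa := C.ext1Lift_apply f z hz hdz (Or.inl hf) i y h.mem h.d_var
      (by rw [← sq]; exact E.sq_eq_zero _ _ hf.add_one h.mem)
    have hGa := C.ext1Lift_apply f z hz hdz (Or.inl hf) g η hη hdη
      (by rw [← sq]; exact D.sq_eq_zero _ _ hf.add_one hη)
    have hval : ∀ a b, F (C.ext1Incl f z hz hdz (Or.inl hf) a + C.ext1Incl f z hz hdz (Or.inl hf) b *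
        C.ext1Var f z hz hdz (Or.inl hf)) = i a + i b * y := fun a b => by
      rw [hFa, ext1Fst_add_mul, ext1Snd_add_mul]
    have hval' : ∀ a b, G (C.ext1Incl f z hz hdz (Or.inl hf) a + C.ext1Incl f z hz hdz (Or.inl hf) b *
        C.ext1Var f z hz hdz (Or.inl hf)) = g a + g b * η := fun a b => by
      rw [hGa, ext1Fst_add_mul, ext1Snd_add_mul]
    have hinj : Function.Injective F := by
      refine (injective_iff_map_eq_zero F.toRingHom).2 fun x hx => ?_
      rw [C.ext1_eq f z hz hdz (Or.inl hf) x] at hx ⊢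
      rw [hval] at hx
      set a := C.ext1Fst f z hz hdz (Or.inl hf) x
      set b := C.ext1Snd f z hz hdz (Or.inl hf) x
      have := h.indep (n := 2) (fun _ => le_rfl) (fun j => if j = 0 then a else b)
        (by simpa [Finset.sum_range_succ] using hx)
      have ha : a = 0 := by simpa using this 0 (by omega)
      have hb : b = 0 := by simpa using this 1 (by omega)
      rw [ha, hb, Hom.map_zero, zero_mul, add_zero]
    have hsurj : Function.Surjective F := h.surjective_of_mem_range fun c n => by
      obtain _ | _ | n := n
      · exact ⟨_, (hval c 0).trans (by simp)⟩
      · exact ⟨_, (hval 0 c).trans (by simp)⟩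
      · exact ⟨0, by rw [h.pow_eq_zero hf.add_one (by omega), mul_zero, F.map_zero]⟩
    have hbij : Function.Bijective F := ⟨hinj, hsurj⟩
    refine ⟨G.comp (F.inv hbij), fun c => ?_, ?_⟩
    · have h1 := hval c 0
      rw [i.map_zero, zero_mul, add_zero] at h1
      change G (F.inv hbij (i c)) = g c
      rw [← h1, F.inv_apply, hval', g.map_zero, zero_mul, add_zero]
    · have h1 := hval 0 1
      rw [i.map_zero, zero_add, i.map_one, one_mul] at h1
      change G (F.inv hbij y) = η
      rw [← h1, F.inv_apply, hval', g.map_zero, zero_add, g.map_one, one_mul]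
  · let F := C.polyExtLift f z hz hdz hf i y h.mem h.d_var
    let G := C.polyExtLift f z hz hdz hf g η hη hdη
    have hFi : ∀ c, F (C.polyExtIncl f z hz hdz hf c) = i c :=
      C.polyExtLift_incl f z hz hdz hf i y h.mem h.d_var
    have hFv : F (C.polyExtVar f z hz hdz hf) = y :=
      C.polyExtLift_var f z hz hdz hf i y h.mem h.d_var
    have hGi : ∀ c, G (C.polyExtIncl f z hz hdz hf c) = g c :=
      C.polyExtLift_incl f z hz hdz hf g η hη hdη
    have hGv : G (C.polyExtVar f z hz hdz hf) = η :=
      C.polyExtLift_var f z hz hdz hf g η hη hdη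
    have hinj : Function.Injective F := by
      refine (injective_iff_map_eq_zero F.toRingHom).2 fun x hx => ?_
      obtain ⟨n, hn⟩ := C.polyExt_eq f z hz hdz hf x
      have := h.indep (n := n) (fun h' => absurd hf.add_one (Nat.not_even_iff_odd.2 h'))
        (fun j => C.polyExtCoeff f z hz hdz hf j x) (by
          rw [← hx]
          conv_rhs => rw [hn]
          rw [map_sum]
          refine Finset.sum_congr rfl fun j _ => ?_
          rw [F.map_mul, F.map_pow, hFi, hFv])
      rw [hn]
      refine Finset.sum_eq_zero fun j hj => ?_
      rw [this j (Finset.mem_range.1 hj), Hom.map_zero, zero_mul]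
    have hsurj : Function.Surjective F := h.surjective_of_mem_range fun c n =>
      ⟨C.polyExtIncl f z hz hdz hf c * C.polyExtVar f z hz hdz hf ^ n, by
        rw [F.map_mul, F.map_pow, hFi, hFv]⟩
    have hbij : Function.Bijective F := ⟨hinj, hsurj⟩
    refine ⟨G.comp (F.inv hbij), fun c => ?_, ?_⟩
    · change G (F.inv hbij (i c)) = g c
      rw [← hFi, F.inv_apply, hGi]
    · change G (F.inv hbij y) = η
      rw [← hFv, F.inv_apply, hGv]

/-- Since `∂(y ^ n)` has lower degree in `y`, the differential acts on leading coefficients as that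
of `C`. -/
theorem d_mul_pow (h : IsFreeExt i (f + 1) z y) {n : ℕ} (hn : Odd (f + 1) → n ≤ 1) (c : C) :
    E.d (i c * y ^ n) - i (C.d c) * y ^ n ∈ powSpan i y n := by
  rw [E.d_mul, i.map_d, add_sub_cancel_left, ← i.map_sgn]
  apply incl_mul_mem_powSpan
  obtain _ | n := n
  · simp [E.d_one]
  have hbase : y ^ n * i z ∈ powSpan i y (n + 1) := by
    refine mul_incl_mem_powSpan h.mem h.mem_base ?_
    have := mul_pow_mem_powSpan i y 1 (Nat.lt_succ_self n)
    rwa [i.map_one, one_mul] at this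
  rcases Nat.even_or_odd (f + 1) with hf | hf
  · rw [E.d_pow_of_even h.mem hf, h.d_var, ← nsmul_eq_mul]
    exact nsmul_mem hbase _
  · have : n = 0 := by have := hn hf; omega
    subst this
    rwa [zero_add, pow_one, h.d_var, ← one_mul (i z), ← pow_zero y]

theorem d_mem_powSpan (h : IsFreeExt i (f + 1) z y) {n : ℕ} (hn : Odd (f + 1) → n ≤ 2) {u : E}
    (hu : u ∈ powSpan i y n) : E.d u ∈ powSpan i y n :=
  powSpan_map_le E.d (fun c j hj => by
    have := add_mem (powSpan_mono hj.le (h.d_mul_pow (fun h' => by have := hn h'; omega) c))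
      (mul_pow_mem_powSpan i y (C.d c) hj)
    rwa [sub_add_cancel] at this) hu

/-- An adjunction of corresponding variables preserves quasi-isomorphisms. -/
theorem coneExact {C' : CDGA.{w}} {E' : CDGA.{w}} {i' : Hom C' E'} {y' : E'} {φ : Hom C C'}
    {Φ : Hom E E'} (h : IsFreeExt i (f + 1) z y) (h' : IsFreeExt i' (f + 1) (φ z) y')
    (hi : ∀ c, Φ (i c) = i' (φ c)) (hy : Φ y = y') (hφ : φ.ConeExact ⊤) : Φ.ConeExact ⊤ := by
  -- Induction along the filtration by degree in `y`, whose graded pieces are copies of the cone of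
  -- `φ`. The leading coefficients of `x` and `v` satisfy the cone equations over `φ`; solving there
  -- and subtracting lowers the degree. For an odd variable the filtration stops at `2`.
  suffices key : ∀ n, (Odd (f + 1) → n ≤ 2) → ∀ v ∈ powSpan i' y' n, ∀ x ∈ powSpan i y n,
      E'.d v = Φ x → E.d x = 0 → ∃ u e, E.d u = x ∧ v = Φ u + E'.d e by
    intro v _ x hv hx
    obtain ⟨n, hn, hvn⟩ := h'.exists_mem v
    obtain ⟨m, hm, hxm⟩ := h.exists_mem x
    obtain ⟨u, e, hu, he⟩ := key (max n m) (fun h' => max_le (hn h') (hm h')) v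
      (powSpan_mono (le_max_left _ _) hvn) x (powSpan_mono (le_max_right _ _) hxm) hv hx
    exact ⟨u, e, trivial, hu, he⟩
  intro n
  induction n with
  | zero =>
    intro _ v hv x hx _ _
    rw [powSpan_zero, AddSubgroup.mem_bot] at hv hx
    subst hv hx
    exact ⟨0, 0, map_zero _, by rw [Φ.map_zero, map_zero, add_zero]⟩
  | succ n ih =>
    intro hn v hv x hx hvx hdx
    have hn1 : Odd (f + 1) → n ≤ 1 := fun h' => by have := hn h'; omega
    have hn2 : Odd (f + 1) → n ≤ 2 := fun h' => by have := hn h'; omega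
    obtain ⟨c', hc'⟩ := exists_sub_mem_powSpan hv
    obtain ⟨c, hc⟩ := exists_sub_mem_powSpan hx
    have hdc : C.d c = 0 := by
      refine h.top n hn1 _ ?_
      have h1 := h.d_mem_powSpan hn2 hc
      rw [map_sub, hdx, zero_sub, neg_mem_iff] at h1
      have := sub_mem h1 (h.d_mul_pow hn1 c)
      rwa [sub_sub_cancel] at this
    have hdc' : C'.d c' = φ c := by
      rw [← sub_eq_zero]
      refine h'.top n hn1 _ ?_
      have h1 := h'.d_mem_powSpan hn2 hc'
      have h2 := map_powSpan hi hy hc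
      rw [map_sub, hvx] at h1
      rw [Φ.map_sub, Φ.map_mul, Φ.map_pow, hi, hy] at h2
      have := sub_mem (sub_mem h2 h1) (h'.d_mul_pow hn1 c')
      rw [i'.map_sub, sub_mul]
      convert this using 1
      abel
    obtain ⟨a, b, -, hac, hb⟩ := hφ c' trivial c hdc' hdc
    have hx1 : x - E.d (i a * y ^ n) ∈ powSpan i y n := by
      have := sub_mem hc (h.d_mul_pow hn1 a)
      rw [hac] at this
      convert this using 1
      abel
    have hv1 : v - Φ (i a * y ^ n) - E'.d (i' b * y' ^ n) ∈ powSpan i' y' n := by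
      have := sub_mem hc' (h'.d_mul_pow hn1 b)
      rw [hb, i'.map_add, add_mul] at this
      rw [Φ.map_mul, Φ.map_pow, hi, hy]
      convert this using 1
      abel
    obtain ⟨u, e, hu, he⟩ := ih hn2 _ hv1 _ hx1
      (by rw [map_sub, map_sub, hvx, E'.d_d, sub_zero, Φ.map_sub, Φ.map_d])
      (by rw [map_sub, hdx, E.d_d, sub_zero])
    refine ⟨u + i a * y ^ n, e + i' b * y' ^ n, by rw [map_add, hu, sub_add_cancel], ?_⟩
    rw [Φ.map_add, map_add, ← add_add_add_comm, ← he]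
    abel

end IsFreeExt

theorem isFreeExt_ext1 (C : CDGA.{u}) {f : ℕ} {z : C} (hz : z ∈ C.grading f) (hdz : C.d z = 0)
    (hf : Even f) : IsFreeExt (C.ext1Incl f z hz hdz (Or.inl hf)) (f + 1) z
      (C.ext1Var f z hz hdz (Or.inl hf)) where
  mem := C.ext1Var_mem f z hz hdz (Or.inl hf)
  d_var := C.d_ext1Var f z hz hdz (Or.inl hf)
  top n hn c hc := by
    have hn := hn hf.add_one
    obtain _ | _ | n := n
    · rw [powSpan_zero, AddSubgroup.mem_bot, pow_zero, mul_one] at hc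
      have h1 := C.ext1Fst_add_mul f z hz hdz (Or.inl hf) c 0
      rwa [hc, Hom.map_zero, zero_mul, add_zero, map_zero, eq_comm] at h1
    · obtain ⟨a, ha⟩ := exists_sub_mem_powSpan hc
      rw [powSpan_zero, AddSubgroup.mem_bot, pow_zero, mul_one, zero_add, pow_one, sub_eq_zero]
        at ha
      have h1 := C.ext1Snd_add_mul f z hz hdz (Or.inl hf) 0 c
      have h2 := C.ext1Snd_add_mul f z hz hdz (Or.inl hf) a 0
      rw [Hom.map_zero, zero_add, ha] at h1
      rw [Hom.map_zero, zero_mul, add_zero] at h2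
      rw [← h1, h2]
    · omega
  span u := ⟨2, by
    rw [C.ext1_eq f z hz hdz (Or.inl hf) u]
    refine add_mem ?_ ?_
    · have := mul_pow_mem_powSpan (C.ext1Incl f z hz hdz (Or.inl hf))
        (C.ext1Var f z hz hdz (Or.inl hf)) (C.ext1Fst f z hz hdz (Or.inl hf) u)
        (show 0 < 2 by omega)
      rwa [pow_zero, mul_one] at this
    · have := mul_pow_mem_powSpan (C.ext1Incl f z hz hdz (Or.inl hf))
        (C.ext1Var f z hz hdz (Or.inl hf)) (C.ext1Snd f z hz hdz (Or.inl hf) u)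
        (show 1 < 2 by omega)
      rwa [pow_one] at this⟩

theorem isFreeExt_polyExt (C : CDGA.{u}) {f : ℕ} {z : C} (hz : z ∈ C.grading f)
    (hdz : C.d z = 0) (hf : Odd f) : IsFreeExt (C.polyExtIncl f z hz hdz hf) (f + 1) z
      (C.polyExtVar f z hz hdz hf) where
  mem := C.polyExtVar_mem f z hz hdz hf
  d_var := C.d_polyExtVar f z hz hdz hf
  top n _ c hc := by
    have key : ∀ {n u}, u ∈ powSpan (C.polyExtIncl f z hz hdz hf) (C.polyExtVar f z hz hdz hf) n →
        C.polyExtCoeff f z hz hdz hf n u = 0 := by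
      intro n u hu
      have : powSpan (C.polyExtIncl f z hz hdz hf) (C.polyExtVar f z hz hdz hf) n ≤
          (C.polyExtCoeff f z hz hdz hf n).ker := (AddSubgroup.closure_le _).2 <| by
        rintro _ ⟨c, j, hj, rfl⟩
        have := C.polyExtCoeff_sum f z hz hdz hf (n + 1) (fun m => if m = j then c else 0)
          (Nat.lt_succ_self n)
        rw [if_neg hj.ne', Finset.sum_eq_single j
          (fun m _ hm => by rw [if_neg hm, Hom.map_zero, zero_mul])
          (fun h => absurd (Finset.mem_range.2 (by omega)) h), if_pos rfl] at this
        exact this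
      exact this hu
    have h1 := C.polyExtCoeff_sum f z hz hdz hf (n + 1) (fun m => if m = n then c else 0)
      (Nat.lt_succ_self n)
    rw [if_pos rfl, Finset.sum_eq_single n
      (fun m _ hm => by rw [if_neg hm, Hom.map_zero, zero_mul])
      (fun h => absurd (Finset.mem_range.2 (by omega)) h), if_pos rfl] at h1
    rw [← h1, key hc]
  span u := by
    obtain ⟨n, hn⟩ := C.polyExt_eq f z hz hdz hf u
    refine ⟨n, ?_⟩
    rw [hn]
    exact sum_mem fun j hj => mul_pow_mem_powSpan _ _ _ (Finset.mem_range.1 hj)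

theorem exists_isFreeExt (C : CDGA.{u}) {f : ℕ} {z : C} (hz : z ∈ C.grading f) (hdz : C.d z = 0) :
    ∃ (E : CDGA.{u}) (i : Hom C E) (y : E), IsFreeExt i (f + 1) z y := by
  rcases Nat.even_or_odd f with hf | hf
  · exact ⟨_, _, _, C.isFreeExt_ext1 hz hdz hf⟩
  · exact ⟨_, _, _, C.isFreeExt_polyExt hz hdz hf⟩

end FreeExt

theorem toZeroRing_pr_zero (A : CDGA.{u}) (a : A) : A.toZeroRing (A.pr 0 a) = A.toZeroRing a := by
  apply Subtype.ext
  change A.pr 0 (A.pr 0 a) = A.pr 0 a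
  exact A.pr_of_mem (A.pr_mem 0 a)

theorem toZeroRing_sgn (A : CDGA.{u}) (a : A) : A.toZeroRing (A.sgn a) = A.toZeroRing a := by
  induction a using A.induction_homogeneous with
  | h0 => simp
  | hom i a ha =>
    rcases Nat.eq_zero_or_pos i with rfl | hi
    · rw [A.sgn_of_even ha Even.zero]
    · rw [A.toZeroRing_of_mem hi.ne' ha, A.toZeroRing_of_mem hi.ne' (A.sgn_mem ha)]
  | add a b ha hb => rw [map_add, map_add, map_add, ha, hb]

/-! ### The ideals `𝔪_A` and `𝔪_A U`, and powers instead of divided powers. -/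

section MaxIdeal

variable (A : CDGA.{u}) [A.IsLocal]

theorem mem_maxIdeal {a : A} :
    a ∈ A.maxIdeal ↔ A.toZeroRing a ∈ IsLocalRing.maximalIdeal A.zeroRing := Iff.rfl

theorem sgnPow_mem_maxIdeal {a : A} (ha : a ∈ A.maxIdeal) (e : ℕ) : A.sgnPow e a ∈ A.maxIdeal := by
  rcases Nat.even_or_odd e with h | h
  · rwa [A.sgnPow_even h]
  · rwa [A.sgnPow_odd h, mem_maxIdeal, toZeroRing_sgn]

theorem mul_mem_maxIdeal_right {a : A} (ha : a ∈ A.maxIdeal) (b : A) : a * b ∈ A.maxIdeal := by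
  rw [mem_maxIdeal, map_mul]
  exact Ideal.mul_mem_right _ _ ha

theorem d_mem_maxIdeal (a : A) : A.d a ∈ A.maxIdeal :=
  A.mem_maximalIdeal_of_mem_boundaries (A.toZeroRing_d_mem_boundaries a)

theorem mem_maxIdeal_of_nsmul_mem (hQ : ∀ n : ℕ, n ≠ 0 → IsUnit (n : A)) {n : ℕ} (hn : n ≠ 0)
    {a : A} (ha : n • a ∈ A.maxIdeal) : a ∈ A.maxIdeal := by
  rw [mem_maxIdeal, nsmul_eq_mul, map_mul, map_natCast] at ha
  have h1 := (hQ n hn).map A.toZeroRing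
  rw [map_natCast] at h1
  exact (Ideal.unit_mul_mem_iff_mem _ h1).1 ha

end MaxIdeal

theorem exists_sum_of_mem_powSpan {C : CDGA.{u}} {E : CDGA.{v}} {i : Hom C E} {y : E} {n : ℕ} {u : E}
    (hu : u ∈ powSpan i y n) : ∃ c : ℕ → C, u = ∑ j ∈ Finset.range n, i (c j) * y ^ j := by
  induction n generalizing u with
  | zero =>
    rw [powSpan_zero, AddSubgroup.mem_bot] at hu
    exact ⟨0, by simpa using hu⟩
  | succ n ih =>
    obtain ⟨a, ha⟩ := exists_sub_mem_powSpan hu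
    obtain ⟨c, hc⟩ := ih ha
    refine ⟨fun j => if j = n then a else c j, ?_⟩
    rw [Finset.sum_range_succ, ← sub_eq_iff_eq_add]
    simp only [if_true]
    rw [hc]
    refine Finset.sum_congr rfl fun j hj => ?_
    rw [if_neg (Finset.mem_range.1 hj).ne]

namespace GammaExtension

variable {A : CDGA.{u}} {E : GammaExtension A}

variable (E) in
/-- The elements whose coefficients lie in `J`. -/
def coefSub (J : AddSubgroup A) : AddSubgroup E.U where
  carrier := {u | ∀ ν, E.coef ν u ∈ J}
  add_mem' hu hv ν := by rw [map_add]; exact add_mem (hu ν) (hv ν)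
  zero_mem' ν := by rw [map_zero]; exact zero_mem _
  neg_mem' hu ν := by rw [map_neg]; exact neg_mem (hu ν)

theorem coefSub_bot : E.coefSub ⊥ = ⊥ :=
  le_bot_iff.1 fun _ hu => E.eq_zero_of_coef fun ν => hu ν

/-- The two conditions hold simultaneously for the terms of the basis expansion: its coefficients
lie in `J`, and those at monomials outside `S` vanish. -/
theorem coefSub_induction {J : AddSubgroup A} {S : Set E.Y} {P : E.U → Prop}
    (mon : ∀ a ∈ J, ∀ μ : E.Y →₀ ℕ, (∀ y, μ y ≠ 0 → y ∈ S) → P (E.incl a * E.monomial μ))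
    (zero : P 0) (add : ∀ u v, P u → P v → P (u + v)) {u : E.U} (hu : u ∈ E.adjoin S)
    (hJ : u ∈ E.coefSub J) : P u := by
  obtain ⟨c, rfl⟩ := E.expansion.surjective u
  have hcoef : ∀ μ, E.coef μ.1 (E.expansion c) = c μ := fun μ => by
    simp [coef, μ.2]
  have hsum : E.expansion c = ∑ μ ∈ c.support, E.incl (c μ) * E.monomial μ.1 := by
    conv_lhs => rw [← Finsupp.sum_single c]
    rw [Finsupp.sum, map_sum]
    exact Finset.sum_congr rfl fun μ _ => E.expansion_single μ _
  have key : ∀ μ ∈ c.support, P (E.incl (c μ) * E.monomial μ.1) := by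
    intro μ hμ
    refine mon _ (hcoef μ ▸ hJ μ.1) _ fun y hy => ?_
    by_contra hyS
    have := coef_eq_zero_of_notMem hu hyS hy
    rw [hcoef] at this
    exact Finsupp.mem_support_iff.1 hμ this
  rw [hsum]
  exact Finset.sum_induction _ P add zero key

theorem coefSub_le {J : AddSubgroup A} {M : AddSubgroup E.U}
    (h : ∀ a ∈ J, ∀ u, E.incl a * u ∈ M) : E.coefSub J ≤ M := fun u hu =>
  coefSub_induction (S := Set.univ) (P := (· ∈ M)) (fun a ha _ _ => h a ha _) (zero_mem _)
    (fun _ _ => add_mem) (E.induction_on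
      (P := (· ∈ E.adjoin Set.univ)) (fun a μ => AddSubgroup.subset_closure
        ⟨a, μ, fun _ _ => trivial, rfl⟩) (fun _ _ => add_mem) u) hu

theorem var_pow (y : E.Y) (n : ℕ) : E.dpow y 1 ^ n = n.factorial • E.dpow y n := by
  induction n with
  | zero => simp [E.dpow_zero]
  | succ n ih =>
    rw [pow_succ, ih, smul_mul_assoc]
    rcases Nat.even_or_odd (E.deg y) with h | h
    · rw [E.dpow_mul y h, ← nsmul_eq_mul, smul_smul, Nat.factorial_succ, Nat.choose_succ_self_right,
        mul_comm]
    · obtain _ | n := n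
      · simp [E.dpow_zero]
      · rw [E.dpow_odd y h (n + 1 + 1) (by omega), smul_zero]
        obtain _ | n := n
        · rw [← sq, E.U.sq_eq_zero _ _ (by rwa [one_mul]) (E.dpow_mem y 1), smul_zero]
        · rw [E.dpow_odd y h _ (by omega), zero_mul, smul_zero]

theorem var_mem (y : E.Y) : E.dpow y 1 ∈ E.U.grading (E.deg y) := by
  simpa using E.dpow_mem y 1

/-- As `y ^ i = i! y^{(i)}`, independence of divided powers gives `i! c_i` modulo `J`, and `J` is
closed under division by nonzero integers. It is used for `J = 0` and for `J = 𝔪_A`. -/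
theorem mem_coefSub_of_sum_pow {J : AddSubgroup A} (hJ : ∀ n ≠ 0, ∀ a, n • a ∈ J → a ∈ J) {S : Set E.Y}
    {y : E.Y} (hy : y ∉ S) {n : ℕ} (hn : Odd (E.deg y) → n ≤ 2) (c : ℕ → E.U)
    (hc : ∀ i, c i ∈ E.adjoin S)
    (h : ∑ i ∈ Finset.range n, c i * E.dpow y 1 ^ i ∈ E.coefSub J) {i : ℕ} (hi : i < n) :
    c i ∈ E.coefSub J := by
  intro μ
  refine hJ _ i.factorial_ne_zero _ ?_
  rw [← map_nsmul]
  refine coef_mem_of_sum J hy hn (fun i => i.factorial • c i) (fun i => nsmul_mem (hc i) _) ?_ hi μ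
  have : ∑ i ∈ Finset.range n, i.factorial • c i * E.dpow y i =
      ∑ i ∈ Finset.range n, c i * E.dpow y 1 ^ i :=
    Finset.sum_congr rfl fun j _ => by rw [var_pow, smul_mul_assoc, mul_smul_comm]
  rwa [this]

theorem isUnit_natCast (hQ : ∀ n : ℕ, n ≠ 0 → IsUnit (n : A)) {n : ℕ} (hn : n ≠ 0) :
    ∃ a : A, ∀ u : E.U, E.incl a * n • u = u := by
  obtain ⟨a, ha⟩ := (hQ n hn).exists_left_inv
  refine ⟨a, fun u => ?_⟩
  rw [nsmul_eq_mul, ← map_natCast E.incl.toRingHom n, ← mul_assoc, ← E.incl.map_mul, ha,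
    E.incl.map_one, one_mul]

theorem nsmul_mem_imp {J : AddSubgroup A} (hJ : ∀ a ∈ J, ∀ b, b * a ∈ J)
    (hQ : ∀ n : ℕ, n ≠ 0 → IsUnit (n : A)) (n : ℕ) (hn : n ≠ 0) (a : A) (ha : n • a ∈ J) :
    a ∈ J := by
  obtain ⟨b, hb⟩ := (hQ n hn).exists_left_inv
  have := hJ _ ha b
  rwa [nsmul_eq_mul, ← mul_assoc, hb, one_mul] at this

section SubAlg

variable {S T : Set E.Y} (hS : Good S) (hT : Good T)

/-- The inclusion of `A⟨S⟩` into `A⟨T⟩`. -/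
noncomputable def subAlgMap (h : S ⊆ T) : Hom (subAlg S hS) (subAlg T hT) where
  toRingHom := Subring.inclusion (adjoin_mono h)
  map_mem _ _ h := h
  map_d _ := rfl

theorem subAlgIncl_subAlgMap (h : S ⊆ T) (x : subAlg S hS) :
    subAlgIncl T hT (subAlgMap hS hT h x) = subAlgIncl S hS x := rfl

theorem subAlgIncl_mem (x : subAlg S hS) : subAlgIncl S hS x ∈ E.adjoin S :=
  (mem_range_subAlgIncl S hS).1 ⟨x, rfl⟩

theorem mem_subAlg_grading {x : subAlg S hS} {i : ℕ} :
    x ∈ (subAlg S hS).grading i ↔ subAlgIncl S hS x ∈ E.U.grading i := Iff.rfl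

theorem good_insert (hS : Good S) {y : E.Y} (hy : ∀ y', E.deg y' < E.deg y → y' ∈ S) :
    Good (insert y S) := by
  rintro y₁ (rfl | h₁) y₂ h
  · exact Or.inr (hy y₂ h)
  · exact Or.inr (hS y₁ h₁ y₂ h)

theorem map_mem_powSpan {y : E.Y} (h : S ⊆ T) {x : subAlg T hT}
    (hx : subAlgIncl T hT x = E.dpow y 1) {n : ℕ} {w : subAlg T hT}
    (hw : w ∈ powSpan (subAlgMap hS hT h) x n) :
    ∃ c : ℕ → E.U, (∀ j, c j ∈ E.adjoin S) ∧
      subAlgIncl T hT w = ∑ j ∈ Finset.range n, c j * E.dpow y 1 ^ j := by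
  obtain ⟨c, hc⟩ := exists_sum_of_mem_powSpan hw
  refine ⟨fun j => subAlgIncl S hS (c j), fun j => subAlgIncl_mem hS _, ?_⟩
  rw [hc, ← hx]
  rw [_root_.map_sum]
  refine Finset.sum_congr rfl fun j _ => ?_
  rw [Hom.map_mul, Hom.map_pow]
  rfl

/-- The monomials `y ^ n` are independent over `A⟨S⟩` modulo `J`. -/
theorem mem_coefSub_of_powSpan {J : AddSubgroup A} (hJ : ∀ n ≠ 0, ∀ a, n • a ∈ J → a ∈ J)
    {y : E.Y} (hy : y ∉ S) (h : S ⊆ T) {x : subAlg T hT} (hx : subAlgIncl T hT x = E.dpow y 1)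
    {n : ℕ} (hn : Odd (E.deg y) → n ≤ 1) {c : subAlg S hS} {w : subAlg T hT}
    (hw : w ∈ powSpan (subAlgMap hS hT h) x n)
    (hcw : subAlgIncl T hT (subAlgMap hS hT h c * x ^ n + w) ∈ E.coefSub J) :
    subAlgIncl S hS c ∈ E.coefSub J := by
  have hmem : subAlgMap hS hT h c * x ^ n + w ∈ powSpan (subAlgMap hS hT h) x (n + 1) :=
    add_mem (mul_pow_mem_powSpan _ _ _ (Nat.lt_succ_self n)) (powSpan_mono (Nat.le_succ n) hw)
  obtain ⟨b, hb, hwb⟩ := map_mem_powSpan hS hT h hx hw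
  have := mem_coefSub_of_sum_pow hJ hy (n := n + 1) (fun h' => by have := hn h'; omega)
    (fun j => if j = n then subAlgIncl S hS c else b j)
    (fun j => by split_ifs; exacts [subAlgIncl_mem hS _, hb j]) (by
      rw [Finset.sum_range_succ, if_pos rfl]
      convert hcw using 1
      rw [Hom.map_add, Hom.map_mul, Hom.map_pow, hx, hwb, add_comm, subAlgIncl_subAlgMap]
      congr 1
      refine Finset.sum_congr rfl fun j hj => ?_
      rw [if_neg (Finset.mem_range.1 hj).ne]) (Nat.lt_succ_self n)
  rwa [if_pos rfl] at this

/-- When the nonzero integers are units, the divided power `y^{(i)}` is `y^i / i!`; so the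
`Γ`-extension by `y` is a free extension. -/
theorem isFreeExt_subAlg (hQ : ∀ n : ℕ, n ≠ 0 → IsUnit (n : A)) {y : E.Y} (hy : y ∉ S)
    (hT : Good (insert y S)) {k : ℕ} (hk : E.deg y = k) {z : subAlg S hS}
    (hz : subAlgIncl S hS z = E.U.d (E.dpow y 1)) {x : subAlg (insert y S) hT}
    (hx : subAlgIncl _ hT x = E.dpow y 1) :
    IsFreeExt (subAlgMap hS hT (Set.subset_insert y S)) k z x where
  mem := by
    rw [mem_subAlg_grading, hx, ← hk]
    exact var_mem y
  d_var := subAlgIncl_injective _ hT (by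
    rw [Hom.map_d, hx, subAlgIncl_subAlgMap, hz])
  top n hn c hc := by
    refine subAlgIncl_injective S hS ?_
    rw [Hom.map_zero]
    have := mem_coefSub_of_powSpan (J := ⊥) hS hT
      (fun n hn a ha => nsmul_mem_imp (fun a ha b => by
        rw [AddSubgroup.mem_bot] at ha ⊢; rw [ha, mul_zero]) hQ n hn a ha)
      hy (Set.subset_insert y S) hx (n := n) (hk ▸ hn) (c := c) (neg_mem hc)
      (by rw [add_neg_cancel, Hom.map_zero]; exact zero_mem _)
    rwa [coefSub_bot, AddSubgroup.mem_bot] at this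
  span u := by
    obtain ⟨n, -, c, hc, hu⟩ := mem_adjoin_insert (subAlgIncl_mem hT u)
    refine ⟨n, ?_⟩
    choose a ha using fun i : ℕ => isUnit_natCast (E := E) hQ i.factorial_ne_zero
    let b : ℕ → subAlg S hS := fun i => ⟨E.incl (a i) * c i,
      MulMemClass.mul_mem (incl_mem_adjoin S _) (hc i)⟩
    have : u = ∑ i ∈ Finset.range n, subAlgMap hS hT (Set.subset_insert y S) (b i) * x ^ i := by
      apply subAlgIncl_injective _ hT
      rw [hu]
      rw [_root_.map_sum]
      refine Finset.sum_congr rfl fun i _ => ?_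
      rw [Hom.map_mul, Hom.map_pow, hx, var_pow]
      change _ = E.incl (a i) * c i * _
      rw [mul_assoc, mul_smul_comm, ha]
    rw [this]
    exact sum_mem fun i hi => mul_pow_mem_powSpan _ _ _ (Finset.mem_range.1 hi)

end SubAlg

theorem admissible_zero : E.Admissible 0 := fun _ _ => Nat.zero_le _

theorem coef_zero_incl (a : A) : E.coef 0 (E.incl a) = a := by
  have := E.coef_monomial_self E.admissible_zero a
  rwa [monomial_zero, mul_one] at this

theorem adjoin_empty {u : E.U} (hu : u ∈ E.adjoin ∅) : ∃ a, u = E.incl a := by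
  refine adjoin_induction_terms (P := fun u => ∃ a, u = E.incl a) ?_ ?_ hu
  · intro a μ hμ
    have : μ = 0 := by
      ext y
      by_contra h
      exact hμ y h
    exact ⟨a, by rw [this, monomial_zero, mul_one]⟩
  · rintro u v ⟨a, rfl⟩ ⟨b, rfl⟩
    exact ⟨a + b, by rw [E.incl.map_add]⟩

theorem mem_incl_of_mem_grading_zero {u : E.U} (hu : u ∈ E.U.grading 0) : ∃ a, u = E.incl a :=
  adjoin_empty (mem_adjoin_of_mem_grading (fun y hy => absurd hy (by
    have := E.deg_pos y; omega)) hu)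

section MaxSub

variable [A.IsLocal]

variable (E) in
/-- The ideal `𝔪_A U`. -/
def maxSub : AddSubgroup E.U := E.coefSub A.maxIdeal.toAddSubgroup

theorem incl_mul_mem_maxSub {a : A} (ha : a ∈ A.maxIdeal) (u : E.U) : E.incl a * u ∈ E.maxSub := by
  intro ν
  rw [coef_mul_left]
  exact A.mul_mem_maxIdeal_right ha _

theorem mul_mem_maxSub_right {u : E.U} (hu : u ∈ E.maxSub) (v : E.U) : u * v ∈ E.maxSub := by
  have : E.maxSub ≤ E.maxSub.comap (AddMonoidHom.mulRight v) := coefSub_le fun a ha u => by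
    change E.incl a * u * v ∈ E.maxSub
    rw [mul_assoc]
    exact incl_mul_mem_maxSub ha _
  exact this hu

theorem mul_mem_maxSub_left {u : E.U} (hu : u ∈ E.maxSub) (v : E.U) : v * u ∈ E.maxSub := by
  have : E.maxSub ≤ E.maxSub.comap (AddMonoidHom.mulLeft v) := coefSub_le fun a ha u => by
    change v * (E.incl a * u) ∈ E.maxSub
    induction v using E.induction_on with
    | add v w hv hw => rw [add_mul]; exact add_mem hv hw
    | mon b μ =>
      rw [mul_assoc, ← mul_assoc (E.monomial μ), E.U.mul_comm_sgnPow (E.monomial_mem μ),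
        ← E.incl.map_sgnPow, mul_assoc, ← mul_assoc (E.incl b), ← E.incl.map_mul]
      exact incl_mul_mem_maxSub (Ideal.mul_mem_left _ _ (A.sgnPow_mem_maxIdeal ha _)) _
  exact this hu

theorem incl_mem_maxSub {a : A} (ha : a ∈ A.maxIdeal) : E.incl a ∈ E.maxSub := by
  simpa using incl_mul_mem_maxSub (E := E) ha 1

theorem mem_maxIdeal_of_incl {a : A} (ha : E.incl a ∈ E.maxSub) : a ∈ A.maxIdeal := by
  have := ha 0
  rwa [coef_zero_incl] at this

theorem d_mem_maxSub {S : Set E.Y} (h : ∀ y ∈ S, E.U.d (E.dpow y 1) ∈ E.maxSub) {u : E.U}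
    (hu : u ∈ E.adjoin S) : E.U.d u ∈ E.maxSub :=
  d_mem_of_dvar_mem (fun u _ _ hv => mul_mem_maxSub_left hv u)
    (fun u _ _ hv => mul_mem_maxSub_right hv u)
    (fun a => by rw [← E.incl.map_d]; exact incl_mem_maxSub (A.d_mem_maxIdeal a)) h hu

/-- For a minimal extension, the linear part of a boundary is trivial modulo `𝔪_A`. -/
theorem coef_single_mem_of_isMinimal (hmin : E.IsMinimal) (u : E.U) (y : E.Y) :
    E.coef (Finsupp.single y 1) (E.U.d u) ∈ A.maxIdeal := by
  obtain ⟨x, hx, w, hw, hxw⟩ := Submodule.mem_sup.1 (hmin u)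
  have hle : A.maxIdeal.map E.incl.toRingHom ≤
      ({ E.maxSub with smul_mem' := fun v u hu => mul_mem_maxSub_left hu v } : Ideal E.U) :=
    Ideal.map_le_iff_le_comap.2 fun a ha => incl_mem_maxSub ha
  -- The vanishing of a single coefficient does not define an ideal; requiring it for all left
  -- multiples does. A multiple of a monomial of total exponent at least two never contains a bare
  -- variable.
  have hle' : E.decomposables ≤
      ({ carrier := {u | ∀ v, E.coef (Finsupp.single y 1) (v * u) = 0}
         add_mem' := fun {a b} ha hb v => by rw [mul_add, map_add, ha, hb, add_zero]
         zero_mem' := fun v => by rw [mul_zero, map_zero]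
         smul_mem' := fun b a ha v => by
          change E.coef _ (v * (b * a)) = 0
          rw [← mul_assoc, ha] } : Ideal E.U) := by
    refine Ideal.span_le.2 ?_
    rintro _ ⟨μ, hμ, rfl⟩ v
    induction v using E.induction_on with
    | add v w hv hw => rw [add_mul, map_add, hv, hw, add_zero]
    | mon a ν =>
      obtain ⟨n, hn⟩ := E.monomial_mul_monomial ν μ
      rw [mul_assoc, hn, mul_smul_comm, map_zsmul, coef_monomial_ne, smul_zero]
      intro h
      have h1 := congrArg (fun κ : E.Y →₀ ℕ => κ.sum fun _ i => i) h
      simp only [Finsupp.sum_single_index] at h1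
      rw [Finsupp.sum_add_index' (fun _ => rfl) (fun _ _ _ => rfl)] at h1
      omega
  rw [← hxw, map_add]
  have h1 := hle' hw 1
  rw [one_mul] at h1
  rw [h1, add_zero]
  exact hle hx _

end MaxSub

end GammaExtension

/-! ### Residue characteristic zero: derivations and minimality. -/

section Ext1

variable {C : CDGA.{u}} {f : ℕ} {z : C} (hz : z ∈ C.grading f) (hdz : C.d z = 0)
  (h : Even f ∨ z = 0)

theorem ext1Snd_incl_mul (b : C) (r : C.ext1 f z hz hdz h) :
    C.ext1Snd f z hz hdz h (C.ext1Incl f z hz hdz h b * r) = b * C.ext1Snd f z hz hdz h r := by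
  change b * _ + 0 * C.sgnPow _ _ = _
  rw [zero_mul, add_zero]
  rfl

theorem ext1Snd_d (r : C.ext1 f z hz hdz h) :
    C.ext1Snd f z hz hdz h ((C.ext1 f z hz hdz h).d r) = C.d (C.ext1Snd f z hz hdz h r) := rfl

theorem ext1Snd_mem {i : ℕ} {r : C.ext1 f z hz hdz h} (hr : r ∈ (C.ext1 f z hz hdz h).grading i) :
    C.ext1Snd f z hz hdz h r = 0 ∨
      ∃ k, k + (f + 1) = i ∧ C.ext1Snd f z hz hdz h r ∈ C.grading k :=
  (C.mem_shift).1 hr.2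

/-- In dual numbers the coefficient of the new variable in `(e + τ)^n` is the derivative `n
e^{n-1}`. -/
theorem ext1_add_var_pow (e : C) {n : ℕ} (hn : Odd (f + 1) → n ≤ 1) :
    ∃ p, (C.ext1Incl f z hz hdz h e + C.ext1Var f z hz hdz h) ^ n =
      C.ext1Incl f z hz hdz h p + C.ext1Incl f z hz hdz h (n • e ^ (n - 1)) *
        C.ext1Var f z hz hdz h := by
  set i := C.ext1Incl f z hz hdz h
  set τ := C.ext1Var f z hz hdz h
  have hττ : τ * τ = 0 := by
    change (⟨0 * 0, 0 * 1 + 1 * C.sgnPow _ 0⟩ : Ext1 C f) = 0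
    ext <;> simp
  rcases Nat.even_or_odd (f + 1) with hf | hf
  · refine ⟨e ^ n, ?_⟩
    have hc : ∀ b, τ * b = b * τ := fun b =>
      ((C.ext1 f z hz hdz h).comm_even (C.ext1Var_mem f z hz hdz h) hf b).eq
    induction n with
    | zero => simp [i.map_zero, i.map_one]
    | succ n ih =>
      rw [pow_succ, ih (fun h' => absurd hf (Nat.not_even_iff_odd.2 h')), add_mul, mul_add, mul_add,
        mul_assoc _ τ τ, hττ, mul_zero, add_zero, mul_assoc, hc, ← mul_assoc, ← i.map_mul,
        ← i.map_mul, ← pow_succ, add_assoc, ← add_mul, ← i.map_add, Nat.add_sub_cancel]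
      congr 3
      obtain _ | n := n
      · simp
      · rw [smul_mul_assoc, Nat.add_sub_cancel, ← pow_succ, succ_nsmul _ (n + 1), add_comm]
  · have := hn hf
    obtain _ | _ | n := n
    · exact ⟨1, by simp [i.map_zero, i.map_one]⟩
    · exact ⟨e, by simp [i.map_one]⟩
    · omega

end Ext1

theorem IsFreeExt.hom_ext {C : CDGA.{u}} {E : CDGA.{v}} {D : CDGA.{w}} {i : Hom C E} {k : ℕ}
    {z : C} {y : E} (h : IsFreeExt i k z y) {g g' : Hom E D} (hi : ∀ c, g (i c) = g' (i c))
    (hy : g y = g' y) (u : E) : g u = g' u := by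
  obtain ⟨n, hn⟩ := h.span u
  have : powSpan i y n ≤ (AddMonoidHom.eqLocus g.toRingHom.toAddMonoidHom
      g'.toRingHom.toAddMonoidHom) := (AddSubgroup.closure_le _).2 <| by
    rintro _ ⟨c, j, -, rfl⟩
    change g (i c * y ^ j) = g' (i c * y ^ j)
    rw [g.map_mul, g.map_pow, g'.map_mul, g'.map_pow, hi, hy]
  exact this hn

namespace GammaExtension

variable {A : CDGA.{u}} {E : GammaExtension A}

variable [A.IsLocal]

/-- The derivation `∂/∂ y` of `A⟨S, y⟩` over `A⟨S⟩` extends to a chain derivation of `A⟨T⟩` with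
values in `U`, if `U` is acyclic. -/
theorem exists_derivation (hE : E.IsAcyclic) (hQ : ∀ n : ℕ, n ≠ 0 → IsUnit (n : A))
    (h0 : ∀ u ∈ E.U.grading 0, u ∈ E.maxSub → ∃ w ∈ E.U.grading 1, E.U.d w = u)
    {S T : Set E.Y} (hS : Good S) (hT : Good T) (hfin : T.Finite) (hST : S ⊆ T)
    (hTd : ∀ y ∈ T, E.U.d (E.dpow y 1) ∈ E.maxSub) {y : E.Y} (hyT : y ∈ T) (hyS : y ∉ S)
    (hlow : ∀ y', E.deg y' < E.deg y → y' ∈ S) {f : ℕ} (hf : E.deg y = f + 1)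
    (hz : (0 : E.U) ∈ E.U.grading f) (hdz : E.U.d 0 = 0) (h : Even f ∨ (0 : E.U) = 0) :
    ∃ Φ : Hom (subAlg T hT) (E.U.ext1 f 0 hz hdz h),
      (∀ x, subAlgIncl T hT x ∈ E.adjoin S →
        Φ x = E.U.ext1Incl f 0 hz hdz h (subAlgIncl T hT x)) ∧
      (∀ x, subAlgIncl T hT x = E.dpow y 1 →
        Φ x = E.U.ext1Incl f 0 hz hdz h (E.dpow y 1) + E.U.ext1Var f 0 hz hdz h) ∧
      ∀ x, subAlgIncl T hT x ∈ E.maxSub → E.U.ext1Snd f 0 hz hdz h (Φ x) ∈ E.maxSub := by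
  set R := E.U.ext1 f 0 hz hdz h
  set I := E.U.ext1Incl f 0 hz hdz h
  set τ := E.U.ext1Var f 0 hz hdz h
  have hτ : τ ∈ R.grading (f + 1) := E.U.ext1Var_mem f 0 hz hdz h
  have hdτ : R.d τ = 0 := by
    rw [E.U.d_ext1Var f 0 hz hdz h, Hom.map_zero]
  let ρ : Hom R E.U := E.U.ext1Lift f 0 hz hdz h (Hom.id _) 0 (zero_mem _) (by simp [Hom.map_zero])
    (mul_zero _)
  have hρ : ∀ a b, ρ (I a + I b * τ) = a := fun a b => by
    have := E.U.ext1Lift_apply f 0 hz hdz h (Hom.id _) 0 (zero_mem _) (by simp [Hom.map_zero])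
      (mul_zero _) (I a + I b * τ)
    rw [ext1Fst_add_mul, mul_zero, add_zero] at this
    exact this
  have hρI : ∀ a, ρ (I a) = a := fun a => by
    have := hρ a 0
    rwa [I.map_zero, zero_mul, add_zero] at this
  -- The derivation is the second component of `Φ`. It is `A`-linear, because `Φ` restricts to the
  -- inclusion on `A`, and hence preserves `𝔪_A U`.
  have hmax : ∀ (V : Set E.Y) (hV : Good V) (Φ : Hom (subAlg V hV) R), S ⊆ V →
      (∀ x, subAlgIncl V hV x ∈ E.adjoin S → Φ x = I (subAlgIncl V hV x)) →
      ∀ x, subAlgIncl V hV x ∈ E.maxSub → E.U.ext1Snd f 0 hz hdz h (Φ x) ∈ E.maxSub := by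
    intro V hV Φ hSV hΦ x hx
    refine (coefSub_induction (S := V) (J := A.maxIdeal.toAddSubgroup)
      (P := fun u => u ∈ E.adjoin V ∧ ∀ x, subAlgIncl V hV x = u →
        E.U.ext1Snd f 0 hz hdz h (Φ x) ∈ E.maxSub) ?_ ?_ ?_ (subAlgIncl_mem hV x) hx).2 x rfl
    · intro a ha μ hμ
      have hμV : E.monomial μ ∈ E.adjoin V :=
        AddSubgroup.subset_closure ⟨1, μ, hμ, by rw [E.incl.map_one, one_mul]⟩
      refine ⟨MulMemClass.mul_mem (incl_mem_adjoin V a) hμV, fun x hx => ?_⟩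
      let c : subAlg V hV := ⟨E.incl a, incl_mem_adjoin V a⟩
      let m : subAlg V hV := ⟨E.monomial μ, hμV⟩
      have : x = c * m := subAlgIncl_injective V hV hx
      rw [this, Φ.map_mul, hΦ c (incl_mem_adjoin S a), ext1Snd_incl_mul]
      exact incl_mul_mem_maxSub ha _
    · refine ⟨zero_mem _, fun x hx => ?_⟩
      rw [show x = 0 from subAlgIncl_injective V hV hx, Φ.map_zero, map_zero]
      exact zero_mem _
    · rintro u v ⟨hu, hu'⟩ ⟨hv, hv'⟩
      refine ⟨add_mem hu hv, fun x hx => ?_⟩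
      let c : subAlg V hV := ⟨u, hu⟩
      let m : subAlg V hV := ⟨v, hv⟩
      rw [show x = c + m from subAlgIncl_injective V hV hx, Φ.map_add, map_add]
      exact add_mem (hu' c rfl) (hv' m rfl)
  -- The induction also carries that `Φ` lifts the inclusion of `A⟨T⟩`; this identifies the first
  -- component of `Φ (∂y')` as `∂y'`.
  suffices key : ∃ (hT : Good T) (Φ : Hom (subAlg T hT) R),
      (∀ x, subAlgIncl T hT x ∈ E.adjoin S → Φ x = I (subAlgIncl T hT x)) ∧
      (∀ x, subAlgIncl T hT x = E.dpow y 1 → Φ x = I (E.dpow y 1) + τ) ∧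
      (∀ x, ρ (Φ x) = subAlgIncl T hT x) by
    obtain ⟨_, Φ, h1, h2, -⟩ := key
    exact ⟨Φ, h1, h2, hmax T hT Φ hST h1⟩
  have hyy : E.dpow y 1 ∈ E.U.grading (f + 1) := hf ▸ var_mem y
  refine good_induction (S₀ := insert y S) hT (good_insert hS hlow)
    (Set.insert_subset hyT hST) (hfin.subset Set.sdiff_subset)
    (P := fun T => ∃ (hT : Good T) (Φ : Hom (subAlg T hT) R),
      (∀ x, subAlgIncl T hT x ∈ E.adjoin S → Φ x = I (subAlgIncl T hT x)) ∧
      (∀ x, subAlgIncl T hT x = E.dpow y 1 → Φ x = I (E.dpow y 1) + τ) ∧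
      (∀ x, ρ (Φ x) = subAlgIncl T hT x)) ?_ ?_
  · have hi := good_insert hS hlow
    let z : subAlg S hS := ⟨E.U.d (E.dpow y 1), dvar_mem_adjoin hlow⟩
    let x : subAlg (insert y S) hi := ⟨E.dpow y 1, dpow_mem_adjoin (Set.mem_insert y S) 1⟩
    have hfree := isFreeExt_subAlg (z := z) (x := x) hS hQ hyS hi hf rfl rfl
    obtain ⟨Φ, hΦi, hΦx⟩ := hfree.exists_lift (I.comp (subAlgIncl S hS))
      (η := I (E.dpow y 1) + τ) (add_mem (I.map_mem _ _ hyy) hτ)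
      (by rw [map_add, hdτ, add_zero, ← I.map_d]; rfl)
    refine ⟨hi, Φ, fun x hx => ?_, fun x' hx' => ?_, hfree.hom_ext (g := ρ.comp Φ)
      (fun c => ?_) ?_⟩
    · let c : subAlg S hS := ⟨subAlgIncl _ hi x, hx⟩
      exact hΦi c
    · rw [show x' = x from subAlgIncl_injective _ hi hx', hΦx]
    · change ρ (Φ _) = _
      rw [hΦi]
      exact hρI _
    · change ρ (Φ _) = _
      rw [hΦx]
      have := hρ (E.dpow y 1) 1
      rw [I.map_one, one_mul] at this
      exact this
  · rintro V y' hV hSV hy'T hy'V hlow' ⟨_, Φ, hΦS, hΦy, hΦρ⟩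
    have hSV' : S ⊆ V := (Set.subset_insert y S).trans hSV
    have hi := good_insert hV hlow'
    let z : subAlg V hV := ⟨E.U.d (E.dpow y' 1), dvar_mem_adjoin hlow'⟩
    let x : subAlg (insert y' V) hi := ⟨E.dpow y' 1, dpow_mem_adjoin (Set.mem_insert y' V) 1⟩
    obtain ⟨k, hk⟩ := Nat.exists_eq_succ_of_ne_zero (E.deg_pos y').ne'
    have hfree := isFreeExt_subAlg (z := z) (x := x) hV hQ hy'V hi hk rfl rfl
    have hzk : z ∈ (subAlg V hV).grading k := hfree.mem_base
    have hdz' : (subAlg V hV).d z = 0 := hfree.d_base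
    set v := E.U.ext1Snd f 0 hz hdz h (Φ z) with hv
    have hΦz : Φ z = I (E.U.d (E.dpow y' 1)) + I v * τ := by
      have h1 := E.U.ext1_eq f 0 hz hdz h (Φ z)
      have h2 := hΦρ z
      rw [h1, hρ] at h2
      rw [h1, h2]
      rfl
    have hdv : E.U.d v = 0 := by
      rw [hv, ← ext1Snd_d, ← Φ.map_d, hdz', Φ.map_zero, map_zero]
    -- Extending over `y'` amounts to bounding the cycle `v`, the derivative of `∂y'`. In positive
    -- degree `U` is acyclic; in degree zero `v` lies in `𝔪_A U`, because `∂y'` does, and so `v`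
    -- bounds by `h0`.
    have hw : ∃ w, E.U.d w = v ∧ I w * τ ∈ R.grading (k + 1) := by
      rcases ext1Snd_mem hz hdz h (Φ.map_mem _ _ hzk) with h1 | ⟨j, hj, h1⟩
      · exact ⟨0, by rw [hv, h1, map_zero], by rw [I.map_zero, zero_mul]; exact zero_mem _⟩
      · have hw : ∃ w ∈ E.U.grading (j + 1), E.U.d w = v := by
          rcases Nat.eq_zero_or_pos j with rfl | hj0
          · exact h0 v h1 (hmax V hV Φ hSV' hΦS z (hTd y' hy'T))
          · exact hE.exact j hj0 v h1 hdv
        obtain ⟨w, hw, hdw⟩ := hw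
        refine ⟨w, hdw, ?_⟩
        have := R.mul_mem (I.map_mem _ _ hw) hτ
        rwa [show j + 1 + (f + 1) = k + 1 by omega] at this
    obtain ⟨w, hdw, hwmem⟩ := hw
    have hyk : E.dpow y' 1 ∈ E.U.grading (k + 1) := by
      have := var_mem y'
      rwa [hk] at this
    obtain ⟨Φ', hΦi, hΦx⟩ := hfree.exists_lift Φ (η := I (E.dpow y' 1) + I w * τ)
      (add_mem (I.map_mem _ _ hyk) hwmem)
      (by rw [map_add, R.d_mul_cycle _ hdτ, ← I.map_d, ← I.map_d, hdw, hΦz])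
    refine ⟨hi, Φ', fun x hx => ?_, fun x' hx' => ?_, hfree.hom_ext (g := ρ.comp Φ')
      (fun c => ?_) ?_⟩
    · let c : subAlg V hV := ⟨subAlgIncl _ hi x, adjoin_mono hSV' hx⟩
      exact (hΦi c).trans (hΦS c hx)
    · let c : subAlg V hV := ⟨E.dpow y 1, dpow_mem_adjoin (hSV (Set.mem_insert y S)) 1⟩
      rw [show x' = subAlgMap hV hi (Set.subset_insert y' V) c from subAlgIncl_injective _ hi hx',
        hΦi, hΦy c rfl]
    · change ρ (Φ' _) = _
      rw [hΦi, hΦρ]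
      rfl
    · change ρ (Φ' _) = _
      rw [hΦx]
      exact hρ _ _

/-- A cycle of `A⟨S, y⟩`, modulo `𝔪_A`, without linear part is independent of `y`. -/
theorem exists_sub_mem_maxSub (hE : E.IsAcyclic) (hQ : ∀ n : ℕ, n ≠ 0 → IsUnit (n : A))
    (h0 : ∀ u ∈ E.U.grading 0, u ∈ E.maxSub → ∃ w ∈ E.U.grading 1, E.U.d w = u)
    {d : ℕ} (hd : ∀ y, E.deg y < d + 1 → E.U.d (E.dpow y 1) ∈ E.maxSub) {S : Set E.Y}
    (hS : Good S) (hST : ∀ y ∈ S, E.deg y < d + 1) {y : E.Y} (hyT : E.deg y < d + 1) (hyS : y ∉ S)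
    (hlow : ∀ y', E.deg y' < E.deg y → y' ∈ S) {z : E.U} (hz : z ∈ E.U.grading d)
    (hdz : E.U.d z = 0) (hz1 : E.coef (Finsupp.single y 1) z ∈ A.maxIdeal)
    (hzS : ∃ u ∈ E.adjoin (insert y S), z - u ∈ E.maxSub) :
    ∃ u ∈ E.adjoin S, z - u ∈ E.maxSub := by
  obtain ⟨u, hu, hzu⟩ := hzS
  obtain ⟨f, hf⟩ := Nat.exists_eq_succ_of_ne_zero (E.deg_pos y).ne'
  have hf' : E.deg y = f + 1 := hf
  obtain ⟨n, hn, c', hc', hu'⟩ := mem_adjoin_insert hu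
  choose a ha using fun i : ℕ => isUnit_natCast (E := E) hQ i.factorial_ne_zero
  set c : ℕ → E.U := fun i => E.incl (a i) * c' i with hc_def
  have hc : ∀ i, c i ∈ E.adjoin S := fun i => MulMemClass.mul_mem (incl_mem_adjoin S _) (hc' i)
  have hcu : u = ∑ i ∈ Finset.range n, c i * E.dpow y 1 ^ i := by
    rw [hu']
    refine Finset.sum_congr rfl fun i _ => ?_
    rw [var_pow, hc_def, mul_assoc, mul_smul_comm, ha]
  set T : Set E.Y := {y | E.deg y < d + 1} with hT_def
  have hT : Good T := good_deg_lt _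
  have hz0 : (0 : E.U) ∈ E.U.grading f := zero_mem _
  have hdz0 : E.U.d 0 = 0 := map_zero _
  obtain ⟨Φ, hΦS, hΦy, hΦm⟩ := exists_derivation hE hQ h0 hS hT (finite_deg_lt _) hST hd
    hyT hyS hlow hf' hz0 hdz0 (Or.inr rfl)
  set σ := E.U.ext1Snd f 0 hz0 hdz0 (Or.inr rfl)
  have hzT : z ∈ E.adjoin T :=
    mem_adjoin_of_mem_grading (fun y hy => Nat.lt_succ_of_le hy) hz
  have huT : u ∈ E.adjoin T := adjoin_mono (Set.insert_subset hyT hST) hu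
  let zT : subAlg T hT := ⟨z, hzT⟩
  let uT : subAlg T hT := ⟨u, huT⟩
  let yT : subAlg T hT := ⟨E.dpow y 1, dpow_mem_adjoin hyT 1⟩
  have hn1 : ∀ i, i < n → Odd (f + 1) → i ≤ 1 := fun i hi h' => by
    have := hn (hf' ▸ h'); omega
  have hterm : ∀ i < n, ∀ (x : subAlg T hT), subAlgIncl T hT x = c i * E.dpow y 1 ^ i →
      σ (Φ x) = i • (c i * E.dpow y 1 ^ (i - 1)) := by
    intro i hi x hx
    let cT : subAlg T hT := ⟨c i, adjoin_mono hST (hc i)⟩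
    have : x = cT * yT ^ i := subAlgIncl_injective T hT hx
    obtain ⟨p, hp⟩ := ext1_add_var_pow hz0 hdz0 (Or.inr rfl) (E.dpow y 1) (hn1 i hi)
    rw [this, Φ.map_mul, Φ.map_pow, hΦS cT (hc i), hΦy yT rfl, hp, ext1Snd_incl_mul,
      ext1Snd_add_mul, mul_smul_comm]
    rfl
  have hσu : σ (Φ uT) = ∑ i ∈ Finset.range n, i • (c i * E.dpow y 1 ^ (i - 1)) := by
    let x : ℕ → subAlg T hT := fun i => ⟨c i * E.dpow y 1 ^ i, MulMemClass.mul_mem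
      (adjoin_mono hST (hc i)) (_root_.pow_mem (dpow_mem_adjoin hyT 1) _)⟩
    have : uT = ∑ i ∈ Finset.range n, x i := by
      apply subAlgIncl_injective T hT
      rw [map_sum]
      exact hcu
    rw [this, map_sum, map_sum]
    exact Finset.sum_congr rfl fun i hi => hterm i (Finset.mem_range.1 hi) _ rfl
  have hσm : σ (Φ (zT - uT)) ∈ E.maxSub := hΦm (zT - uT) hzu
  have hdσ : E.U.d (σ (Φ zT)) = 0 := by
    rw [← ext1Snd_d, ← Φ.map_d, show (subAlg T hT).d zT = 0 from subAlgIncl_injective T hT hdz,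
      Φ.map_zero, map_zero]
  -- The derivative of `z` is a cycle. In positive degree it is the boundary of an element of
  -- `A⟨T⟩`, so it lies in `𝔪_A U`. In degree zero it is, modulo `𝔪_A` and up to sign, the
  -- coefficient of `y` in `z`, which is in `𝔪_A` by hypothesis.
  have hσz : σ (Φ zT) ∈ E.maxSub := by
    rcases ext1Snd_mem hz0 hdz0 (Or.inr rfl) (Φ.map_mem d zT hz) with h1 | ⟨k, hk, h1⟩
    · change E.U.ext1Snd f 0 hz0 hdz0 (Or.inr rfl) _ ∈ _
      rw [h1]
      exact zero_mem _
    rcases Nat.eq_zero_or_pos k with rfl | hk0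
    · obtain ⟨b, hb⟩ := mem_incl_of_mem_grading_zero h1
      change E.U.ext1Snd f 0 hz0 hdz0 (Or.inr rfl) _ ∈ _
      rw [hb]
      refine incl_mem_maxSub ?_
      have h2 : E.coef 0 (σ (Φ zT)) = b := by
        rw [← E.coef_zero_incl b, ← hb]
      rw [← h2, ← sub_add_cancel zT uT, Φ.map_add, map_add, map_add]
      refine add_mem (hσm 0) ?_
      have h3 : E.coef (0 + Finsupp.single y 1) u ∈ A.maxIdeal := by
        have := sub_mem hz1 (hzu (Finsupp.single y 1))
        rwa [map_sub, sub_sub_cancel, ← zero_add (Finsupp.single y 1)] at this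
      have hdp : ∀ i, c i * E.dpow y 1 ^ i = (i.factorial • c i) * E.dpow y i := fun i => by
        rw [var_pow, smul_mul_assoc, mul_smul_comm]
      have hne : ∀ i j, i ≠ j → E.coef (0 + Finsupp.single y j) (c i * E.dpow y 1 ^ i) = 0 :=
        fun i j hij => by rw [hdp, coef_mul_dpow_ne (nsmul_mem (hc i) _) hyS rfl hij]
      rw [hσu, map_sum]
      refine sum_mem fun i hi => ?_
      rw [map_nsmul]
      obtain _ | _ | i := i
      · rw [zero_smul]; exact zero_mem _
      · rw [zero_add, one_smul, Nat.sub_self, pow_zero, mul_one]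
        rw [hcu, map_sum, Finset.sum_eq_single 1 (fun j _ hj => hne j 1 hj)
          (fun h => absurd hi h), pow_one] at h3
        rcases coef_mul_dpow_self (E := E) (S := S) hyS (μ := 0) rfl (i := 1) (fun _ => le_rfl)
          with h4 | h4
        · rwa [h4 _ (hc 1)] at h3
        · rw [h4 _ (hc 1)] at h3
          exact (neg_mem_iff (S := Ideal A)).1 h3
      · have h4 : E.coef (0 + Finsupp.single y 0)
            (c (i + 1 + 1) * E.dpow y 1 ^ (i + 1 + 1 - 1)) = 0 := by
          rw [Nat.add_sub_cancel, var_pow, mul_smul_comm, map_nsmul,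
            coef_mul_dpow_ne (hc _) hyS rfl (Nat.succ_ne_zero i), smul_zero]
        rw [Finsupp.single_zero, add_zero] at h4
        rw [h4, smul_zero]
        exact zero_mem _
    · obtain ⟨w, hw, hdw⟩ := hE.exact k hk0 _ h1 hdσ
      have hwT : w ∈ E.adjoin T := mem_adjoin_of_mem_grading
        (fun y hy => show E.deg y < d + 1 by omega) hw
      change E.U.ext1Snd f 0 hz0 hdz0 (Or.inr rfl) _ ∈ _
      rw [← hdw]
      exact d_mem_maxSub hd hwT
  have hσu' : σ (Φ uT) ∈ E.maxSub := by
    have := sub_mem hσz hσm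
    rwa [← map_sub, ← Φ.map_sub, sub_sub_cancel] at this
  rw [hσu] at hσu'
  obtain _ | n := n
  · refine ⟨0, zero_mem _, ?_⟩
    rwa [hcu, Finset.sum_range_zero] at hzu
  rw [Finset.sum_range_succ', zero_smul, add_zero] at hσu'
  -- The derivative `∑ i c_i y^{i-1}` of `u` lies in `𝔪_A U`, so every `i c_i` does. Dividing by `i`
  -- leaves only `c_0` modulo `𝔪_A U`.
  have hcm : ∀ i < n, c (i + 1) ∈ E.maxSub := by
    intro i hi
    have h := mem_coefSub_of_sum_pow (J := A.maxIdeal.toAddSubgroup)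
      (fun n hn a ha => A.mem_maxIdeal_of_nsmul_mem hQ hn ha) hyS (n := n)
      (fun h' => by have := hn h'; omega) (fun i => (i + 1) • c (i + 1))
      (fun i => nsmul_mem (hc _) _) (by
        have e : ∑ i ∈ Finset.range n, (i + 1) • c (i + 1) * E.dpow y 1 ^ i =
            ∑ i ∈ Finset.range n, (i + 1) • (c (i + 1) * E.dpow y 1 ^ (i + 1 - 1)) :=
          Finset.sum_congr rfl fun i _ => by rw [smul_mul_assoc, Nat.add_sub_cancel]
        rw [e]
        exact hσu') hi
    intro ν
    have := h ν
    rw [map_nsmul] at this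
    exact A.mem_maxIdeal_of_nsmul_mem hQ (Nat.succ_ne_zero i) this
  refine ⟨c 0, hc 0, ?_⟩
  have : z - c 0 = z - u + ∑ i ∈ Finset.range n, c (i + 1) * E.dpow y 1 ^ (i + 1) := by
    rw [hcu, Finset.sum_range_succ', pow_zero, mul_one]
    abel
  rw [this]
  have hsum : ∑ i ∈ Finset.range n, c (i + 1) * E.dpow y 1 ^ (i + 1) ∈ E.maxSub :=
    sum_mem fun i hi => mul_mem_maxSub_right (hcm i (Finset.mem_range.1 hi)) _
  exact add_mem hzu hsum

/-- In residue characteristic zero, minimality means that the differential of `𝐤 ⊗ U` is zero. -/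
theorem dvar_mem_maxSub (hE : E.IsAcyclic) (hmin : E.IsMinimal)
    (hQ : ∀ n : ℕ, n ≠ 0 → IsUnit (n : A))
    (h0 : ∀ u ∈ E.U.grading 0, u ∈ E.maxSub → ∃ w ∈ E.U.grading 1, E.U.d w = u)
    (h1 : ∀ u a, E.U.d u - E.incl a ∈ E.maxSub → a ∈ A.maxIdeal) (y : E.Y) :
    E.U.d (E.dpow y 1) ∈ E.maxSub := by
  induction hd : E.deg y using Nat.strong_induction_on generalizing y with
  | _ d ih =>
    obtain ⟨d, rfl⟩ := Nat.exists_eq_succ_of_ne_zero (hd ▸ (E.deg_pos y).ne')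
    have hz : E.U.d (E.dpow y 1) ∈ E.U.grading d := E.U.d_mem _ _ (by
      rw [← Nat.succ_eq_add_one, ← hd]
      exact var_mem y)
    -- By induction on the degree, smaller variables have boundaries in `𝔪_A U`. The variables of
    -- `∂y` are removed one at a time modulo `𝔪_A U`, and once none is left the remaining element of
    -- `A` lies in `𝔪_A` by `h1`.
    refine good_induction (S₀ := ∅) (T := {y | E.deg y < d + 1}) (good_deg_lt _)
      (fun _ h => absurd h (Set.notMem_empty _)) (Set.empty_subset _)
      ((finite_deg_lt _).subset Set.sdiff_subset)
      (P := fun S => (∀ y' ∈ S, E.deg y' < d + 1) → (∃ u ∈ E.adjoin S,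
        E.U.d (E.dpow y 1) - u ∈ E.maxSub) → E.U.d (E.dpow y 1) ∈ E.maxSub) ?_ ?_ (fun _ h => h)
      ⟨_, mem_adjoin_of_mem_grading (fun y' hy' => Nat.lt_succ_of_le hy') hz,
        by rw [sub_self]; exact zero_mem _⟩
    · rintro - ⟨u, hu, h⟩
      obtain ⟨a, rfl⟩ := adjoin_empty hu
      have := add_mem h (incl_mem_maxSub (h1 _ _ h))
      rwa [sub_add_cancel] at this
    · intro S y' hS _ hyT hyS hlow hP hST hu
      have hST' : ∀ y'' ∈ S, E.deg y'' < d + 1 := fun y'' h => hST y'' (Or.inr h)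
      exact hP hST' (exists_sub_mem_maxSub hE hQ h0 (fun y'' h => ih _ h y'' rfl) hS hST' hyT hyS
        hlow hz (E.U.d_d _) (coef_single_mem_of_isMinimal hmin _ _) hu)

end GammaExtension

/-! ### Even cycles generated by nilpotent elements and boundaries of degree zero. -/

section NilSub

variable (C : CDGA.{u})

/-- The right ideal generated by `K` and the nilpotent elements of positive degree. -/
def nilSub (K : Set C) : AddSubgroup C :=
  AddSubgroup.closure {u | ∃ x v, u = x * v ∧ ((∃ i, 0 < i ∧ x ∈ C.grading i ∧ IsNilpotent x) ∨
    x ∈ K)}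

variable {C}

theorem mul_pow_signEq {i j : ℕ} {a b : C} (ha : a ∈ C.grading i) (hb : b ∈ C.grading j) (n : ℕ) :
    SignEq ((a * b) ^ n) (a ^ n * b ^ n) := by
  induction n with
  | zero => simpa using SignEq.refl _
  | succ n ih =>
    rw [pow_succ]
    refine (ih.mul_right (a * b)).trans ?_
    have := ((signEq_comm C (C.pow_mem hb n) ha).mul_right b).mul_left (a ^ n)
    rw [pow_succ, pow_succ]
    convert this using 1 <;> noncomm_ring

theorem isNilpotent_mul {i j : ℕ} {a b : C} (ha : a ∈ C.grading i) (hb : b ∈ C.grading j)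
    (h : IsNilpotent a) : IsNilpotent (a * b) := by
  obtain ⟨n, hn⟩ := h
  refine ⟨n, ?_⟩
  have := mul_pow_signEq ha hb n
  rw [hn, zero_mul] at this
  rcases this with h | h
  · exact h
  · rw [h, neg_zero]

/-- If `K` consists of boundaries of degree zero, homogeneous elements of `nilSub C K` of even
degree are homologous to nilpotent ones. -/
theorem exists_nilpotent_of_mem_nilSub {K : Set C} (hK : ∀ x ∈ K, ∃ g ∈ C.grading 1, C.d g = x)
    {e : ℕ} (he : Even e) {u : C} (hu : u ∈ C.nilSub K) :
    ∃ n ∈ C.grading e, IsNilpotent n ∧ ∃ b, C.pr e u = n + C.d b := by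
  induction hu using AddSubgroup.closure_induction with
  | zero => exact ⟨0, zero_mem _, IsNilpotent.zero, 0, by simp⟩
  | add u v _ _ hu hv =>
    obtain ⟨n, hn, hnn, b, hb⟩ := hu
    obtain ⟨n', hn', hnn', b', hb'⟩ := hv
    refine ⟨n + n', add_mem hn hn', (C.comm_even hn he n').isNilpotent_add hnn hnn', b + b', ?_⟩
    rw [map_add, hb, hb', map_add]
    abel
  | neg u _ hu =>
    obtain ⟨n, hn, hnn, b, hb⟩ := hu
    refine ⟨-n, neg_mem hn, hnn.neg, -b, ?_⟩
    rw [map_neg, hb, map_neg]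
    abel
  | mem u hu =>
    obtain ⟨x, v, rfl, ⟨i, -, hx, hxn⟩ | hx⟩ := hu
    · rcases Nat.lt_or_ge e i with h | h
      · exact ⟨0, zero_mem _, IsNilpotent.zero, 0, by
          rw [C.pr_mul_of_mem_lt hx v h, map_zero, add_zero]⟩
      · obtain ⟨k, rfl⟩ := Nat.exists_eq_add_of_le h
        refine ⟨x * C.pr k v, C.mul_mem hx (C.pr_mem k v), isNilpotent_mul hx (C.pr_mem k v) hxn, 0,
          ?_⟩
        rw [C.pr_mul_of_mem hx, map_zero, add_zero]
    -- Up to the boundary of `g v`, the product `(∂g) v` equals `g ∂v`, which is nilpotent because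
    -- `g` is odd and `g ^ 2 = 0`.
    · obtain ⟨g, hg, rfl⟩ := hK x hx
      have hgg : IsNilpotent g := ⟨2, C.sq_eq_zero _ _ odd_one hg⟩
      have h0 : C.pr e (C.d g * v) = C.d g * C.pr e v := by
        have := C.pr_mul_of_mem (C.d_mem 0 g hg) v e
        rwa [zero_add] at this
      have h1 : C.d (g * C.pr e v) = C.d g * C.pr e v - g * C.d (C.pr e v) := by
        rw [C.d_mul_of_odd hg odd_one]
      obtain _ | k := e
      · rw [C.d_eq_zero _ (C.pr_mem 0 v), mul_zero, sub_zero] at h1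
        exact ⟨0, zero_mem _, IsNilpotent.zero, g * C.pr 0 v, by rw [h0, h1, zero_add]⟩
      · have hdv := C.d_mem k _ (C.pr_mem (k + 1) v)
        refine ⟨g * C.d (C.pr (k + 1) v), ?_, isNilpotent_mul hg hdv hgg, g * C.pr (k + 1) v, ?_⟩
        · have := C.mul_mem hg hdv
          rwa [add_comm] at this
        · rw [h0, h1]
          abel

end NilSub

/-! ### Nilpotent models of `A⟨S⟩`. -/

namespace GammaExtension

variable {A : CDGA.{u}} {E : GammaExtension A}

theorem good_empty : Good (∅ : Set E.Y) := fun _ h => absurd h (Set.notMem_empty _)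

variable [A.IsLocal]

/-- A span of quasi-isomorphisms `A⟨S⟩ ← T → T'` such that elements of `𝔪_A A⟨S⟩` correspond to
combinations of nilpotent elements of positive degree and of elements of degree zero. -/
structure IsNilModel {S : Set E.Y} (hS : Good S) {T : CDGA.{v}} {T' : CDGA.{w}}
    (φ : Hom T (subAlg S hS)) (χ : Hom T T') : Prop where
  exact_left : φ.ConeExact ⊤
  exact_right : χ.ConeExact ⊤
  mem : ∀ u, subAlgIncl S hS (φ u) ∈ E.maxSub →
    χ u ∈ T'.nilSub {x | ∃ c ∈ T.grading 0, subAlgIncl S hS (φ c) ∈ E.maxSub ∧ χ c = x}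

/-- Components of positive degree become nilpotent in `T'`; the component of degree zero of an
element lying over `𝔪_A` still lies over `𝔪_A`. -/
theorem isNilModel_empty {T : CDGA.{v}} {T' : CDGA.{w}} {φ : Hom T A} {χ : Hom T T'}
    (hφ : φ.ConeExact ⊤) (hχ : χ.ConeExact ⊤) (hT' : T'.IsNil) :
    ∃ φ' : Hom T (subAlg ∅ (good_empty (E := E))), IsNilModel good_empty φ' χ := by
  let j : Hom A (subAlg ∅ (good_empty (E := E))) :=
    { toRingHom := E.incl.toRingHom.codRestrict _ (incl_mem_adjoin ∅)
      map_mem := fun i a ha => E.incl.map_mem i a ha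
      map_d := fun a => Subtype.ext (E.incl.map_d a) }
  have hj : ∀ a, subAlgIncl ∅ good_empty (j a) = E.incl a := fun a => rfl
  have hjinj : ∀ a b, j a = j b → a = b := fun a b h => E.incl_injective (by rw [← hj, h, hj])
  have hjsurj : ∀ v, ∃ a, j a = v := fun v => by
    obtain ⟨a, ha⟩ := adjoin_empty (subAlgIncl_mem good_empty v)
    exact ⟨a, subAlgIncl_injective _ good_empty ha.symm⟩
  refine ⟨j.comp φ, ?_, hχ, fun u hu => ?_⟩
  · intro v _ x hv hx
    obtain ⟨a, rfl⟩ := hjsurj v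
    obtain ⟨u, e, -, hu, he⟩ := hφ a trivial x (hjinj _ _ ((j.map_d a).trans hv)) hx
    exact ⟨u, j e, trivial, hu, by rw [he, j.map_add, j.map_d]; rfl⟩
  · have hu' : φ u ∈ A.maxIdeal := mem_maxIdeal_of_incl hu
    obtain ⟨n, hn⟩ := T.exists_sum_pr u
    rw [hn n le_rfl]
    change χ.toRingHom _ ∈ _
    rw [_root_.map_sum]
    refine sum_mem fun i _ => AddSubgroup.subset_closure ⟨χ (T.pr i u), 1, (mul_one _).symm, ?_⟩
    rcases Nat.eq_zero_or_pos i with rfl | hi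
    · refine Or.inr ⟨T.pr 0 u, T.pr_mem 0 u, ?_, rfl⟩
      change E.incl (φ (T.pr 0 u)) ∈ _
      refine incl_mem_maxSub ?_
      rw [φ.map_pr, mem_maxIdeal, toZeroRing_pr_zero]
      exact hu'
    · exact Or.inl ⟨i, hi, χ.map_mem _ _ (T.pr_mem i u),
        hT'.isNilpotent hi.ne' (χ.map_mem _ _ (T.pr_mem i u))⟩

theorem exists_cycle_preimage {T : CDGA.{v}} {B : CDGA.{u}} {φ : Hom T B} (hφ : φ.ConeExact ⊤)
    {f : ℕ} {z : B} (hz : z ∈ B.grading f) (hdz : B.d z = 0) :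
    ∃ z' ∈ T.grading f, T.d z' = 0 ∧ ∃ e ∈ B.grading (f + 1), φ z' = z - B.d e := by
  obtain ⟨u, e, -, hu, he⟩ := hφ z trivial 0 (by rw [hdz, φ.map_zero]) (map_zero _)
  refine ⟨T.pr f u, T.pr_mem f u, ?_, B.pr (f + 1) e, B.pr_mem _ _, ?_⟩
  · obtain _ | f := f
    · exact T.d_eq_zero _ (T.pr_mem _ _)
    · rw [← T.pr_d, hu, map_zero]
  · rw [φ.map_pr, ← B.pr_d, eq_sub_iff_add_eq, ← map_add, ← he, B.pr_of_mem hz]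

/-- The cycle `∂y` is homologous to the image of a cycle `z'` of `T`. After the substitution `y ↦ y
- e`, variables bounding `z'`, `φ z'` and `χ z'` are adjoined in parallel, so both
quasi-isomorphisms survive. The condition on `𝔪_A` is checked on leading coefficients. -/
theorem IsNilModel.insert (hQ : ∀ n : ℕ, n ≠ 0 → IsUnit (n : A)) {S : Set E.Y} {hS : Good S}
    {T : CDGA.{v}} {T' : CDGA.{w}} {φ : Hom T (subAlg S hS)} {χ : Hom T T'}
    (h : IsNilModel hS φ χ) {y : E.Y} (hy : y ∉ S) (hlow : ∀ y', E.deg y' < E.deg y → y' ∈ S) :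
    ∃ (hi : Good (insert y S)) (T₁ : CDGA.{v}) (T₁' : CDGA.{w})
      (φ₁ : Hom T₁ (subAlg (insert y S) hi)) (χ₁ : Hom T₁ T₁'), IsNilModel hi φ₁ χ₁ := by
  have hi := good_insert hS hlow
  let j := subAlgMap hS hi (Set.subset_insert y S)
  let z : subAlg S hS := ⟨E.U.d (E.dpow y 1), dvar_mem_adjoin hlow⟩
  let x : subAlg (Insert.insert y S) hi := ⟨E.dpow y 1, dpow_mem_adjoin (Set.mem_insert y S) 1⟩
  obtain ⟨f, hf⟩ := Nat.exists_eq_succ_of_ne_zero (E.deg_pos y).ne'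
  have hf' : E.deg y = f + 1 := hf
  have hfree : IsFreeExt j (f + 1) z x := isFreeExt_subAlg hS hQ hy hi hf rfl rfl
  obtain ⟨z', hz', hdz', e, he, hze⟩ := exists_cycle_preimage h.exact_left hfree.mem_base
    hfree.d_base
  have hfree₁ : IsFreeExt j (f + 1) (φ z') (x - j e) := by
    rw [hze]
    exact hfree.sub he
  obtain ⟨T₁, i, t, ht⟩ := T.exists_isFreeExt hz' hdz'
  obtain ⟨T₁', i', t', ht'⟩ := T'.exists_isFreeExt (χ.map_mem _ _ hz')
    (by rw [← χ.map_d, hdz', χ.map_zero])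
  obtain ⟨φ₁, hφi, hφt⟩ := ht.exists_lift (j.comp φ) hfree₁.mem hfree₁.d_var
  obtain ⟨χ₁, hχi, hχt⟩ := ht.exists_lift (i'.comp χ) ht'.mem ht'.d_var
  have hφi : ∀ c, φ₁ (i c) = j (φ c) := hφi
  have hχi : ∀ c, χ₁ (i c) = i' (χ c) := hχi
  refine ⟨hi, T₁, T₁', φ₁, χ₁, ht.coneExact hfree₁ hφi hφt h.exact_left,
    ht.coneExact ht' hχi hχt h.exact_right, fun u hu => ?_⟩
  set K := {x | ∃ c ∈ T.grading 0, subAlgIncl S hS (φ c) ∈ E.maxSub ∧ χ c = x}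
  set K₁ := {x | ∃ c ∈ T₁.grading 0, subAlgIncl _ hi (φ₁ c) ∈ E.maxSub ∧ χ₁ c = x}
  have hJ : ∀ n ≠ 0, ∀ a : A, n • a ∈ A.maxIdeal.toAddSubgroup → a ∈ A.maxIdeal.toAddSubgroup :=
    fun n hn a ha => A.mem_maxIdeal_of_nsmul_mem hQ hn ha
  have hnil : ∀ u ∈ T'.nilSub K, ∀ v, i' u * v ∈ T₁'.nilSub K₁ := by
    intro u hu v
    induction hu using AddSubgroup.closure_induction with
    | zero => rw [i'.map_zero, zero_mul]; exact zero_mem _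
    | add a b _ _ ha hb => rw [i'.map_add, add_mul]; exact add_mem ha hb
    | neg a _ ha => rw [i'.map_neg, neg_mul]; exact neg_mem ha
    | mem a ha =>
      obtain ⟨b, c, rfl, hb⟩ := ha
      refine AddSubgroup.subset_closure ⟨i' b, i' c * v, by rw [i'.map_mul, mul_assoc], ?_⟩
      rcases hb with ⟨k, hk, hbk, hbn⟩ | ⟨c, hc, hcm, rfl⟩
      · exact Or.inl ⟨k, hk, i'.map_mem _ _ hbk, hbn.map i'.toRingHom⟩
      · refine Or.inr ⟨i c, i.map_mem _ _ hc, ?_, hχi c⟩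
        rw [hφi]
        exact hcm
  obtain ⟨n, hn, hun⟩ := ht.exists_mem u
  induction n generalizing u with
  | zero =>
    rw [powSpan_zero, AddSubgroup.mem_bot] at hun
    rw [hun, χ₁.map_zero]
    exact zero_mem _
  | succ n ih =>
    obtain ⟨c, hc⟩ := exists_sub_mem_powSpan hun
    have hn1 : Odd (f + 1) → n ≤ 1 := fun h' => by have := hn h'; omega
    have hc1 : φ₁ (u - i c * t ^ n) ∈ powSpan j x n := by
      have := map_powSpan hφi hφt hc
      rwa [powSpan_sub hfree.mem he] at this
    have hterm : φ₁ (i c * t ^ n) = j (φ c) * (x - j e) ^ n := by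
      rw [φ₁.map_mul, φ₁.map_pow, hφi, hφt]
    -- Powers of `y` are independent modulo `𝔪_A`, so the leading coefficient lies in `𝔪_A A⟨S⟩`.
    -- Its term can then be removed and the degree in the variable drops.
    have hcm : subAlgIncl S hS (φ c) ∈ E.maxSub := by
      refine mem_coefSub_of_powSpan hS hi hJ hy (Set.subset_insert y S) (x := x) rfl (n := n)
        (hf' ▸ hn1) (w := φ₁ (u - i c * t ^ n) + (j (φ c) * (x - j e) ^ n - j (φ c) * x ^ n))
        (add_mem hc1 (mul_sub_pow_sub_mem hfree.mem he _ n)) ?_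
      have e1 : j (φ c) * x ^ n + (φ₁ (u - i c * t ^ n) +
          (j (φ c) * (x - j e) ^ n - j (φ c) * x ^ n)) = φ₁ u := by
        rw [φ₁.map_sub, hterm]
        abel
      change subAlgIncl _ hi (j (φ c) * x ^ n + (φ₁ (u - i c * t ^ n) +
          (j (φ c) * (x - j e) ^ n - j (φ c) * x ^ n))) ∈ E.maxSub
      rw [e1]
      exact hu
    have hm : subAlgIncl _ hi (φ₁ (i c * t ^ n)) ∈ E.maxSub := by
      rw [hterm, Hom.map_mul]
      exact mul_mem_maxSub_right hcm _
    have hsplit : χ₁ u = χ₁ (u - i c * t ^ n) + i' (χ c) * t' ^ n := by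
      rw [χ₁.map_sub, χ₁.map_mul, χ₁.map_pow, hχi, hχt]
      exact (sub_add_cancel _ _).symm
    rw [hsplit]
    refine add_mem (ih _ ?_ (fun h' => by have := hn h'; omega) hc) (hnil _ (h.mem c hcm) _)
    rw [φ₁.map_sub, Hom.map_sub]
    exact sub_mem hu hm

/-- If `A⟨S⟩` has a nilpotent model, powers of cycles in `𝔪_A A⟨S⟩` become boundaries. -/
theorem IsNilModel.exists_pow_boundary {S : Set E.Y} {hS : Good S}
    {T : CDGA.{v}} {T' : CDGA.{w}} {φ : Hom T (subAlg S hS)} {χ : Hom T T'}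
    (h : IsNilModel hS φ χ)
    (h0 : ∀ u ∈ E.U.grading 0, u ∈ E.maxSub → ∃ w ∈ E.U.grading 1, E.U.d w = u)
    (hS1 : ∀ y, E.deg y ≤ 1 → y ∈ S) (hd : ∀ y ∈ S, E.U.d (E.dpow y 1) ∈ E.maxSub) {e : ℕ}
    (he : Even e) {z : E.U} (hz : z ∈ E.U.grading e) (hzS : z ∈ E.adjoin S) (hdz : E.U.d z = 0)
    (hzm : z ∈ E.maxSub) : ∃ N, ∃ b ∈ E.adjoin S, E.U.d b = z ^ N := by
  let x : subAlg S hS := ⟨z, hzS⟩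
  have hx : x ∈ (subAlg S hS).grading e := hz
  have hdx : (subAlg S hS).d x = 0 := subAlgIncl_injective S hS hdz
  obtain ⟨z', hz', hdz', b, -, hzb⟩ := exists_cycle_preimage h.exact_left hx hdx
  -- Elements of degree zero in `𝔪_A U` bound in `U`, hence in `A⟨S⟩` as it contains all variables
  -- of degree one. They then bound in `T` and in `T'` as well.
  have hK : ∀ a ∈ {x | ∃ c ∈ T.grading 0, subAlgIncl S hS (φ c) ∈ E.maxSub ∧ χ c = x},
      ∃ g ∈ T'.grading 1, T'.d g = a := by
    rintro _ ⟨c, hc, hcm, rfl⟩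
    obtain ⟨w, hw, hdw⟩ := h0 _ (φ.map_mem _ _ hc) hcm
    let w' : subAlg S hS := ⟨w, mem_adjoin_of_mem_grading hS1 hw⟩
    obtain ⟨u, -, -, hu, -⟩ := h.exact_left w' trivial c (subAlgIncl_injective S hS hdw)
      (T.d_eq_zero c hc)
    refine ⟨χ (T.pr 1 u), χ.map_mem _ _ (T.pr_mem 1 u), ?_⟩
    rw [← χ.map_d, ← T.pr_d, hu, T.pr_of_mem hc]
  have hmem := h.mem z' (by
    rw [hzb, Hom.map_sub, Hom.map_d]
    exact sub_mem hzm (d_mem_maxSub hd (subAlgIncl_mem hS b)))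
  -- In `T'` the cycle is homologous to a nilpotent element, so its `N`-th power bounds. This passes
  -- back to `T` by `χ` and forward to `A⟨S⟩` by `φ`.
  obtain ⟨n, -, ⟨N, hN⟩, b', hb'⟩ := exists_nilpotent_of_mem_nilSub hK he hmem
  rw [T'.pr_of_mem (χ.map_mem _ _ hz')] at hb'
  have hdχ : T'.d (χ z') = 0 := by rw [← χ.map_d, hdz', χ.map_zero]
  obtain ⟨b₁, -, hb₁⟩ := T'.exists_d_eq_pow_sub_pow ⊤ he (x := χ z') (y := n) (b := b') trivial
    trivial trivial (χ.map_mem _ _ hz') hdχ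
    (by rw [hb', map_add, T'.d_d, add_zero] at hdχ; exact hdχ) (by rw [hb']; abel) N
  rw [hN, sub_zero, ← χ.map_pow] at hb₁
  obtain ⟨g, -, -, hg, -⟩ := h.exact_right b₁ trivial (z' ^ N) hb₁ (T.d_pow_cycle hdz' N)
  obtain ⟨b₂, -, hb₂⟩ := (subAlg S hS).exists_d_eq_pow_sub_pow ⊤ he (x := x) (y := φ z') (b := b)
    trivial trivial trivial hx hdx (by rw [← φ.map_d, hdz', φ.map_zero]) (by rw [hzb]; abel) N
  refine ⟨N, subAlgIncl S hS (b₂ + φ g), subAlgIncl_mem hS _, ?_⟩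
  rw [← Hom.map_d, map_add, hb₂, ← φ.map_d, hg, φ.map_pow, sub_add_cancel, Hom.map_pow]
  rfl

theorem exists_pow_boundary_of_span (hQ : ∀ n : ℕ, n ≠ 0 → IsUnit (n : A))
    {T : CDGA.{v}} {T' : CDGA.{w}} {φ : Hom T A} {χ : Hom T T'}
    (hφ : φ.ConeExact ⊤) (hχ : χ.ConeExact ⊤) (hT' : T'.IsNil) {S : Set E.Y} (hS : Good S)
    (hfin : S.Finite)
    (h0 : ∀ u ∈ E.U.grading 0, u ∈ E.maxSub → ∃ w ∈ E.U.grading 1, E.U.d w = u)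
    (hS1 : ∀ y, E.deg y ≤ 1 → y ∈ S) (hd : ∀ y ∈ S, E.U.d (E.dpow y 1) ∈ E.maxSub) {e : ℕ}
    (he : Even e) {z : E.U} (hz : z ∈ E.U.grading e) (hzS : z ∈ E.adjoin S) (hdz : E.U.d z = 0)
    (hzm : z ∈ E.maxSub) : ∃ N, ∃ b ∈ E.adjoin S, E.U.d b = z ^ N := by
  have key : ∃ (hS : Good S) (T₁ : CDGA.{v}) (T₁' : CDGA.{w}) (φ₁ : Hom T₁ (subAlg S hS))
      (χ₁ : Hom T₁ T₁'), IsNilModel hS φ₁ χ₁ := by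
    refine good_induction (S₀ := ∅) hS good_empty (Set.empty_subset _)
      (hfin.subset Set.sdiff_subset) (P := fun S => ∃ (hS : Good S) (T₁ : CDGA.{v})
      (T₁' : CDGA.{w}) (φ₁ : Hom T₁ (subAlg S hS)) (χ₁ : Hom T₁ T₁'), IsNilModel hS φ₁ χ₁) ?_ ?_
    · obtain ⟨φ', h⟩ := isNilModel_empty (E := E) hφ hχ hT'
      exact ⟨good_empty, T, T', φ', χ, h⟩
    · rintro V y _ _ _ hyV hlow ⟨_, _, _, _, _, h⟩
      exact h.insert hQ hyV hlow
  obtain ⟨_, _, _, _, _, h⟩ := key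
  exact h.exists_pow_boundary h0 hS1 hd he hz hzS hdz hzm

theorem coneExact_id (B : CDGA.{u}) : (Hom.id B).ConeExact ⊤ := fun v _ _ hv _ =>
  ⟨v, 0, trivial, hv, by rw [map_zero, add_zero]; rfl⟩

/-- Either direction of the quasi-isomorphism is a span with one identity leg: `A = A → B` or `A ← B
= B`. -/
theorem exists_pow_boundary_of_isUnit (hA : IsDerivedNilpotent.{u, w} A)
    (hQ : ∀ n : ℕ, n ≠ 0 → IsUnit (n : A)) {S : Set E.Y} (hS : Good S) (hfin : S.Finite)
    (h0 : ∀ u ∈ E.U.grading 0, u ∈ E.maxSub → ∃ w ∈ E.U.grading 1, E.U.d w = u)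
    (hS1 : ∀ y, E.deg y ≤ 1 → y ∈ S) (hd : ∀ y ∈ S, E.U.d (E.dpow y 1) ∈ E.maxSub) {e : ℕ}
    (he : Even e) {z : E.U} (hz : z ∈ E.U.grading e) (hzS : z ∈ E.adjoin S) (hdz : E.U.d z = 0)
    (hzm : z ∈ E.maxSub) : ∃ N, ∃ b ∈ E.adjoin S, E.U.d b = z ^ N := by
  obtain ⟨B, _, hB, ⟨f, -, hf⟩ | ⟨f, -, hf⟩⟩ := hA
  · exact exists_pow_boundary_of_span hQ (coneExact_id A) (coneExact_of_isQuasiIso hf) hB hS hfin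
      h0 hS1 hd he hz hzS hdz hzm
  · exact exists_pow_boundary_of_span hQ (coneExact_of_isQuasiIso hf) (coneExact_id B) hB hS hfin
      h0 hS1 hd he hz hzS hdz hzm

end GammaExtension

/-! ### Application to acyclic closures and conclusion. -/

namespace AcyclicClosure

variable {A : CDGA.{u}} [A.IsLocal] (F : AcyclicClosure A.augmentation)

theorem augmentation_eq_zero {a : A} : A.augmentation a = 0 ↔ a ∈ A.maxIdeal :=
  IsLocalRing.residue_eq_zero_iff _

theorem q_eq_zero {u : F.U} (hu : u ∈ F.toGammaExtension.maxSub) : F.q u = 0 := by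
  have : F.toGammaExtension.maxSub ≤ F.q.toRingHom.toAddMonoidHom.ker :=
    GammaExtension.coefSub_le fun a ha u => by
      change F.q (F.incl a * u) = 0
      rw [F.q.map_mul, F.q_incl, augmentation_eq_zero.2 ha, zero_mul]
  exact this hu

theorem isAcyclic : F.toGammaExtension.IsAcyclic where
  exact i hi u hu hdu := by
    refine (F.q_isQuasiIso i).1 u ⟨hu, hdu⟩ ?_
    have : F.q u = 0 := (mem_trivialGrading_pos _ hi.ne').1 (F.q.map_mem i u hu)
    rw [this]
    exact zero_mem _
  one_ne w hw := by
    have h := F.q.map_d w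
    rw [hw, F.q.map_one] at h
    exact one_ne_zero (α := IsLocalRing.ResidueField A.zeroRing) h

theorem exists_d_eq (u : F.U) (hu : u ∈ F.U.grading 0) (hm : u ∈ F.toGammaExtension.maxSub) :
    ∃ w ∈ F.U.grading 1, F.U.d w = u := by
  refine (F.q_isQuasiIso 0).1 u ⟨hu, F.U.d_eq_zero u hu⟩ ?_
  rw [F.q_eq_zero hm]
  exact zero_mem _

/-- The augmentation `U → 𝐤` kills boundaries and `𝔪_A U`, so it sends `a` to zero. -/
theorem mem_maxIdeal_of_sub_mem (u : F.U) (a : A)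
    (h : F.U.d u - F.incl a ∈ F.toGammaExtension.maxSub) : a ∈ A.maxIdeal := by
  have h1 := F.q_eq_zero h
  have h2 : F.q (F.U.d u) = 0 := F.q.map_d u
  rw [F.q.map_sub, h2, zero_sub, neg_eq_zero, F.q_incl] at h1
  exact augmentation_eq_zero.1 h1

/-- Powers of the boundary of a variable of odd degree become boundaries. -/
theorem exists_dvar_pow_boundary (hA : IsDerivedNilpotent.{u, w} A) {q : ℕ} (hq : 1 < q)
    (hodd : Odd q) {y : F.Y} (hy : F.deg y = q) :
    ∃ N, ∃ b ∈ F.toGammaExtension.adjoin {y | F.deg y < q},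
      F.U.d b = F.U.d (F.dpow y 1) ^ N := by
  have hS : GammaExtension.Good {y : F.Y | F.deg y < q} := GammaExtension.good_deg_lt q
  -- An odd `q > 1` is at least three. So `∂y` has positive even degree, and `S` contains the
  -- variables of degree one needed for `π` and for bounding `𝔪_A` in degree zero.
  obtain ⟨e, rfl⟩ : ∃ e, q = e + 2 + 1 := ⟨q - 3, by obtain ⟨s, hs⟩ := hodd; omega⟩
  have he : Even e := by
    obtain ⟨s, hs⟩ := hodd
    exact ⟨s - 1, by omega⟩
  have hS1 : ∀ y : F.Y, F.deg y ≤ 1 → y ∈ {y : F.Y | F.deg y < e + 2 + 1} := fun y hy => by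
    change F.deg y < e + 2 + 1
    omega
  have hz : F.U.d (F.dpow y 1) ∈ F.U.grading (e + 2) := F.U.d_mem _ _ (hy ▸ GammaExtension.var_mem y)
  have hzS : F.U.d (F.dpow y 1) ∈ F.toGammaExtension.adjoin {y : F.Y | F.deg y < e + 2 + 1} :=
    GammaExtension.dvar_mem_adjoin fun y' hy' => lt_of_lt_of_eq hy' hy
  obtain ⟨p, hp⟩ := CharP.exists (IsLocalRing.ResidueField A.zeroRing)
  have hnat : ∀ n : ℕ, (n : A) ∈ A.maxIdeal ↔ p ∣ n := fun n => by
    rw [← CharP.cast_eq_zero_iff (IsLocalRing.ResidueField A.zeroRing) p n,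
      ← augmentation_eq_zero]
    exact iff_of_eq (congrArg (· = _) (map_natCast A.augmentation.toRingHom n))
  rcases CharP.char_is_prime_or_zero (IsLocalRing.ResidueField A.zeroRing) p with hp' | rfl
  · have hpm : (p : F.U) ∈ F.toGammaExtension.maxSub := by
      rw [← map_natCast F.incl.toRingHom p]
      exact GammaExtension.incl_mem_maxSub ((hnat p).2 dvd_rfl)
    have hp0 : (p : F.U) ∈ F.U.grading 0 := by
      rw [← nsmul_one]
      exact nsmul_mem F.U.one_mem p
    obtain ⟨π, hπ, hdπ⟩ := F.exists_d_eq _ hp0 hpm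
    exact GammaExtension.exists_pow_boundary_of_prime hA hS hp' hπ
      (GammaExtension.mem_adjoin_of_mem_grading hS1 hπ) hdπ he hz hzS (F.U.d_d _)
  · have hQ : ∀ n : ℕ, n ≠ 0 → IsUnit (n : A) := by
      intro n hn
      have h1 : (n : A) ∉ A.maxIdeal := fun h => hn (zero_dvd_iff.1 ((hnat n).1 h))
      rw [mem_maxIdeal, map_natCast, IsLocalRing.mem_maximalIdeal, mem_nonunits_iff, not_not] at h1
      simpa using h1.map A.zeroRing.subtype
    have hd := GammaExtension.dvar_mem_maxSub F.isAcyclic F.isMinimal hQ F.exists_d_eq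
      F.mem_maxIdeal_of_sub_mem
    exact GammaExtension.exists_pow_boundary_of_isUnit hA hQ hS (GammaExtension.finite_deg_lt _) F.exists_d_eq
      hS1 (fun y _ => hd y) (he.add (by decide)) hz hzS (F.U.d_d _) (hd y)

end AcyclicClosure

end CDGA

theorem theorem4p4 (A : CDGA.{u}) [A.IsLocal] (hA : CDGA.IsDerivedNilpotent.{u, w} A)
    (q : ℕ) (hq : 1 < q) (hodd : Odd q) (hε : A.deviation q ≠ 0) :
    ∃ i : ℕ, Even i ∧ q < i ∧ A.deviation i ≠ 0 := by
  by_contra! hcon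
  have hne : Nonempty (CDGA.AcyclicClosure A.augmentation) := by
    by_contra h
    -- The default value zero of the deviation is excluded by `hε`.
    exact hε (dif_neg h)
  have hdev : ∀ i, A.deviation i = Nat.card {y : hne.some.Y // hne.some.deg y = i} :=
    fun i => dif_pos hne
  set F := hne.some
  have hY : ∀ y : F.Y, q ≤ F.deg y → Odd (F.deg y) := by
    intro y hy
    by_contra h
    have heven := Nat.not_odd_iff_even.1 h
    have hlt : q < F.deg y := lt_of_le_of_ne hy fun h' => h (h' ▸ hodd)
    have h0 := hcon _ heven hlt
    rw [hdev, Nat.card_eq_zero] at h0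
    -- `Nat.card` also vanishes on infinite types; finiteness in each degree rules this out.
    rcases h0 with h0 | h0
    · exact h0.false ⟨y, rfl⟩
    · exact h0.not_finite (F.finite_deg _)
  obtain ⟨y, hy⟩ : ∃ y : F.Y, F.deg y = q := by
    by_contra! h
    refine hε ((hdev q).trans ?_)
    rw [Nat.card_eq_zero]
    exact Or.inl ⟨fun y => h y.1 y.2⟩
  obtain ⟨N, b, hb, hdb⟩ := F.exists_dvar_pow_boundary hA hq hodd hy
  exact CDGA.GammaExtension.dvar_pow_ne_boundary F.isAcyclic hq hodd hY hy N hb hdb
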